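/- **Setting.** Let $G$ be a semisimple Lie group whose Lie algebra has a $|k|$-grading $\mathfrak g=\mathfrak g_{-k}\oplus\cdots\oplus\mathfrak g_k$ (that is, $[\mathfrak g_i,\mathfrak g_j]\subseteq\mathfrak g_{i+j}$ and $\mathfrak g_-=\bigoplus_{i<0}\mathfrak g_i$ is generated by $\mathfrak g_{-1}$), and let $P\subset G$ be a closed subgroup with Lie algebra $\mathfrak p=\mathfrak g_0\oplus\mathfrak p_+$, $\mathfrak p_+=\bigoplus_{i>0}\mathfrak g_i$. Put $G_0=\{g\in P:\mathrm{Ad}(g)\mathfrak g_i=\mathfrak g_i\ \forall i\}$ and $P_+=\exp(\mathfrak p_+)$. Let $(\pi:\mathcal G\to M,\omega)$ be a parabolic geometry of type $(G,P)$: a smooth principal $P$-bundle with a Cartan connection $\omega\in\Omega^1(\mathcal G,\mathfrak g)$. Let $\mathcal G_0=\mathcal G/P_+$, with projections $\pi_+:\mathcal G\to\mathcal G_0$ and $\pi_0:\mathcal G_0\to M$. A *Weyl structure* is a smooth $G_0$-equivariant section $\sigma:\mathcal G_0\to\mathcal G$ of $\pi_+$; write $\sigma^*\omega=\sum_i\sigma^*\omega_i$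 for the decomposition by the grading and $\sigma^*\omega_\le=\sum_{i\le0}\sigma^*\omega_i$. Fix a nonzero element $E_\lambda$ of the center of $\mathfrak g_0$ such that $\mathrm{ad}(E_\lambda)$ acts by a real scalar on each $\mathfrak g_i$, and a continuous homomorphism $\lambda:G_0\to\mathbb R_+$ with derivative $\lambda'(A)=B(E_\lambda,A)$, $B$ the Killing form. Let $\mathcal L^\lambda=\mathcal G_0/\mathrm{Ker}(\lambda)\to M$ be the scale bundle, with projection $\pi_\lambda:\mathcal G_0\to\mathcal L^\lambda$, and let $\sigma^\lambda\in\Omega^1(\mathcal L^\lambda)$ be the principal connection with $\pi_\lambda^*\sigma^\lambda=\lambda'\circ\sigma^*\omega_0$. The Weyl structure $\sigma$ is *exact*, corresponding to the global smooth section $s_\sigma$ of $\mathcal L^\lambda\to M$, if $\sigma^\lambda$ is the trivial connection induced by $s_\sigma$ (its horizontal spaces are the translates under $\mathbb R_+$ of the tangent spaces of $s_\sigma(M)$); then $\overline{\mathcal G}_0=\pi_\lambda^{-1}(s_\sigma(M))\subset\mathcal G_0$ is the corresponding reduction to $\mathrm{Ker}(\lambda)$, with inclusion $r$, and $\overline\sigma=\sigma\circ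 r$. For a principal $K$-bundle $Q$ with a vector-valued one-form $\theta$, $\mathrm{Aut}(Q,\theta)$ is the set of principal bundle automorphisms $\Psi$ with $\Psi^*\theta=\theta$, and $\mathrm{inf}(Q,\theta)$ is the set of $K$-invariant smooth vector fields $\mathbf Y$ with $\mathcal L_{\mathbf Y}\theta=0$. Any $\Phi\in\mathrm{Aut}(\mathcal G,\omega)$ induces maps $\Phi_0,\Phi_\lambda,\varphi$ of $\mathcal G_0,\mathcal L^\lambda,M$, and any $\mathbf X\in\mathrm{inf}(\mathcal G,\omega)$ projects to vector fields $\mathbf X_0,\mathbf X_\lambda,X$ on these. Define - $\Phi\in\mathrm{Aut}(\sigma)$ iff $\Phi^{-1}\circ\sigma\circ\Phi_0=\sigma$; for $\sigma$ exact, $\Phi\in\mathrm{Aut}(\overline\sigma)$ (an *exact automorphism*) iff $\Phi_\lambda^{-1}\circ s_\sigma\circ\varphi=s_\sigma$; - $\mathbf X\in\mathrm{inf}(\sigma)$ iff $\frac{d}{dt}\big|_{t=0}\,\mathrm{Fl}^{\mathbf X}_{-t}\circ\sigma\circ\mathrm{Fl}^{\mathbf X_0}_t=0$; for $\sigma$ exact,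 $\mathbf X\in\mathrm{inf}(\overline\sigma)$ iff $\frac{d}{dt}\big|_{t=0}\,\mathrm{Fl}^{\mathbf X_\lambda}_{-t}\circ s_\sigma\circ\mathrm{Fl}^{X}_t=0$ (pointwise derivatives, $\mathrm{Fl}$ denoting local flows). **Lemma.** Let $\sigma$ be a Weyl structure. 1. For $\Phi\in\mathrm{Aut}(\mathcal G,\omega)$ the following are equivalent: (i) $\Phi\in\mathrm{Aut}(\sigma)$; (ii) $\Phi_0\in\mathrm{Aut}(\mathcal G_0,\sigma^*\omega_\le)$; (iii) $\Phi_\lambda^*\sigma^\lambda=\sigma^\lambda$. 2. If $\sigma$ is exact, then $\Phi\in\mathrm{Aut}(\overline\sigma)$ if and only if $\Phi_0(\overline{\mathcal G}_0)\subseteq\overline{\mathcal G}_0$ and the restriction of $\Phi_0$ to $\overline{\mathcal G}_0$ belongs to $\mathrm{Aut}(\overline{\mathcal G}_0,\overline\sigma^*\omega_\le)$. 3. For $\mathbf X\in\mathrm{inf}(\mathcal G,\omega)$: $\mathbf X\in\mathrm{inf}(\sigma)$ if and only if $\mathbf X_0\in\mathrm{inf}(\mathcal G_0,\sigma^*\omega_\le)$.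 4. If $\sigma$ is exact, then $\mathbf X\in\mathrm{inf}(\overline\sigma)$ if and only if the restriction of $\mathbf X_0$ to $\overline{\mathcal G}_0$ is tangent to $\overline{\mathcal G}_0$ and induces an element of $\mathrm{inf}(\overline{\mathcal G}_0,\overline\sigma^*\omega_\le)$. -/

import Mathlib

open scoped Manifold ContDiff RightActions

namespace ParabolicWeyl

set_option linter.unusedSectionVars false

instance instLEInftyMinSmoothness : ENat.LEInfty (minSmoothness ℝ 3) := ⟨by simp; decide⟩

instance instCompleteOfFiniteDimensional (E : Type*) [NormedAddCommGroup E] [NormedSpace ℝ E]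
    [FiniteDimensional ℝ E] : CompleteSpace E := FiniteDimensional.complete ℝ E

/-! ### Vector fields, flows and vector-valued one-forms -/

section Forms

variable {E : Type*} [NormedAddCommGroup E] [NormedSpace ℝ E]
  {X : Type*} [TopologicalSpace X] [ChartedSpace E X] [IsManifold 𝓘(ℝ, E) ∞ X]
  {E' : Type*} [NormedAddCommGroup E'] [NormedSpace ℝ E']
  {Y : Type*} [TopologicalSpace Y] [ChartedSpace E' Y]
  {F : Type*} [AddCommGroup F] [Module ℝ F]

/-- (Not necessarily smooth) vector fields on `X`. -/
abbrev VField (E : Type*) [NormedAddCommGroup E] [NormedSpace ℝ E]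
    (X : Type*) [TopologicalSpace X] [ChartedSpace E X] : Type _ :=
  ∀ x : X, TangentSpace 𝓘(ℝ, E) x

/-- (Not necessarily smooth) `F`-valued one-forms on `X`. -/
abbrev OneForm (E : Type*) [NormedAddCommGroup E] [NormedSpace ℝ E]
    (X : Type*) [TopologicalSpace X] [ChartedSpace E X]
    (F : Type*) [AddCommGroup F] [Module ℝ F] : Type _ :=
  ∀ x : X, TangentSpace 𝓘(ℝ, E) x →ₗ[ℝ] F

/-- The pullback `f^* θ`. -/
noncomputable def pullbackForm (f : X → Y) (θ : OneForm E' Y F) : OneForm E X F :=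
  fun x => (θ (f x)).comp (mfderiv 𝓘(ℝ, E) 𝓘(ℝ, E') f x).toLinearMap

/-- A form with values in a (finite-dimensional) vector space is smooth if all its scalar
components are smooth as functions on the tangent bundle. -/
def SmoothForm (θ : OneForm E X F) : Prop :=
  ∀ l : F →ₗ[ℝ] ℝ, ContMDiff 𝓘(ℝ, E).tangent 𝓘(ℝ, ℝ) ∞
    (fun v : TangentBundle 𝓘(ℝ, E) X => l (θ v.proj v.snd))

/-- Smooth vector fields. -/
def SmoothField (V : VField E X) : Prop :=
  ContMDiff 𝓘(ℝ, E) 𝓘(ℝ, E).tangent ∞ (fun x => (⟨x, V x⟩ : TangentBundle 𝓘(ℝ, E) X))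

/-- `L_V θ = 0`, by the formula `(L_V θ)(Z) = V (θ (Z)) - θ ([V, Z])` for vector fields `Z` which
are defined and smooth near the given point (applied to all scalar components of `θ`). -/
def LieDerivFormZero (V : VField E X) (θ : OneForm E X F) : Prop :=
  ∀ (x : X) (Z : VField E X),
    ContMDiffAt 𝓘(ℝ, E) 𝓘(ℝ, E).tangent ∞
      (fun y => (⟨y, Z y⟩ : TangentBundle 𝓘(ℝ, E) X)) x →
    ∀ l : F →ₗ[ℝ] ℝ,
      mfderiv 𝓘(ℝ, E) 𝓘(ℝ, ℝ) (fun y => l (θ y (Z y))) x (V x)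
        = l (θ x (VectorField.mlieBracket 𝓘(ℝ, E) V Z x))

open Classical in
/-- The local flow of a vector field: `flow V t x` is the value at time `t` of an integral curve of
`V` which starts at `x` and is defined on an open interval containing `0` and `t` (and `x` if there
is no such curve). For a smooth vector field on a Hausdorff manifold without boundary this does not
depend on the choice of the integral curve. -/
noncomputable def flow (V : VField E X) (t : ℝ) (x : X) : X :=
  if h : ∃ y : X, ∃ (a b : ℝ) (c : ℝ → X), (0 : ℝ) ∈ Set.Ioo a b ∧ t ∈ Set.Ioo a b ∧ c 0 = x ∧
      IsMIntegralCurveOn (I := 𝓘(ℝ, E)) c V (Set.Ioo a b) ∧ c t = y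
  then h.choose else x

/-- Automorphisms of a pair `(X, θ)`, for `X` a manifold with right translations
`R : K → X → X` by a group `K` (a principal `K`-bundle) and `θ` a one-form on it: equivariant
diffeomorphisms `Φ` (i.e. principal bundle automorphisms) with `Φ^* θ = θ`. -/
structure GeomAut {K : Type*} (R : K → X → X) (θ : OneForm E X F) where
  toDiffeo : X ≃ₘ^∞⟮𝓘(ℝ, E), 𝓘(ℝ, E)⟯ X
  equivariant : ∀ k x, toDiffeo (R k x) = R k (toDiffeo x)
  preserves : pullbackForm toDiffeo θ = θ

/-- Infinitesimal automorphisms of a pair `(X, θ)` as above: smooth vector fields `V` with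
`(R_k)_* V = V` for all `k` and `L_V θ = 0`. -/
structure InfAut {K : Type*} (R : K → X → X) (θ : OneForm E X F) where
  field : VField E X
  smooth : SmoothField field
  invariant : ∀ k x, mfderiv 𝓘(ℝ, E) 𝓘(ℝ, E) (R k) x (field x) = field (R k x)
  lie : LieDerivFormZero field θ

lemma GeomAut.symm_equivariant {K : Type*} {R : K → X → X} {θ : OneForm E X F}
    (Φ : GeomAut R θ) (k : K) (x : X) :
    Φ.toDiffeo.symm (R k x) = R k (Φ.toDiffeo.symm x) := by
  have h := Φ.equivariant k (Φ.toDiffeo.symm x)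
  rw [Φ.toDiffeo.apply_symm_apply] at h
  rw [← h, Φ.toDiffeo.symm_apply_apply]

end Forms

/-! ### Graded Lie algebras -/

/-- A `|k|`-grading `L = L_{-k} ⊕ ... ⊕ L_k` of a real Lie algebra, with
`L_- = L_{-k} ⊕ ... ⊕ L_{-1}` generated by `L_{-1}`. -/
structure Grading (L : Type*) [LieRing L] [LieAlgebra ℝ L] (k : ℕ) where
  comp : ℤ → Submodule ℝ L
  isInternal : DirectSum.IsInternal comp
  eq_bot : ∀ i : ℤ, (k : ℤ) < |i| → comp i = ⊥
  lie_mem : ∀ (i j : ℤ) (x y : L), x ∈ comp i → y ∈ comp j → ⁅x, y⁆ ∈ comp (i + j)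
  generated : (LieSubalgebra.lieSpan ℝ L (comp (-1) : Set L)).toSubmodule
    = ⨆ (i : ℤ) (_ : i < 0), comp i

namespace Grading

variable {L : Type*} [LieRing L] [LieAlgebra ℝ L] {k : ℕ} (gr : Grading L k)

/-- `𝔭 = L_0 ⊕ ... ⊕ L_k`. -/
def nonneg : Submodule ℝ L := ⨆ (i : ℤ) (_ : 0 ≤ i), gr.comp i

/-- `𝔭_+ = L_1 ⊕ ... ⊕ L_k`. -/
def pos : Submodule ℝ L := ⨆ (i : ℤ) (_ : 0 < i), gr.comp i

lemma bijective_coe : Function.Bijective (DirectSum.coeLinearMap gr.comp) := gr.isInternal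

/-- The projection of `L` onto `L_i` along the other components. -/
noncomputable def proj (i : ℤ) : L →ₗ[ℝ] L :=
  (gr.comp i).subtype ∘ₗ (DirectSum.component ℝ ℤ (fun j => gr.comp j) i) ∘ₗ
    (LinearEquiv.ofBijective (DirectSum.coeLinearMap gr.comp) gr.bijective_coe).symm.toLinearMap

/-- The projection of `L` onto `𝔭^* = L_{-k} ⊕ ... ⊕ L_0` along `𝔭_+`. -/
noncomputable def projLe : L →ₗ[ℝ] L := ∑ i ∈ Finset.Icc (-(k : ℤ)) 0, gr.proj i

/-- The element `Z` (usually denoted `E_λ`) is a nonzero element of the center of `L_0` such that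
`ad Z` acts by a real scalar on every component `L_i`. -/
structure IsScaling (Z : L) : Prop where
  ne_zero : Z ≠ 0
  mem : Z ∈ gr.comp 0
  central : ∀ A ∈ gr.comp 0, ⁅Z, A⁆ = 0
  scalar : ∀ i : ℤ, ∃ c : ℝ, ∀ A ∈ gr.comp i, ⁅Z, A⁆ = c • A

end Grading

/-! ### Parabolic subgroups of semisimple Lie groups -/

section Groups

variable (EG : Type*) [NormedAddCommGroup EG] [NormedSpace ℝ EG]
  {G : Type*} [TopologicalSpace G] [ChartedSpace EG G] [Group G]

/-- The adjoint action: the derivative at `1` of the conjugation by `g`. -/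
noncomputable def Ad (g : G) :
    GroupLieAlgebra 𝓘(ℝ, EG) G →ₗ[ℝ] GroupLieAlgebra 𝓘(ℝ, EG) G :=
  (show TangentSpace 𝓘(ℝ, EG) (1 : G) →L[ℝ] TangentSpace 𝓘(ℝ, EG) (1 : G) from
    mfderiv 𝓘(ℝ, EG) 𝓘(ℝ, EG) (fun x : G => g * x * g⁻¹) 1).toLinearMap

/-- `c` is the one-parameter subgroup `t ↦ exp (t A)`. -/
structure IsExpCurve (A : GroupLieAlgebra 𝓘(ℝ, EG) G) (c : ℝ → G) : Prop where
  map_add : ∀ s t, c (s + t) = c s * c t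
  smooth : ContMDiff 𝓘(ℝ, ℝ) 𝓘(ℝ, EG) ∞ c
  velocity : (mfderiv 𝓘(ℝ, ℝ) 𝓘(ℝ, EG) c 0 (1 : ℝ) : GroupLieAlgebra 𝓘(ℝ, EG) G) = A

variable [LieGroup 𝓘(ℝ, EG) ∞ G]

lemma mdifferentiableAt_conj (g x : G) :
    MDifferentiableAt 𝓘(ℝ, EG) 𝓘(ℝ, EG) (fun x : G => g * x * g⁻¹) x := by
  have h : ContMDiff 𝓘(ℝ, EG) 𝓘(ℝ, EG) ∞ (fun x : G => g * x * g⁻¹) :=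
    (contMDiff_const.mul contMDiff_id).mul contMDiff_const
  exact (h x).mdifferentiableAt (by simp)

lemma Ad_one (A : GroupLieAlgebra 𝓘(ℝ, EG) G) : Ad EG (1 : G) A = A := by
  have h : (fun x : G => 1 * x * (1 : G)⁻¹) = id := by funext x; simp
  have h2 := congrArg (fun f : G → G => fun v : EG =>
    (show EG from mfderiv 𝓘(ℝ, EG) 𝓘(ℝ, EG) f 1 v)) h
  have h3 := congrFun h2 A
  refine h3.trans ?_
  have h4 := congrFun (congrArg DFunLike.coe (mfderiv_id (I := 𝓘(ℝ, EG)) (x := (1 : G)))) A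
  exact h4

lemma mfderiv_conj_comp {F : Type*} [NormedAddCommGroup F] [NormedSpace ℝ F]
    {N : Type*} [TopologicalSpace N] [ChartedSpace F N] (g : G) (f : N → G) (x : N) (hx : f x = 1)
    (hf : MDifferentiableAt 𝓘(ℝ, F) 𝓘(ℝ, EG) f x) (v : TangentSpace 𝓘(ℝ, F) x) :
    (mfderiv 𝓘(ℝ, F) 𝓘(ℝ, EG) (fun y => g * f y * g⁻¹) x v : EG)
      = Ad EG g (show GroupLieAlgebra 𝓘(ℝ, EG) G from mfderiv 𝓘(ℝ, F) 𝓘(ℝ, EG) f x v) := by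
  have h := mfderiv_comp x (mdifferentiableAt_conj EG g (f x)) hf
  have h1 := congrFun (congrArg DFunLike.coe h) v
  refine h1.trans ?_
  have key : ∀ (p : G), p = 1 → ∀ w : EG,
      (show EG from mfderiv 𝓘(ℝ, EG) 𝓘(ℝ, EG) (fun x : G => g * x * g⁻¹) p w) = Ad EG g w := by
    rintro p rfl w; rfl
  exact key (f x) hx _

lemma Ad_mul (g h : G) (A : GroupLieAlgebra 𝓘(ℝ, EG) G) :
    Ad EG (g * h) A = Ad EG g (Ad EG h A) := by
  have e : (fun x : G => (g * h) * x * (g * h)⁻¹) = (fun x : G => g * (h * x * h⁻¹) * g⁻¹) := by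
    funext x; group
  have h2 := congrArg (fun f : G → G => fun v : EG =>
    (show EG from mfderiv 𝓘(ℝ, EG) 𝓘(ℝ, EG) f 1 v)) e
  have h3 := congrFun h2 A
  refine h3.trans ?_
  exact mfderiv_conj_comp EG g (fun x : G => h * x * h⁻¹) 1 (by simp)
    (mdifferentiableAt_conj EG h 1) A

variable {EG} [FiniteDimensional ℝ EG] {k : ℕ} (gr : Grading (GroupLieAlgebra 𝓘(ℝ, EG) G) k)
  (P : Subgroup G)

/-- `P` (with its structure of an embedded Lie subgroup of `G`) is a parabolic subgroup for the
given `|k|`-grading of the Lie algebra of `G`: it is closed and its Lie algebra is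
`𝔭 = 𝔤_0 ⊕ ... ⊕ 𝔤_k`. (For `𝔤` semisimple, the subalgebras `𝔭` of this form are exactly the
parabolic subalgebras.) -/
structure IsParabolicSubgroup (EP : Type*) [NormedAddCommGroup EP] [NormedSpace ℝ EP]
    [ChartedSpace EP P] : Prop where
  isClosed : IsClosed (P : Set G)
  embedded : Manifold.IsSmoothEmbedding 𝓘(ℝ, EP) 𝓘(ℝ, EG) ∞ (fun p : P => (p : G))
  lieAlgebra : ∀ A : GroupLieAlgebra 𝓘(ℝ, EG) G, A ∈ gr.nonneg ↔
    ∃ B : GroupLieAlgebra 𝓘(ℝ, EP) P,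
      mfderiv 𝓘(ℝ, EP) 𝓘(ℝ, EG) (fun p : P => (p : G)) 1 B = A

/-- The Levi subgroup `G_0 ⊆ P` of all elements whose adjoint action preserves the grading. -/
def levi : Subgroup P where
  carrier := {p | ∀ i, (gr.comp i).map (Ad EG (p : G)) = gr.comp i}
  one_mem' := by
    intro i
    ext A
    simp [Ad_one]
  mul_mem' := by
    intro p q hp hq i
    have h : Ad EG ((p * q : P) : G) = Ad EG (p : G) ∘ₗ Ad EG (q : G) :=
      LinearMap.ext fun A => Ad_mul EG (p : G) (q : G) A
    rw [h, Submodule.map_comp, hq i, hp i]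
  inv_mem' := by
    intro p hp i
    have h : Ad EG ((p⁻¹ : P) : G) ∘ₗ Ad EG (p : G) = LinearMap.id := by
      refine LinearMap.ext fun A => ?_
      have := Ad_mul EG ((p⁻¹ : P) : G) (p : G) A
      rw [← Subgroup.coe_mul, inv_mul_cancel, Subgroup.coe_one, Ad_one] at this
      exact this.symm
    conv_lhs => rw [← hp i]
    rw [← Submodule.map_comp, h, Submodule.map_id]

/-- The subgroup `P_+ = exp (𝔭_+)` of `P`, as the subgroup generated by `exp (𝔭_+)`. -/
def unip : Subgroup P :=
  Subgroup.closure {p | ∃ A ∈ gr.pos, ∃ c : ℝ → G, IsExpCurve EG A c ∧ c 1 = p}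

variable {gr P}

lemma Ad_mem_pos {g : P} (hg : g ∈ levi gr P) {A : GroupLieAlgebra 𝓘(ℝ, EG) G}
    (hA : A ∈ gr.pos) : Ad EG (g : G) A ∈ gr.pos := by
  have h : gr.pos.map (Ad EG (g : G)) = gr.pos := by
    simp only [Grading.pos, Submodule.map_iSup]
    exact iSup_congr fun i => iSup_congr fun _ => hg i
  rw [← h]
  exact Submodule.mem_map_of_mem hA

lemma conj_mem_unip {g : P} (hg : g ∈ levi gr P) {p : P} (hp : p ∈ unip gr P) :
    g * p * g⁻¹ ∈ unip gr P := by
  have h : unip gr P ≤ (unip gr P).comap (MulAut.conj g).toMonoidHom := by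
    refine (Subgroup.closure_le _).2 ?_
    rintro q ⟨A, hA, c, hc, hq⟩
    refine Subgroup.subset_closure ⟨Ad EG (g : G) A, Ad_mem_pos hg hA,
      fun t => (g : G) * c t * (g : G)⁻¹, ⟨?_, ?_, ?_⟩, ?_⟩
    · intro s t
      rw [hc.map_add]
      group
    · exact (contMDiff_const.mul hc.smooth).mul contMDiff_const
    · have h0 : c 0 = 1 := by
        have := hc.map_add 0 0
        simpa using this
      have h1 := mfderiv_conj_comp EG (g : G) c 0 h0 ((hc.smooth 0).mdifferentiableAt (by simp))
        (1 : ℝ)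
      refine h1.trans ?_
      exact congrArg (Ad EG (g : G)) hc.velocity
    · simp [hq]
  exact h hp

/-- A scale representation: a continuous homomorphism `λ : G_0 → ℝ_+` whose derivative at the
identity (along curves in `G_0`) is `λ'(A) = B(Z, A)`, with `B` the Killing form and `Z = E_λ`. -/
structure ScaleRep (gr : Grading (GroupLieAlgebra 𝓘(ℝ, EG) G) k) (P : Subgroup G)
    (Z : GroupLieAlgebra 𝓘(ℝ, EG) G) where
  hom : levi gr P →* {r : ℝ // 0 < r}
  continuous_hom : Continuous hom
  deriv_hom : ∀ (c : ℝ → levi gr P) (A : GroupLieAlgebra 𝓘(ℝ, EG) G), c 0 = 1 →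
    HasMFDerivAt 𝓘(ℝ, ℝ) 𝓘(ℝ, EG) (fun t => ((c t : P) : G)) 0
      ((1 : ℝ →L[ℝ] ℝ).smulRight (show EG from A)) →
    HasDerivAt (fun t => (hom (c t) : ℝ)) (killingForm ℝ (GroupLieAlgebra 𝓘(ℝ, EG) G) Z A) 0

end Groups

/-! ### Cartan geometries -/

section Bundles

variable {EG : Type*} [NormedAddCommGroup EG] [NormedSpace ℝ EG] [FiniteDimensional ℝ EG]
  {G : Type*} [TopologicalSpace G] [ChartedSpace EG G] [Group G] [LieGroup 𝓘(ℝ, EG) ∞ G]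
  {EP : Type*} [NormedAddCommGroup EP] [NormedSpace ℝ EP]
  (P : Subgroup G) [ChartedSpace EP P]
  {EB : Type*} [NormedAddCommGroup EB] [NormedSpace ℝ EB]
  {B : Type*} [TopologicalSpace B] [ChartedSpace EB B] [IsManifold 𝓘(ℝ, EB) ∞ B]
  [MulAction (↥P)ᵐᵒᵖ B]
  {EM : Type*} [NormedAddCommGroup EM] [NormedSpace ℝ EM]
  {M : Type*} [TopologicalSpace M] [ChartedSpace EM M]

/-- `π : B → M` is a smooth principal `P`-bundle (for the given right action of `P` on `B`). A
local trivialization over `U` is `u ↦ (π u, e u) ∈ U × P`, with inverse `(y, p) ↦ s y · p`. -/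
structure IsPrincipalBundle (EP EB EM : Type*) [NormedAddCommGroup EP] [NormedSpace ℝ EP]
    [NormedAddCommGroup EB] [NormedSpace ℝ EB] [NormedAddCommGroup EM] [NormedSpace ℝ EM]
    (P : Subgroup G) [ChartedSpace EP P] {B : Type*} [TopologicalSpace B] [ChartedSpace EB B]
    [MulAction (↥P)ᵐᵒᵖ B] {M : Type*} [TopologicalSpace M] [ChartedSpace EM M]
    (π : B → M) : Prop where
  smooth_act : ContMDiff (𝓘(ℝ, EB).prod 𝓘(ℝ, EP)) 𝓘(ℝ, EB) ∞ (fun q : B × P => q.1 <• q.2)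
  smooth_proj : ContMDiff 𝓘(ℝ, EB) 𝓘(ℝ, EM) ∞ π
  proj_act : ∀ (u : B) (p : P), π (u <• p) = π u
  locally_trivial : ∀ x : M, ∃ U : Set M, IsOpen U ∧ x ∈ U ∧ ∃ (e : B → P) (s : M → B),
    ContMDiffOn 𝓘(ℝ, EB) 𝓘(ℝ, EP) ∞ e (π ⁻¹' U) ∧ ContMDiffOn 𝓘(ℝ, EM) 𝓘(ℝ, EB) ∞ s U ∧
    (∀ y ∈ U, π (s y) = y) ∧ (∀ u, π u ∈ U → ∀ p : P, e (u <• p) = e u * p) ∧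
    (∀ u, π u ∈ U → s (π u) <• e u = u)

/-- The right translations on a bundle with structure group `P`. -/
def rightAct (B : Type*) [MulAction (↥P)ᵐᵒᵖ B] (p : P) (u : B) : B := u <• p

variable (EG) in
/-- A Cartan geometry of type `(G, P)` with total space `B` and base `M`: a principal `P`-bundle
`B → M` with a Cartan connection. -/
structure CartanGeometry (EP EB EM : Type*) [NormedAddCommGroup EP] [NormedSpace ℝ EP]
    [NormedAddCommGroup EB] [NormedSpace ℝ EB] [NormedAddCommGroup EM] [NormedSpace ℝ EM]
    (P : Subgroup G) [ChartedSpace EP P] (B : Type*) [TopologicalSpace B] [ChartedSpace EB B]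
    [IsManifold 𝓘(ℝ, EB) ∞ B]
    [MulAction (↥P)ᵐᵒᵖ B] (M : Type*) [TopologicalSpace M] [ChartedSpace EM M] where
  proj : B → M
  principal : IsPrincipalBundle EP EB EM P proj
  form : OneForm EB B (GroupLieAlgebra 𝓘(ℝ, EG) G)
  smooth_form : SmoothForm form
  equivariant : ∀ (p : P) (u : B) (v : TangentSpace 𝓘(ℝ, EB) u),
    form (u <• p) (mfderiv 𝓘(ℝ, EB) 𝓘(ℝ, EB) (rightAct P B p) u v)
      = Ad EG ((p⁻¹ : P) : G) (form u v)
  fundamental : ∀ (u : B) (A : GroupLieAlgebra 𝓘(ℝ, EP) P),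
    form u (mfderiv 𝓘(ℝ, EP) 𝓘(ℝ, EB) (fun p : P => u <• p) 1 A)
      = mfderiv 𝓘(ℝ, EP) 𝓘(ℝ, EG) (fun p : P => (p : G)) 1 A
  bijective : ∀ u : B, Function.Bijective (form u)

end Bundles

/-! ### The bundles `𝒢_0 = 𝒢 / P_+` and `𝓛^λ = 𝒢_0 / Ker λ` -/

section Quotients

variable {EG : Type*} [NormedAddCommGroup EG] [NormedSpace ℝ EG] [FiniteDimensional ℝ EG]
  {G : Type*} [TopologicalSpace G] [ChartedSpace EG G] [Group G] [LieGroup 𝓘(ℝ, EG) ∞ G]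
  {k : ℕ} (gr : Grading (GroupLieAlgebra 𝓘(ℝ, EG) G) k)
  (P : Subgroup G) (B : Type*) [MulAction (↥P)ᵐᵒᵖ B]

/-- Two points of `B` are equivalent if they lie in the same `P_+`-orbit. -/
def plusSetoid : Setoid B where
  r u v := ∃ p ∈ unip gr P, u <• p = v
  iseqv := by
    refine ⟨fun u => ⟨1, one_mem _, by simp⟩, ?_, ?_⟩
    · rintro u v ⟨p, hp, rfl⟩
      exact ⟨p⁻¹, inv_mem hp, by simp⟩
    · rintro u v w ⟨p, hp, rfl⟩ ⟨q, hq, rfl⟩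
      exact ⟨p * q, mul_mem hp hq, by simp [mul_smul]⟩

/-- The orbit space `𝒢_0 = 𝒢 / P_+` (with the quotient topology). -/
abbrev GZero : Type _ := Quotient (plusSetoid gr P B)

/-- The projection `π_+ : 𝒢 → 𝒢_0`. -/
def piPlus (u : B) : GZero gr P B := Quotient.mk _ u

/-- The right action of `G_0` on `𝒢_0`: `[u] · g = [u · g]`. -/
def rightZero (g : levi gr P) : GZero gr P B → GZero gr P B :=
  Quotient.map (fun u => u <• (g : P)) (by
    rintro u v ⟨p, hp, rfl⟩
    refine ⟨(g : P)⁻¹ * p * g, ?_, ?_⟩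
    · simpa using conj_mem_unip (inv_mem g.2) hp
    · simp [← mul_smul, ← MulOpposite.op_mul, mul_assoc])

variable {B} in
/-- The map `Φ_0 : 𝒢_0 → 𝒢_0` induced by an equivariant map `Φ : 𝒢 → 𝒢`:
`Φ_0 ∘ π_+ = π_+ ∘ Φ`. -/
def mapZero (f : B → B) (hf : ∀ p u, f (rightAct P B p u) = rightAct P B p (f u)) :
    GZero gr P B → GZero gr P B :=
  Quotient.map f (by
    rintro u v ⟨p, hp, rfl⟩
    exact ⟨p, hp, (hf p u).symm⟩)

lemma rightZero_one (x : GZero gr P B) : rightZero gr P B 1 x = x := by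
  induction x using Quotient.inductionOn with
  | h u => simp [rightZero]

lemma rightZero_mul (g h : levi gr P) (x : GZero gr P B) :
    rightZero gr P B (g * h) x = rightZero gr P B h (rightZero gr P B g x) := by
  induction x using Quotient.inductionOn with
  | h u => simp [rightZero, mul_smul]

variable {B} in
lemma mapZero_rightZero (f : B → B)
    (hf : ∀ p u, f (rightAct P B p u) = rightAct P B p (f u)) (g : levi gr P)
    (x : GZero gr P B) :
    mapZero gr P f hf (rightZero gr P B g x) = rightZero gr P B g (mapZero gr P f hf x) := by
  induction x using Quotient.inductionOn with
  | h u => exact congrArg (Quotient.mk (plusSetoid gr P B)) (hf g u)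

variable {gr P} {Z : GroupLieAlgebra 𝓘(ℝ, EG) G} (lam : ScaleRep gr P Z)

/-- Two points of `𝒢_0` are equivalent if they lie in the same `Ker λ`-orbit. -/
def lamSetoid : Setoid (GZero gr P B) where
  r x y := ∃ g : levi gr P, lam.hom g = 1 ∧ rightZero gr P B g x = y
  iseqv := by
    refine ⟨fun x => ⟨1, map_one _, rightZero_one gr P B x⟩, ?_, ?_⟩
    · rintro x y ⟨g, hg, rfl⟩
      exact ⟨g⁻¹, by simp [hg], by rw [← rightZero_mul, mul_inv_cancel, rightZero_one]⟩
    · rintro x y z ⟨g, hg, rfl⟩ ⟨h, hh, rfl⟩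
      exact ⟨g * h, by simp [hg, hh], rightZero_mul gr P B g h x⟩

/-- The scale bundle `𝓛^λ = 𝒢_0 / Ker λ` (with the quotient topology). -/
abbrev ScaleBundle : Type _ := Quotient (lamSetoid B lam)

/-- The projection `π_λ : 𝒢_0 → 𝓛^λ`. -/
def piLam (x : GZero gr P B) : ScaleBundle B lam := Quotient.mk _ x

/-- The right action of `ℝ_+` on `𝓛^λ`, given by `[x] · λ(g) = [x · g]` for `g ∈ G_0`. -/
def rightLam (g : levi gr P) : ScaleBundle B lam → ScaleBundle B lam :=
  Quotient.map (rightZero gr P B g) (by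
    rintro x y ⟨h, hh, rfl⟩
    refine ⟨g⁻¹ * h * g, by simp [hh], ?_⟩
    simp only [← rightZero_mul]
    congr 1
    group)

variable {B} in
/-- The map `Φ_λ : 𝓛^λ → 𝓛^λ` induced by an equivariant map `Φ : 𝒢 → 𝒢`:
`Φ_λ ∘ π_λ = π_λ ∘ Φ_0`. -/
def mapLam (f : B → B) (hf : ∀ p u, f (rightAct P B p u) = rightAct P B p (f u)) :
    ScaleBundle B lam → ScaleBundle B lam :=
  Quotient.map (mapZero gr P f hf) (by
    rintro x y ⟨g, hg, rfl⟩
    exact ⟨g, hg, (mapZero_rightZero gr P f hf g x).symm⟩)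

end Quotients

/-! ### Weyl structures and their automorphisms -/

section Weyl

variable {EG : Type*} [NormedAddCommGroup EG] [NormedSpace ℝ EG] [FiniteDimensional ℝ EG]
  {G : Type*} [TopologicalSpace G] [ChartedSpace EG G] [Group G] [LieGroup 𝓘(ℝ, EG) ∞ G]
  {k : ℕ} (gr : Grading (GroupLieAlgebra 𝓘(ℝ, EG) G) k)
  {EP : Type*} [NormedAddCommGroup EP] [NormedSpace ℝ EP]
  {P : Subgroup G} [ChartedSpace EP P]
  {EB : Type*} [NormedAddCommGroup EB] [NormedSpace ℝ EB]
  {B : Type*} [TopologicalSpace B] [ChartedSpace EB B] [IsManifold 𝓘(ℝ, EB) ∞ B]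
  [MulAction (↥P)ᵐᵒᵖ B]
  {EM : Type*} [NormedAddCommGroup EM] [NormedSpace ℝ EM]
  {M : Type*} [TopologicalSpace M] [ChartedSpace EM M]
  (C : CartanGeometry EG EP EB EM P B M)

namespace CartanGeometry

lemma proj_surjective : Function.Surjective C.proj := fun x => by
  obtain ⟨U, -, hx, e, s, -, -, hs, -⟩ := C.principal.locally_trivial x
  exact ⟨s x, hs x hx⟩

/-- The automorphisms `Φ ∈ Aut(𝒢, ω)`. -/
abbrev Aut : Type _ := GeomAut (rightAct P B) C.form

/-- The infinitesimal automorphisms `𝐗 ∈ inf(𝒢, ω)`. -/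
abbrev Inf : Type _ := InfAut (rightAct P B) C.form

/-- The projection `π_0 : 𝒢_0 → M`. -/
def projZero : GZero gr P B → M :=
  Quotient.lift C.proj (by
    rintro u v ⟨p, -, rfl⟩
    exact (C.principal.proj_act u p).symm)

variable {gr} in
/-- The projection `𝓛^λ → M`. -/
def projLam {Z : GroupLieAlgebra 𝓘(ℝ, EG) G} (lam : ScaleRep gr P Z) : ScaleBundle B lam → M :=
  Quotient.lift (C.projZero gr) (by
    rintro x y ⟨g, -, rfl⟩
    induction x using Quotient.inductionOn with
    | h u => exact (C.principal.proj_act u g).symm)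

end CartanGeometry

variable {C}

/-- The diffeomorphism `φ : M → M` underlying `Φ`: `φ ∘ π = π ∘ Φ`. -/
noncomputable def baseMap (Φ : C.Aut) (x : M) : M :=
  C.proj (Φ.toDiffeo (Function.surjInv C.proj_surjective x))

/-- The induced bundle map `Φ_0 : 𝒢_0 → 𝒢_0`. -/
noncomputable def zeroMap (Φ : C.Aut) : GZero gr P B → GZero gr P B := mapZero gr P Φ.toDiffeo Φ.equivariant

/-- The vector field `𝐗_0` on `𝒢_0` to which `𝐗` projects. -/
noncomputable def zeroField {E0 : Type*} [NormedAddCommGroup E0] [NormedSpace ℝ E0]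
    [ChartedSpace E0 (GZero gr P B)] (V : C.Inf) : VField E0 (GZero gr P B) :=
  fun x => mfderiv 𝓘(ℝ, EB) 𝓘(ℝ, E0) (piPlus gr P B) x.out (V.field x.out)

/-- The vector field on `M` to which `𝐗` projects. -/
noncomputable def baseField (V : C.Inf) : VField EM M :=
  fun x => mfderiv 𝓘(ℝ, EB) 𝓘(ℝ, EM) C.proj (Function.surjInv C.proj_surjective x)
    (V.field (Function.surjInv C.proj_surjective x))

/-- The vector field `𝐗_λ` on `𝓛^λ` to which `𝐗_0` projects. -/
noncomputable def lamField {gr : Grading (GroupLieAlgebra 𝓘(ℝ, EG) G) k}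
    {Z : GroupLieAlgebra 𝓘(ℝ, EG) G} (lam : ScaleRep gr P Z)
    (E0 : Type*) [NormedAddCommGroup E0] [NormedSpace ℝ E0]
    [ChartedSpace E0 (GZero gr P B)]
    {EL : Type*} [NormedAddCommGroup EL] [NormedSpace ℝ EL]
    [ChartedSpace EL (ScaleBundle B lam)] (V : C.Inf) : VField EL (ScaleBundle B lam) :=
  fun p => mfderiv 𝓘(ℝ, E0) 𝓘(ℝ, EL) (piLam B lam) p.out
    (zeroField gr V p.out : TangentSpace 𝓘(ℝ, E0) p.out)

/-- Weyl structures: smooth `G_0`-equivariant sections `σ : 𝒢_0 → 𝒢` of `π_+`. -/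
structure WeylStructure (_C : CartanGeometry EG EP EB EM P B M) (E0 : Type*) [NormedAddCommGroup E0] [NormedSpace ℝ E0]
    [ChartedSpace E0 (GZero gr P B)] where
  toFun : GZero gr P B → B
  smooth : ContMDiff 𝓘(ℝ, E0) 𝓘(ℝ, EB) ∞ toFun
  isSection : ∀ x, piPlus gr P B (toFun x) = x
  equivariant : ∀ (g : levi gr P) (x : GZero gr P B),
    toFun (rightZero gr P B g x) = toFun x <• (g : P)

variable {gr}
  {E0 : Type*} [NormedAddCommGroup E0] [NormedSpace ℝ E0]
  [ChartedSpace E0 (GZero gr P B)] [IsManifold 𝓘(ℝ, E0) ∞ (GZero gr P B)]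
  (σ : WeylStructure gr C E0)

/-- The form `σ^* ω_≤ = σ^* ω_{-k} + ... + σ^* ω_0` on `𝒢_0`, with values in
`𝔭^* = 𝔤_{-k} ⊕ ... ⊕ 𝔤_0 ⊆ 𝔤`. -/
noncomputable def weylFormLe : OneForm E0 (GZero gr P B) (GroupLieAlgebra 𝓘(ℝ, EG) G) :=
  pullbackForm σ.toFun (fun u => gr.projLe ∘ₗ C.form u)

/-- `Φ ∈ Aut(σ)`, i.e. `Φ^* σ = σ` for `Φ^* σ = Φ⁻¹ ∘ σ ∘ Φ_0`. -/
def IsWeylAut (Φ : C.Aut) : Prop :=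
  Φ.toDiffeo.symm ∘ σ.toFun ∘ zeroMap gr Φ = σ.toFun

/-- `𝐗 ∈ inf(σ)`, i.e. the Lie derivative
`L_𝐗 σ = (d/dt)|_{t=0} (Φ_{𝐗,t}^{-1} ∘ σ ∘ Φ_{𝐗_0,t})` (exists and) vanishes. -/
def IsWeylInf (V : C.Inf) : Prop :=
  ∀ x : GZero gr P B, HasMFDerivAt 𝓘(ℝ, ℝ) 𝓘(ℝ, EB)
    (fun t : ℝ => flow V.field (-t) (σ.toFun (flow (zeroField gr V : VField E0 _) t x))) 0 0

variable {Z : GroupLieAlgebra 𝓘(ℝ, EG) G} (lam : ScaleRep gr P Z)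
  {EL : Type*} [NormedAddCommGroup EL] [NormedSpace ℝ EL]
  [ChartedSpace EL (ScaleBundle B lam)]

/-- The form `λ' ∘ σ^* ω_0` on `𝒢_0`, where `λ'(A) = B(Z, A)`. -/
noncomputable def weylFormLam (_lam : ScaleRep gr P Z) : OneForm E0 (GZero gr P B) ℝ :=
  pullbackForm σ.toFun
    (fun u => killingForm ℝ (GroupLieAlgebra 𝓘(ℝ, EG) G) Z ∘ₗ gr.proj 0 ∘ₗ C.form u)

/-- The connection form `σ^λ` on `𝓛^λ` induced by `λ' ∘ σ^* ω_0`: the (unique) one-form on `𝓛^λ`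
with `π_λ^* σ^λ = λ' ∘ σ^* ω_0`. -/
noncomputable def scaleConnection : OneForm EL (ScaleBundle B lam) ℝ :=
  Classical.epsilon fun θ : OneForm EL (ScaleBundle B lam) ℝ =>
    pullbackForm (piLam B lam) θ = weylFormLam σ lam

variable (C EL) in
/-- Global scales: smooth sections of `𝓛^λ → M`. -/
structure Scale where
  toFun : M → ScaleBundle B lam
  smooth : ContMDiff 𝓘(ℝ, EM) 𝓘(ℝ, EL) ∞ toFun
  isSection : ∀ x, C.projLam lam (toFun x) = x

/-- `σ` is the exact Weyl structure corresponding to the global scale `s`: `σ^λ` is the trivial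
connection induced by `s`, i.e. its horizontal subspaces are the `(R_r)_* s_* T_x M`. -/
def IsExactWith (s : Scale C lam EL) : Prop :=
  ∀ (g : levi gr P) (x : M) (v : TangentSpace 𝓘(ℝ, EM) x),
    pullbackForm (E := EM) (fun y => rightLam B lam g (s.toFun y))
      (scaleConnection (EL := EL) σ lam) x v = 0

variable {lam}

/-- `Φ ∈ Aut(σ̄)`, i.e. `Φ^* s = s` for `Φ^* s = Φ_λ⁻¹ ∘ s ∘ φ`. -/
def IsExactAut (s : Scale C lam EL) (Φ : C.Aut) : Prop :=
  mapLam lam Φ.toDiffeo.symm Φ.symm_equivariant ∘ s.toFun ∘ baseMap Φ = s.toFun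

variable (E0) in
/-- `𝐗 ∈ inf(σ̄)`, i.e. the Lie derivative
`L_𝐗 s = (d/dt)|_{t=0} (Φ_{𝐗_λ,t}^{-1} ∘ s ∘ φ_{X,t})` (exists and) vanishes. -/
def IsExactInf (s : Scale C lam EL) (V : C.Inf) : Prop :=
  ∀ x : M, HasMFDerivAt 𝓘(ℝ, ℝ) 𝓘(ℝ, EL)
    (fun t : ℝ => flow (lamField lam E0 V : VField EL _) (-t)
      (s.toFun (flow (baseField V) t x))) 0 0

/-- The reduction `𝒢̄_0 = π_λ⁻¹ (s(M)) ⊆ 𝒢_0` to the structure group `Ker λ`. -/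
def reduction (s : Scale C lam EL) : Set (GZero gr P B) := piLam B lam ⁻¹' Set.range s.toFun

/-- The right action of `Ker λ` on `𝒢̄_0`. -/
def rightRed (s : Scale C lam EL) (g : lam.hom.ker) (x : reduction s) : reduction s :=
  ⟨rightZero gr P B g x, by
    have h : piLam B lam (rightZero gr P B (g : levi gr P) x) = piLam B lam x :=
      (Quotient.sound (s := lamSetoid B lam) ⟨g, g.2, rfl⟩).symm
    have hx : piLam B lam (x : GZero gr P B) ∈ Set.range s.toFun := x.2
    rw [← h] at hx
    exact hx⟩

/-- The form `σ̄^* ω_≤` on `𝒢̄_0`, for `σ̄ = σ ∘ r` and `r : 𝒢̄_0 → 𝒢_0` the inclusion. -/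
noncomputable def redFormLe (s : Scale C lam EL) {ER : Type*} [NormedAddCommGroup ER]
    [NormedSpace ℝ ER] [ChartedSpace ER (reduction s)] :
    OneForm ER (reduction s) (GroupLieAlgebra 𝓘(ℝ, EG) G) :=
  pullbackForm (fun x : reduction s => σ.toFun x) (fun u => gr.projLe ∘ₗ C.form u)

end Weyl

end ParabolicWeyl

open ParabolicWeyl

/-! Everything rests on the scalar one-form θ = B(Z, ω) on 𝒢, where Z = E_λ. Since Z ∈ 𝔤_0 is
Killing-orthogonal to all other degrees, σ^*θ equals λ' ∘ σ^*ω_0, the form on 𝒢_0 that descends to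
the connection σ^λ. It is a component of σ^*ω_≤, and yet it already determines σ; this closes the
circle between the three conditions on automorphisms.

Uniqueness (`eq_of_scaleForm_eq`). Two maps f, g : N → 𝒢 with the same projection to 𝒢_0 satisfy g =
f · p with p valued in P_+. Passing from f to g replaces ω by Ad(p⁻¹)ω up to terms in 𝔭_+, which
B(Z, ·) does not see. If f^*θ = g^*θ, then Ad(p)Z − Z is orthogonal to the values of f^*ω. It lies
in 𝔭_+, so it is orthogonal to 𝔭 as well, and if N → M is a submersion these two subspaces span 𝔤.
Hence Ad(p)Z = Z. As ad Z acts on 𝔤_i by c·i with c ≠ 0, p preserves the grading, so p ∈ G_0 ∩ P_+,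
which is trivial. The case f = σ, g = Φ⁻¹ ∘ σ ∘ Φ_0 gives the statement on automorphisms.

Infinitesimal version (`eq_of_lieForm_eq`). If fields V on 𝒢 and W on N are related over 𝒢_0, the
defect D = V ∘ f − Tf(W) is tangent to the fibres of π_+, so a = ω(D) ∈ 𝔭_+ and θ(D) = 0. Cartan's
formula turns L_V θ = 0 and L_W f^*θ = 0 into dθ(D, Tf v) = 0, and equivariance gives dθ(D, w) =
−B(Z, [a, ω(w)]). The same orthogonality argument yields [Z, a] = 0, so a ∈ 𝔤_0 ∩ 𝔭_+ = 0. The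
conditions stated with flows say that a map relates two vector fields (`hasMFDerivAt_flow_iff`).

Exact case. Both results are applied to f = σ ∘ r on N = 𝒢̄_0. There f^*θ = 0 because s is
horizontal, so its invariance is automatic once the reduction is preserved, and preserving the
reduction amounts to preserving s.

The facts needed from Lie theory are that the derivative of Ad is the bracket (`hasDerivAt_adm`),
that P_+ acts trivially on the graded object of the filtration of 𝔤 (`Ad_sub_mem_filt`), and that
curves in P_+ through 1 have velocity in 𝔭_+ (`velocity_mem_pos`). -/

namespace ParabolicWeyl

set_option linter.unusedSectionVars false

/-! ### Algebra of graded Lie algebras -/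

namespace Grading

variable {L : Type*} [LieRing L] [LieAlgebra ℝ L] {k : ℕ} (gr : Grading L k)

/-- The filtration component `L_i ⊕ L_{i+1} ⊕ ...`. -/
def filt (i : ℤ) : Submodule ℝ L := ⨆ (j : ℤ) (_ : i ≤ j), gr.comp j

lemma pos_eq_filt : gr.pos = gr.filt 1 := rfl

lemma comp_le_filt {i j : ℤ} (h : i ≤ j) : gr.comp j ≤ gr.filt i :=
  le_iSup₂_of_le j h le_rfl

lemma filt_anti {i j : ℤ} (h : i ≤ j) : gr.filt j ≤ gr.filt i :=
  iSup₂_le fun _ hl => gr.comp_le_filt (h.trans hl)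

lemma filt_le_iff {i : ℤ} {S : Submodule ℝ L} : gr.filt i ≤ S ↔ ∀ j, i ≤ j → gr.comp j ≤ S := by
  simp [filt]

lemma iSup_comp : ⨆ i, gr.comp i = ⊤ := gr.isInternal.submodule_iSup_eq_top

lemma induction_comp {p : L → Prop} (hc : ∀ i, ∀ x ∈ gr.comp i, p x) (hz : p 0)
    (ha : ∀ x y, p x → p y → p (x + y)) (x : L) : p x :=
  Submodule.iSup_induction gr.comp (motive := p) (gr.iSup_comp ▸ Submodule.mem_top) hc hz ha

lemma filt_eq_bot {i : ℤ} (h : (k : ℤ) < i) : gr.filt i = ⊥ := by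
  refine le_bot_iff.1 (gr.filt_le_iff.2 fun j hj => ?_)
  rw [gr.eq_bot j (lt_of_lt_of_le (h.trans_le hj) (le_abs_self j))]

lemma proj_mem (i : ℤ) (x : L) : gr.proj i x ∈ gr.comp i := by
  simp [proj]

lemma proj_of_mem {i : ℤ} {x : L} (hx : x ∈ gr.comp i) : gr.proj i x = x := by
  have h : (LinearEquiv.ofBijective (DirectSum.coeLinearMap gr.comp) gr.bijective_coe).symm x
      = DirectSum.lof ℝ ℤ (fun j => gr.comp j) i ⟨x, hx⟩ := by
    rw [LinearEquiv.symm_apply_eq]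
    simp
  simp [proj, h]

lemma proj_of_mem_ne {i j : ℤ} (hij : i ≠ j) {x : L} (hx : x ∈ gr.comp j) : gr.proj i x = 0 := by
  have h : (LinearEquiv.ofBijective (DirectSum.coeLinearMap gr.comp) gr.bijective_coe).symm x
      = DirectSum.lof ℝ ℤ (fun j => gr.comp j) j ⟨x, hx⟩ := by
    rw [LinearEquiv.symm_apply_eq]
    simp
  simp only [proj, LinearMap.comp_apply, LinearEquiv.coe_coe, h, DirectSum.component.of]
  simp [hij.symm]

lemma sum_proj (x : L) : ∑ i ∈ Finset.Icc (-(k : ℤ)) k, gr.proj i x = x := by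
  induction x using gr.induction_comp with
  | hz => simp
  | ha x y hx hy => simp only [map_add, Finset.sum_add_distrib, hx, hy]
  | hc j x hj =>
    by_cases hk : (k : ℤ) < |j|
    · have : x = 0 := by simpa [gr.eq_bot j hk] using hj
      simp [this]
    · rw [Finset.sum_eq_single j]
      · exact gr.proj_of_mem hj
      · intro i _ hij
        exact gr.proj_of_mem_ne hij hj
      · intro h
        exfalso
        apply h
        rw [Finset.mem_Icc, ← abs_le]
        exact not_lt.1 hk

lemma mem_filt_iff {i : ℤ} {x : L} : x ∈ gr.filt i ↔ ∀ j < i, gr.proj j x = 0 := by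
  constructor
  · intro hx j hj
    have h : gr.filt i ≤ LinearMap.ker (gr.proj j) :=
      gr.filt_le_iff.2 fun l hl y hy => gr.proj_of_mem_ne (by lia) hy
    exact h hx
  · intro h
    rw [← gr.sum_proj x]
    refine Submodule.sum_mem _ fun j _ => ?_
    by_cases hj : i ≤ j
    · exact gr.comp_le_filt hj (gr.proj_mem j x)
    · rw [h j (by lia)]
      exact zero_mem _

lemma mem_comp_iff {i : ℤ} {x : L} : x ∈ gr.comp i ↔ ∀ j, j ≠ i → gr.proj j x = 0 := by
  constructor
  · intro hx j hj
    exact gr.proj_of_mem_ne hj hx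
  · intro h
    rw [← gr.sum_proj x]
    refine Submodule.sum_mem _ fun j _ => ?_
    by_cases hj : j = i
    · subst hj
      exact gr.proj_mem j x
    · rw [h j hj]
      exact zero_mem _

lemma proj_lie_of_mem {i j : ℤ} (x : L) {y : L} (hy : y ∈ gr.comp j) :
    gr.proj (i + j) ⁅x, y⁆ = ⁅gr.proj i x, y⁆ := by
  induction x using gr.induction_comp with
  | hz => simp
  | ha a b ha hb => simp only [map_add, add_lie, ha, hb]
  | hc l x hx =>
    have h := gr.lie_mem l j x y hx hy
    by_cases hl : i = l
    · subst hl
      rw [gr.proj_of_mem h, gr.proj_of_mem hx]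
    · rw [gr.proj_of_mem_ne (by lia) h, gr.proj_of_mem_ne hl hx, zero_lie]

lemma lie_mem_filt {i j : ℤ} {x y : L} (hx : x ∈ gr.filt i) (hy : y ∈ gr.filt j) :
    ⁅x, y⁆ ∈ gr.filt (i + j) := by
  have h1 : ∀ l, i ≤ l → ∀ x ∈ gr.comp l, ∀ y ∈ gr.filt j, ⁅x, y⁆ ∈ gr.filt (i + j) := by
    intro l hl x hx y hy
    have h2 : gr.filt j ≤ (gr.filt (i + j)).comap (LieAlgebra.ad ℝ L x : L →ₗ[ℝ] L) :=
      gr.filt_le_iff.2 fun m hm z hz =>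
        gr.comp_le_filt (add_le_add hl hm) (gr.lie_mem l m x z hx hz)
    exact h2 hy
  have h3 : gr.filt i ≤ (gr.filt (i + j)).comap (LieAlgebra.ad ℝ L y : L →ₗ[ℝ] L) :=
    gr.filt_le_iff.2 fun l hl z hz => by
      have := h1 l hl z hz y hy
      rwa [← lie_skew, neg_mem_iff] at this
  rw [← lie_skew, neg_mem_iff]
  exact h3 hx

/-- Used to recover ω_0, and with it B(Z, ω), from ω_≤. -/
lemma proj_zero_projLe (x : L) : gr.proj 0 (gr.projLe x) = gr.proj 0 x := by
  simp only [projLe, LinearMap.coe_sum, Finset.sum_apply, map_sum]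
  rw [Finset.sum_eq_single 0]
  · exact gr.proj_of_mem (gr.proj_mem 0 x)
  · intro j _ hj
    exact gr.proj_of_mem_ne (Ne.symm hj) (gr.proj_mem j x)
  · intro h
    exact absurd (Finset.mem_Icc.2 ⟨by simp, le_rfl⟩) h

/-- The linear map acting by `i` on `L_i`. -/
noncomputable def degree : L →ₗ[ℝ] L := ∑ i ∈ Finset.Icc (-(k : ℤ)) k, (i : ℝ) • gr.proj i

lemma degree_of_mem {i : ℤ} {x : L} (hx : x ∈ gr.comp i) : gr.degree x = (i : ℝ) • x := by
  have h : gr.degree x = (i : ℝ) • ∑ j ∈ Finset.Icc (-(k : ℤ)) k, gr.proj j x := by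
    simp only [degree, LinearMap.coe_sum, Finset.sum_apply, LinearMap.smul_apply, Finset.smul_sum]
    refine Finset.sum_congr rfl fun j _ => ?_
    by_cases hj : j = i
    · rw [hj]
    · rw [gr.proj_of_mem_ne hj hx, smul_zero, smul_zero]
  rw [h, gr.sum_proj]

/-- Brackets add degrees, so the grading operator is a derivation; `IsScaling.exists_scalar`
compares it with `ad Z`. -/
lemma degree_lie (x y : L) : gr.degree ⁅x, y⁆ = ⁅gr.degree x, y⁆ + ⁅x, gr.degree y⁆ := by
  induction x using gr.induction_comp with
  | hz => simp
  | ha a b ha hb => simp only [map_add, add_lie, ha, hb]; abel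
  | hc i x hx =>
    induction y using gr.induction_comp with
    | hz => simp
    | ha a b ha hb => simp only [map_add, lie_add, ha, hb]; abel
    | hc j y hy =>
      rw [gr.degree_of_mem (gr.lie_mem i j x y hx hy), gr.degree_of_mem hx, gr.degree_of_mem hy]
      simp [add_smul]

variable [FiniteDimensional ℝ L]

/-- The map `ad x ∘ ad y` shifts every degree by `i + j ≠ 0`, so it has no diagonal blocks and its
trace vanishes. -/
lemma killingForm_eq_zero {i j : ℤ} (hij : i + j ≠ 0) {x y : L} (hx : x ∈ gr.comp i)
    (hy : y ∈ gr.comp j) : killingForm ℝ L x y = 0 := by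
  rw [killingForm_apply_apply]
  refine LinearMap.trace_eq_zero_of_mapsTo_ne gr.isInternal (fun l => i + (j + l))
    (fun l => by lia) fun l z hz => ?_
  exact gr.lie_mem i (j + l) x _ hx (gr.lie_mem j l y z hy hz)

lemma killingForm_filt_eq_zero {i j : ℤ} (hij : 0 < i + j) {x y : L} (hx : x ∈ gr.filt i)
    (hy : y ∈ gr.filt j) : killingForm ℝ L x y = 0 := by
  have h1 : ∀ l, i ≤ l → ∀ x ∈ gr.comp l, killingForm ℝ L x y = 0 := by
    intro l hl x hx
    have h2 : gr.filt j ≤ LinearMap.ker (killingForm ℝ L x) :=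
      gr.filt_le_iff.2 fun m hm z hz => gr.killingForm_eq_zero (by lia) hx hz
    exact h2 hy
  have h3 : gr.filt i ≤ LinearMap.ker ((killingForm ℝ L).flip y) :=
    gr.filt_le_iff.2 fun l hl z hz => h1 l hl z hz
  exact h3 hx

variable [LieAlgebra.IsKilling ℝ L]

omit gr in
lemma eq_zero_of_killingForm {x : L} (h : ∀ y, killingForm ℝ L x y = 0) : x = 0 := by
  have : x ∈ LinearMap.ker (killingForm ℝ L) := LinearMap.ext h
  simpa using this

omit gr in
lemma eq_zero_of_central {x : L} (h : ∀ y : L, ⁅x, y⁆ = 0) : x = 0 := by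
  refine eq_zero_of_killingForm fun y => ?_
  have : LieAlgebra.ad ℝ L x = 0 := LinearMap.ext h
  simp [killingForm_apply_apply, this]

-- The scalar on `L_{-1}` fixes all others: in negative degrees because `L_-` is generated by
-- `L_{-1}`, in degree 0 because `Z` is central there, and in positive degrees because the Killing
-- form pairs `L_i` with `L_{-i}`. If `c` were zero, `Z` would be central in `L`, hence zero.
variable {gr} in
lemma IsScaling.exists_scalar {Z : L} (hZ : gr.IsScaling Z) :
    ∃ c : ℝ, c ≠ 0 ∧ ∀ (i : ℤ), ∀ x ∈ gr.comp i, ⁅Z, x⁆ = (c * i) • x := by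
  obtain ⟨c', hc'⟩ := hZ.scalar (-1)
  set c := -c' with hcdef
  have hneg : ∀ i < 0, ∀ x ∈ gr.comp i, ⁅Z, x⁆ = (c * i) • x := by
    -- The set where `ad Z` agrees with `c • degree`. It is a subalgebra because both maps are
    -- derivations.
    let S : LieSubalgebra ℝ L :=
      { LinearMap.ker ((LieAlgebra.ad ℝ L Z : L →ₗ[ℝ] L) - c • gr.degree) with
        lie_mem' := by
          intro x y hx hy
          simp only [AddSubsemigroup.mem_carrier, AddSubmonoid.mem_toSubsemigroup,
            Submodule.mem_toAddSubmonoid, LinearMap.mem_ker, LinearMap.sub_apply,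
            LinearMap.smul_apply, LieAlgebra.ad_apply, sub_eq_zero] at hx hy ⊢
          rw [gr.degree_lie, leibniz_lie, hx, hy]
          simp }
    have hS : LieSubalgebra.lieSpan ℝ L (gr.comp (-1) : Set L) ≤ S := by
      rw [LieSubalgebra.lieSpan_le]
      intro x hx
      have h1 := hc' x hx
      have h2 := gr.degree_of_mem hx
      change ((LieAlgebra.ad ℝ L Z : L →ₗ[ℝ] L) - c • gr.degree) x = 0
      simp [h1, h2, hcdef]
    intro i hi x hx
    have h1 : x ∈ (LieSubalgebra.lieSpan ℝ L (gr.comp (-1) : Set L)).toSubmodule := by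
      rw [gr.generated]
      exact (le_iSup₂_of_le (f := fun (i : ℤ) (_ : i < 0) => gr.comp i) i hi le_rfl) hx
    have h2 : ((LieAlgebra.ad ℝ L Z : L →ₗ[ℝ] L) - c • gr.degree) x = 0 := hS h1
    rw [LinearMap.sub_apply, sub_eq_zero] at h2
    simpa [gr.degree_of_mem hx, mul_smul] using h2
  have hall : ∀ (i : ℤ), ∀ x ∈ gr.comp i, ⁅Z, x⁆ = (c * i) • x := by
    intro i x hx
    rcases lt_trichotomy i 0 with hi | hi | hi
    · exact hneg i hi x hx
    · subst hi
      simp [hZ.central x hx]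
    · by_cases hx0 : x = 0
      · simp [hx0]
      obtain ⟨d, hd⟩ := hZ.scalar i
      rw [hd x hx]
      congr 1
      by_contra hne
      refine hx0 (eq_zero_of_killingForm fun y => ?_)
      induction y using gr.induction_comp with
      | hz => simp
      | ha a b ha hb => rw [map_add, ha, hb, add_zero]
      | hc j y hy =>
        -- Only `y ∈ L_{-i}` can pair with `x`. Invariance of the Killing form gives `(d + c * j)
        -- B(x, y) = 0`, so a scalar `d ≠ c * i` would make `x` orthogonal to everything.
        by_cases hij : i + j = 0
        · have h1 : killingForm ℝ L ⁅Z, x⁆ y = - killingForm ℝ L x ⁅Z, y⁆ := by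
            rw [← LieModule.traceForm_apply_lie_apply, ← lie_skew Z x, map_neg,
              LinearMap.neg_apply, LieModule.traceForm_apply_lie_apply]
          rw [hd x hx, hneg j (by lia) y hy] at h1
          have h2 : (d + c * j) * killingForm ℝ L x y = 0 := by
            simp only [map_smul, LinearMap.smul_apply, smul_eq_mul] at h1
            linear_combination h1
          rcases mul_eq_zero.1 h2 with h | h
          · exfalso
            apply hne
            have : (i : ℝ) = -j := by
              have := congrArg (Int.cast : ℤ → ℝ) hij
              push_cast at this
              linarith
            rw [this]
            linarith
          · exact h
        · exact gr.killingForm_eq_zero hij hx hy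
  refine ⟨c, fun hc => hZ.ne_zero (eq_zero_of_central fun y => ?_), hall⟩
  induction y using gr.induction_comp with
  | hz => simp
  | ha a b ha hb => rw [lie_add, ha, hb, add_zero]
  | hc j y hy => simp [hall j y hy, hc]

variable {gr} in
/-- `L_i` is an eigenspace of `ad Z`. -/
lemma IsScaling.mem_comp_of_lie {Z : L} {c : ℝ} (hc : c ≠ 0)
    (hZ : ∀ (i : ℤ), ∀ x ∈ gr.comp i, ⁅Z, x⁆ = (c * i) • x) {i : ℤ} {x : L}
    (hx : ⁅Z, x⁆ = (c * i) • x) : x ∈ gr.comp i := by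
  have h1 : ∀ (j : ℤ) (x : L), gr.proj j ⁅Z, x⁆ = (c * j) • gr.proj j x := by
    intro j x
    induction x using gr.induction_comp with
    | hz => simp
    | ha a b ha hb => rw [lie_add, map_add, ha, hb, map_add, smul_add]
    | hc l x hx =>
      rw [hZ l x hx, map_smul]
      by_cases hl : j = l
      · rw [hl]
      · rw [gr.proj_of_mem_ne hl hx, smul_zero, smul_zero]
  rw [gr.mem_comp_iff]
  intro j hj
  have h2 := h1 j x
  rw [hx, map_smul, ← sub_eq_zero, ← sub_smul] at h2
  rcases smul_eq_zero.1 h2 with h | h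
  · exfalso
    rw [← mul_sub] at h
    rcases mul_eq_zero.1 h with h | h
    · exact hc h
    · exact hj (by exact_mod_cast (sub_eq_zero.1 h).symm)
  · exact h

-- `Z` has degree 0 and is orthogonal to every other degree. This identifies `λ' ∘ ω_0` with `B(Z,
-- ω)`.
variable {gr} in
lemma IsScaling.killingForm_proj {Z : L} (hZ : gr.IsScaling Z) (x : L) :
    killingForm ℝ L Z (gr.proj 0 x) = killingForm ℝ L Z x := by
  induction x using gr.induction_comp with
  | hz => simp
  | ha a b ha hb => rw [map_add, map_add, ha, hb, map_add]
  | hc l x hx =>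
    by_cases hl : 0 = l
    · subst hl
      rw [gr.proj_of_mem hx]
    · rw [gr.proj_of_mem_ne hl hx, map_zero]
      exact (gr.killingForm_eq_zero (by lia) hZ.mem hx).symm

/-- If `ad x` raises the filtration by one, every component of `x` of degree at most 0 commutes with
all homogeneous elements, and the center is trivial. This criterion detects `𝔭_+` through the
adjoint action alone. -/
lemma mem_pos_of_lie {x : L} (h : ∀ j, ∀ y ∈ gr.comp j, ⁅x, y⁆ ∈ gr.filt (j + 1)) :
    x ∈ gr.pos := by
  rw [pos_eq_filt, mem_filt_iff]
  intro i hi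
  refine eq_zero_of_central fun y => ?_
  induction y using gr.induction_comp with
  | hz => simp
  | ha a b ha hb => rw [lie_add, ha, hb, add_zero]
  | hc j y hy =>
    rw [← gr.proj_lie_of_mem x hy]
    exact gr.mem_filt_iff.1 (h j y hy) _ (by lia)

variable {gr} in
/-- An element `x ∈ 𝔭_+` such that `[Z, x]` is orthogonal to a complement of `𝔭` is zero. -/
lemma IsScaling.eq_zero_of_mem_pos {Z : L} (hZ : gr.IsScaling Z) {x : L} (hx : x ∈ gr.pos)
    {S : Submodule ℝ L} (hS : S ⊔ gr.nonneg = ⊤) (h : ∀ y ∈ S, killingForm ℝ L Z ⁅x, y⁆ = 0) :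
    x = 0 := by
  obtain ⟨c, hc, hcZ⟩ := hZ.exists_scalar
  have hZ0 : Z ∈ gr.filt 0 := gr.comp_le_filt le_rfl hZ.mem
  have h1 : ⁅Z, x⁆ = 0 := by
    -- `[Z, x]` is orthogonal to `S` by invariance of the Killing form, and to `𝔭` for reasons of
    -- degree.
    refine eq_zero_of_killingForm fun y => ?_
    have h2 : S ⊔ gr.nonneg ≤ LinearMap.ker (killingForm ℝ L ⁅Z, x⁆) := by
      refine sup_le (fun y hy => ?_) (fun y hy => ?_)
      · rw [LinearMap.mem_ker, LieModule.traceForm_apply_lie_apply]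
        exact h y hy
      · have hx1 := gr.lie_mem_filt hZ0 hx
        exact gr.killingForm_filt_eq_zero (by norm_num) hx1 hy
    exact h2 (hS ▸ Submodule.mem_top)
  -- The zero eigenspace of `ad Z` is `L_0`, which meets `𝔭_+` only in zero.
  have h3 : x ∈ gr.comp 0 := IsScaling.mem_comp_of_lie hc hcZ (by simp [h1])
  rw [← gr.proj_of_mem h3]
  exact gr.mem_filt_iff.1 hx 0 (by norm_num)

end Grading

/-! ### Derivatives of maps between manifolds -/

section Derivatives

open Filter Topology

variable {E : Type*} [NormedAddCommGroup E] [NormedSpace ℝ E]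
  {E' : Type*} [NormedAddCommGroup E'] [NormedSpace ℝ E']
  {E'' : Type*} [NormedAddCommGroup E''] [NormedSpace ℝ E'']
  {E₃ : Type*} [NormedAddCommGroup E₃] [NormedSpace ℝ E₃]
  {X : Type*} [TopologicalSpace X] [ChartedSpace E X]
  {Y : Type*} [TopologicalSpace Y] [ChartedSpace E' Y]
  {W : Type*} [TopologicalSpace W] [ChartedSpace E'' W]
  {N : Type*} [TopologicalSpace N] [ChartedSpace E₃ N]

variable (E E') in
/-- The derivative of a map between manifolds, as a map between the model spaces. -/
noncomputable def md (f : X → Y) (x : X) : E →L[ℝ] E' := mfderiv 𝓘(ℝ, E) 𝓘(ℝ, E') f x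

variable (E E') in
/-- Differentiability of maps between boundaryless manifolds. -/
abbrev DiffAt (f : X → Y) (x : X) : Prop := MDifferentiableAt 𝓘(ℝ, E) 𝓘(ℝ, E') f x

variable (E E') in
/-- Smoothness of maps between boundaryless manifolds. -/
abbrev SmoothAt (f : X → Y) (x : X) : Prop := ContMDiffAt 𝓘(ℝ, E) 𝓘(ℝ, E') ∞ f x

lemma SmoothAt.diffAt {f : X → Y} {x : X} (h : SmoothAt E E' f x) : DiffAt E E' f x :=
  h.mdifferentiableAt (by simp)

lemma md_comp {g : Y → W} {f : X → Y} {x : X} (hg : DiffAt E' E'' g (f x))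
    (hf : DiffAt E E' f x) :
    md E E'' (fun y => g (f y)) x = (md E' E'' g (f x)).comp (md E E' f x) :=
  mfderiv_comp x hg hf

lemma md_comp_apply {g : Y → W} {f : X → Y} {x : X} (hg : DiffAt E' E'' g (f x))
    (hf : DiffAt E E' f x) (v : E) :
    md E E'' (fun y => g (f y)) x v = md E' E'' g (f x) (md E E' f x v) := by
  rw [md_comp hg hf]; rfl

/-- The base point `y` is kept separate from `f x`, so that curves with `c 0 = x` need no rewriting
inside derivatives. -/
lemma md_comp_apply_of_eq {g : Y → W} {f : X → Y} {x : X} {y : Y} (hy : f x = y)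
    (hg : DiffAt E' E'' g y) (hf : DiffAt E E' f x) (v : E) :
    md E E'' (fun y => g (f y)) x v = md E' E'' g y (md E E' f x v) := by
  subst hy
  exact md_comp_apply hg hf v

lemma md_congr {f g : X → Y} {x : X} (h : f =ᶠ[𝓝 x] g) : md E E' f x = md E E' g x :=
  h.mfderiv_eq

lemma md_id (x : X) : md E E (fun y : X => y) x = ContinuousLinearMap.id ℝ E := mfderiv_id

lemma md_const (y : Y) (x : X) : md E E' (fun _ : X => y) x = 0 := mfderiv_const

lemma md_eq_fderiv (f : E → E') (x : E) : md E E' f x = fderiv ℝ f x := mfderiv_eq_fderiv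

lemma diffAt_iff_differentiableAt {f : E → E'} {x : E} :
    DiffAt E E' f x ↔ DifferentiableAt ℝ f x := mdifferentiableAt_iff_differentiableAt

lemma hasMFDerivAt_iff_md {f : X → Y} {x : X} {f' : E →L[ℝ] E'} :
    HasMFDerivAt 𝓘(ℝ, E) 𝓘(ℝ, E') f x f' ↔ DiffAt E E' f x ∧ md E E' f x = f' :=
  ⟨fun h => ⟨h.mdifferentiableAt, h.mfderiv⟩, fun h => by
    have := h.1.hasMFDerivAt
    rw [← h.2]
    exact this⟩

lemma DiffAt.congr {f g : X → Y} {x : X} (hf : DiffAt E E' f x) (h : g =ᶠ[𝓝 x] f) :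
    DiffAt E E' g x := MDifferentiableAt.congr_of_eventuallyEq hf h

lemma DiffAt.comp' {g : Y → W} {f : X → Y} {x : X} (hg : DiffAt E' E'' g (f x))
    (hf : DiffAt E E' f x) : DiffAt E E'' (fun y => g (f y)) x := MDifferentiableAt.comp x hg hf

lemma SmoothAt.comp' {g : Y → W} {f : X → Y} {x : X} (hg : SmoothAt E' E'' g (f x))
    (hf : SmoothAt E E' f x) : SmoothAt E E'' (fun y => g (f y)) x := ContMDiffAt.comp x hg hf

lemma SmoothAt.comp_of_eq' {g : Y → W} {f : X → Y} {x : X} {y : Y} (hg : SmoothAt E' E'' g y)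
    (hf : SmoothAt E E' f x) (hy : f x = y) : SmoothAt E E'' (fun y => g (f y)) x := by
  subst hy; exact hg.comp' hf

/-- The derivative of a function of two variables is the sum of the partial derivatives. -/
lemma md_two {a : X → Y → W}
    (ha : ContMDiff (𝓘(ℝ, E).prod 𝓘(ℝ, E')) 𝓘(ℝ, E'') ∞ (fun q : X × Y => a q.1 q.2))
    {f : N → X} {g : N → Y} {x : N} (hf : DiffAt E₃ E f x) (hg : DiffAt E₃ E' g x) (v : E₃) :
    md E₃ E'' (fun y => a (f y) (g y)) x v =
      md E E'' (fun z => a z (g x)) (f x) (md E₃ E f x v) +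
      md E' E'' (fun z => a (f x) z) (g x) (md E₃ E' g x v) := by
  have h1 : MDifferentiableAt (𝓘(ℝ, E).prod 𝓘(ℝ, E')) 𝓘(ℝ, E'') (fun q : X × Y => a q.1 q.2)
    (f x, g x) := (ha _).mdifferentiableAt (by simp)
  have h2 := mfderiv_comp x h1 (hf.prodMk hg)
  have h3 := congrArg (fun T => T v) h2
  refine h3.trans ?_
  refine (mfderiv_prod_eq_add_apply h1).trans ?_
  rw [mfderiv_prodMk hf hg]
  rfl

lemma diffAt_two {a : X → Y → W}
    (ha : ContMDiff (𝓘(ℝ, E).prod 𝓘(ℝ, E')) 𝓘(ℝ, E'') ∞ (fun q : X × Y => a q.1 q.2))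
    {f : N → X} {g : N → Y} {x : N} (hf : DiffAt E₃ E f x) (hg : DiffAt E₃ E' g x) :
    DiffAt E₃ E'' (fun y => a (f y) (g y)) x := by
  have h1 : MDifferentiableAt (𝓘(ℝ, E).prod 𝓘(ℝ, E')) 𝓘(ℝ, E'') (fun q : X × Y => a q.1 q.2)
    (f x, g x) := (ha _).mdifferentiableAt (by simp)
  exact MDifferentiableAt.comp x h1 (hf.prodMk hg)

lemma smoothAt_two {a : X → Y → W}
    (ha : ContMDiff (𝓘(ℝ, E).prod 𝓘(ℝ, E')) 𝓘(ℝ, E'') ∞ (fun q : X × Y => a q.1 q.2))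
    {f : N → X} {g : N → Y} {x : N} (hf : SmoothAt E₃ E f x) (hg : SmoothAt E₃ E' g x) :
    SmoothAt E₃ E'' (fun y => a (f y) (g y)) x :=
  ContMDiffAt.comp x (ha (f x, g x)) (hf.prodMk hg)

/-- Charts in the maximal atlas of a boundaryless manifold are inverse to each other on tangent
spaces. -/
lemma md_chart_symm_md_chart {φ : OpenPartialHomeomorph X E}
    (hφ : φ ∈ IsManifold.maximalAtlas 𝓘(ℝ, E) ∞ X) {x : X} (hx : x ∈ φ.source) (v : E) :
    md E E φ.symm (φ x) (md E E φ x v) = v := by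
  have h1 : SmoothAt E E φ x := contMDiffAt_of_mem_maximalAtlas hφ hx
  have h2 : SmoothAt E E φ.symm (φ x) :=
    contMDiffAt_symm_of_mem_maximalAtlas hφ (φ.map_source hx)
  rw [← md_comp_apply h2.diffAt h1.diffAt]
  have h3 : (fun y => φ.symm (φ y)) =ᶠ[𝓝 x] fun y => y := by
    filter_upwards [φ.open_source.mem_nhds hx] with y hy using φ.left_inv hy
  rw [md_congr h3, md_id]
  rfl

lemma md_chart_md_chart_symm {φ : OpenPartialHomeomorph X E}
    (hφ : φ ∈ IsManifold.maximalAtlas 𝓘(ℝ, E) ∞ X) {y : E} (hy : y ∈ φ.target) (v : E) :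
    md E E φ (φ.symm y) (md E E φ.symm y v) = v := by
  have h1 : SmoothAt E E φ (φ.symm y) := contMDiffAt_of_mem_maximalAtlas hφ (φ.map_target hy)
  have h2 : SmoothAt E E φ.symm y := contMDiffAt_symm_of_mem_maximalAtlas hφ hy
  rw [← md_comp_apply h1.diffAt h2.diffAt]
  have h3 : (fun y => φ (φ.symm y)) =ᶠ[𝓝 y] fun y => y := by
    filter_upwards [φ.open_target.mem_nhds hy] with y hy using φ.right_inv hy
  rw [md_congr h3, md_id]
  rfl

/-! ### Submersions and immersions -/

/-- A submersion looks like a linear projection in suitable charts. -/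
lemma _root_.Manifold.IsSubmersionAt.exists_charts {f : X → Y} {x : X}
    (h : Manifold.IsSubmersionAt 𝓘(ℝ, E) 𝓘(ℝ, E') ∞ f x) :
    ∃ (φ : OpenPartialHomeomorph X E) (ψ : OpenPartialHomeomorph Y E') (L : E →L[ℝ] E')
      (S : E' →L[ℝ] E), φ ∈ IsManifold.maximalAtlas 𝓘(ℝ, E) ∞ X ∧
      ψ ∈ IsManifold.maximalAtlas 𝓘(ℝ, E') ∞ Y ∧ x ∈ φ.source ∧
      (∀ y ∈ φ.source, f y ∈ ψ.source) ∧ (∀ y ∈ φ.source, ψ (f y) = L (φ y)) ∧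
      (∀ w, L (S w) = w) := by
  refine ⟨h.domChart, h.codChart,
    (ContinuousLinearMap.fst ℝ E' h.complement).comp (h.equiv : E →L[ℝ] E' × h.complement),
    (h.equiv.symm : E' × h.complement →L[ℝ] E).comp (ContinuousLinearMap.inl ℝ E' h.complement),
    h.domChart_mem_maximalAtlas, h.codChart_mem_maximalAtlas, h.mem_domChart_source,
    fun y hy => h.source_subset_preimage_source hy, fun y hy => ?_, fun w => by simp⟩
  have hy' : h.domChart y ∈ (h.domChart.extend 𝓘(ℝ, E)).target := by
    simpa using h.domChart.map_source hy
  have h1 := h.writtenInCharts hy'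
  simpa [hy] using h1

/-- An immersion looks like a linear inclusion in suitable charts. -/
lemma _root_.Manifold.IsImmersionAt.exists_charts {f : X → Y} {x : X}
    (h : Manifold.IsImmersionAt 𝓘(ℝ, E) 𝓘(ℝ, E') ∞ f x) :
    ∃ (φ : OpenPartialHomeomorph X E) (ψ : OpenPartialHomeomorph Y E') (L : E →L[ℝ] E')
      (S : E' →L[ℝ] E), φ ∈ IsManifold.maximalAtlas 𝓘(ℝ, E) ∞ X ∧
      ψ ∈ IsManifold.maximalAtlas 𝓘(ℝ, E') ∞ Y ∧ x ∈ φ.source ∧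
      (∀ y ∈ φ.source, f y ∈ ψ.source) ∧ (∀ y ∈ φ.source, ψ (f y) = L (φ y)) ∧
      (∀ w, S (L w) = w) := by
  refine ⟨h.domChart, h.codChart,
    (h.equiv : E × h.complement →L[ℝ] E').comp (ContinuousLinearMap.inl ℝ E h.complement),
    (ContinuousLinearMap.fst ℝ E h.complement).comp (h.equiv.symm : E' →L[ℝ] E × h.complement),
    h.domChart_mem_maximalAtlas, h.codChart_mem_maximalAtlas, h.mem_domChart_source,
    fun y hy => h.source_subset_preimage_source hy, fun y hy => ?_, fun w => by simp⟩
  have hy' : h.domChart y ∈ (h.domChart.extend 𝓘(ℝ, E)).target := by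
    simpa using h.domChart.map_source hy
  have h1 := h.writtenInCharts hy'
  simpa [hy] using h1

lemma SmoothAt.clm (L : E →L[ℝ] E') (x : E) : SmoothAt E E' L x := L.contMDiff x

lemma md_clm (L : E →L[ℝ] E') (x : E) : md E E' L x = L := by
  rw [md_eq_fderiv, L.fderiv]

lemma _root_.Manifold.IsSubmersionAt.exists_smooth_section {f : X → Y} {x : X}
    (h : Manifold.IsSubmersionAt 𝓘(ℝ, E) 𝓘(ℝ, E') ∞ f x) :
    ∃ s : Y → X, SmoothAt E' E s (f x) ∧ s (f x) = x ∧ ∀ᶠ y in 𝓝 (f x), f (s y) = y := by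
  obtain ⟨φ, ψ, L, S, hφ, hψ, hx, hm, hL, hS⟩ := h.exists_charts
  -- The linear section `S` is translated so that the resulting section passes through `x` itself
  -- and not through another point of its fibre.
  let T : E' → E := fun w => φ x + S (w - ψ (f x))
  have hT : ∀ w, SmoothAt E' E T w := fun w =>
    (contDiff_const.add (S.contDiff.comp (contDiff_id.sub contDiff_const))).contMDiff w
  have hT0 : T (ψ (f x)) = φ x := by simp [T]
  have h1 : SmoothAt E' E' ψ (f x) := contMDiffAt_of_mem_maximalAtlas hψ (hm x hx)
  have h2 : SmoothAt E E φ.symm (φ x) :=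
    contMDiffAt_symm_of_mem_maximalAtlas hφ (φ.map_source hx)
  have h3 : SmoothAt E' E (fun y => T (ψ y)) (f x) := (hT _).comp' h1
  refine ⟨fun y => φ.symm (T (ψ y)), h2.comp_of_eq' h3 hT0, ?_, ?_⟩
  · simp only [hT0, φ.left_inv hx]
  · have h4 : ∀ᶠ y in 𝓝 (f x), T (ψ y) ∈ φ.target := by
      refine h3.continuousAt.eventually_mem (φ.open_target.mem_nhds ?_)
      rw [hT0]
      exact φ.map_source hx
    filter_upwards [h4, ψ.open_source.mem_nhds (hm x hx)] with y hy hy'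
    have h5 := φ.map_target hy
    apply ψ.injOn (hm _ h5) hy'
    rw [hL _ h5, φ.right_inv hy]
    simp [T, hS, hL x hx]

/-- Lifting with prescribed initial velocity turns statements about kernels of tangent maps into
statements about curves: for constant `m` the lift is a curve in a fibre with any given vertical
velocity. -/
lemma _root_.Manifold.IsSubmersionAt.exists_lift {f : X → Y} {x : X}
    (h : Manifold.IsSubmersionAt 𝓘(ℝ, E) 𝓘(ℝ, E') ∞ f x) {m : ℝ → Y} (hm : SmoothAt ℝ E' m 0)
    (hm0 : m 0 = f x) {v : E} (hv : md ℝ E' m 0 1 = md E E' f x v) :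
    ∃ c : ℝ → X, SmoothAt ℝ E c 0 ∧ c 0 = x ∧ md ℝ E c 0 1 = v ∧ ∀ᶠ t in 𝓝 0, f (c t) = m t := by
  obtain ⟨φ, ψ, L, S, hφ, hψ, hx, hmap, hL, hS⟩ := h.exists_charts
  have h1 : SmoothAt E' E' ψ (f x) := contMDiffAt_of_mem_maximalAtlas hψ (hmap x hx)
  have h1' : SmoothAt E E φ x := contMDiffAt_of_mem_maximalAtlas hφ hx
  have h2 : SmoothAt E E φ.symm (φ x) :=
    contMDiffAt_symm_of_mem_maximalAtlas hφ (φ.map_source hx)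
  have hf : SmoothAt E E' f x := h.contMDiffAt
  have hψm : SmoothAt ℝ E' (fun t => ψ (m t)) 0 := h1.comp_of_eq' hm hm0
  set w : E := md E E φ x v with hw
  have hLw : md ℝ E' (fun t => ψ (m t)) 0 1 = L w := by
    rw [md_comp_apply_of_eq hm0 h1.diffAt hm.diffAt, hv, ← md_comp_apply h1.diffAt hf.diffAt]
    have : (fun y => ψ (f y)) =ᶠ[𝓝 x] fun y => L (φ y) := by
      filter_upwards [φ.open_source.mem_nhds hx] with y hy using hL y hy
    rw [md_congr this, md_comp_apply (SmoothAt.clm L _).diffAt h1'.diffAt, md_clm]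
  -- The last term lies over the curve `m`; the middle one moves in the kernel of `L` and corrects
  -- the velocity from `S (L w)` to `w`.
  let T : ℝ → E := fun t => φ x + t • (w - S (L w)) + S (ψ (m t) - ψ (m 0))
  have hψm' : ContDiffAt ℝ ∞ (fun t => ψ (m t)) 0 := contMDiffAt_iff_contDiffAt.1 hψm
  have hT : SmoothAt ℝ E T 0 := by
    refine ContDiffAt.contMDiffAt ?_
    exact (contDiffAt_const.add (contDiffAt_id.smul contDiffAt_const)).add
      (S.contDiff.contDiffAt.comp 0 (hψm'.sub contDiffAt_const))
  have hT0 : T 0 = φ x := by simp [T]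
  have hTv : md ℝ E T 0 1 = w := by
    have h3 : HasDerivAt (fun t => ψ (m t)) (L w) 0 := by
      have h4 := (hψm'.differentiableAt (by simp)).hasFDerivAt.hasDerivAt
      rw [md_eq_fderiv] at hLw
      rwa [hLw] at h4
    have h5 : HasDerivAt T (0 + (1 : ℝ) • (w - S (L w)) + S (L w)) 0 :=
      ((hasDerivAt_const _ _).add ((hasDerivAt_id _).smul_const _)).add
        (S.hasFDerivAt.comp_hasDerivAt 0 (h3.sub_const _))
    rw [md_eq_fderiv, h5.hasFDerivAt.fderiv]
    simp
  have hL' : ∀ t, L (T t) = ψ (m t) := by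
    intro t
    simp [T, hS, hm0, ← hL x hx]
  refine ⟨fun t => φ.symm (T t), h2.comp_of_eq' hT hT0, ?_, ?_, ?_⟩
  · simp only [hT0, φ.left_inv hx]
  · rw [md_comp_apply_of_eq hT0 h2.diffAt hT.diffAt, hTv, hw, md_chart_symm_md_chart hφ hx]
  · have h4 : ∀ᶠ t in 𝓝 (0 : ℝ), T t ∈ φ.target := by
      refine hT.continuousAt.eventually_mem (φ.open_target.mem_nhds ?_)
      rw [hT0]
      exact φ.map_source hx
    have h6 : ∀ᶠ t in 𝓝 (0 : ℝ), m t ∈ ψ.source := by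
      refine hm.continuousAt.eventually_mem (ψ.open_source.mem_nhds ?_)
      rw [hm0]
      exact hmap x hx
    filter_upwards [h4, h6] with t ht ht'
    have h5 := φ.map_target ht
    apply ψ.injOn (hmap _ h5) ht'
    rw [hL _ h5, φ.right_inv ht, hL']

lemma _root_.Manifold.IsSubmersionAt.md_surjective {f : X → Y} {x : X}
    (h : Manifold.IsSubmersionAt 𝓘(ℝ, E) 𝓘(ℝ, E') ∞ f x) :
    Function.Surjective (md E E' f x) := by
  obtain ⟨s, hs, hsx, hfs⟩ := h.exists_smooth_section
  intro w
  refine ⟨md E' E s (f x) w, ?_⟩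
  rw [← md_comp_apply_of_eq hsx (SmoothAt.diffAt h.contMDiffAt) hs.diffAt]
  have h1 : (fun y => f (s y)) =ᶠ[𝓝 (f x)] fun y => y := hfs
  rw [md_congr h1, md_id]
  rfl

/-- Smoothness of maps descends along surjective submersions. -/
lemma _root_.Manifold.IsSubmersion.smoothAt_of_comp {f : X → Y}
    (h : Manifold.IsSubmersion 𝓘(ℝ, E) 𝓘(ℝ, E') ∞ f) {g : Y → W} {x : X}
    (hg : SmoothAt E E'' (fun y => g (f y)) x) : SmoothAt E' E'' g (f x) := by
  obtain ⟨s, hs, hsx, hfs⟩ := (h.isSubmersionAt x).exists_smooth_section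
  have h1 : SmoothAt E' E'' (fun y => g (f (s y))) (f x) :=
    SmoothAt.comp_of_eq' (g := fun z => g (f z)) hg hs hsx
  refine h1.congr_of_eventuallyEq ?_
  filter_upwards [hfs] with y hy
  rw [hy]

lemma _root_.Manifold.IsImmersionAt.exists_left_inverse {f : X → Y} {x : X}
    (h : Manifold.IsImmersionAt 𝓘(ℝ, E) 𝓘(ℝ, E') ∞ f x) :
    ∃ r : Y → X, SmoothAt E' E r (f x) ∧ ∀ᶠ y in 𝓝 x, r (f y) = y := by
  obtain ⟨φ, ψ, L, S, hφ, hψ, hx, hmap, hL, hS⟩ := h.exists_charts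
  have h1 : SmoothAt E' E' ψ (f x) := contMDiffAt_of_mem_maximalAtlas hψ (hmap x hx)
  have h2 : SmoothAt E E φ.symm (φ x) :=
    contMDiffAt_symm_of_mem_maximalAtlas hφ (φ.map_source hx)
  have h3 : SmoothAt E' E (fun y => S (ψ y)) (f x) := (SmoothAt.clm S _).comp' h1
  refine ⟨fun y => φ.symm (S (ψ y)), h2.comp_of_eq' h3 (by rw [hL x hx, hS]), ?_⟩
  filter_upwards [φ.open_source.mem_nhds hx] with y hy
  rw [hL y hy, hS, φ.left_inv hy]

lemma _root_.Manifold.IsImmersionAt.md_injective {f : X → Y} {x : X}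
    (h : Manifold.IsImmersionAt 𝓘(ℝ, E) 𝓘(ℝ, E') ∞ f x) :
    Function.Injective (md E E' f x) := by
  obtain ⟨r, hr, hrf⟩ := h.exists_left_inverse
  have h1 : (fun y => r (f y)) =ᶠ[𝓝 x] fun y => y := hrf
  refine Function.LeftInverse.injective (g := md E' E r (f x)) fun v => ?_
  rw [← md_comp_apply hr.diffAt (SmoothAt.diffAt h.contMDiffAt), md_congr h1, md_id]
  rfl

/-- A map into an embedded submanifold is smooth if it is smooth as a map into the ambient
manifold. -/
lemma _root_.Manifold.IsSmoothEmbedding.smoothAt_of_comp {f : X → Y}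
    (h : Manifold.IsSmoothEmbedding 𝓘(ℝ, E) 𝓘(ℝ, E') ∞ f) {g : W → X} {w : W}
    (hg : SmoothAt E'' E' (fun y => f (g y)) w) : SmoothAt E'' E g w := by
  refine (ContMDiffAt.iff_comp_isImmersionAt (h.isImmersion.isImmersionAt (g w))).2 ⟨?_, hg⟩
  exact h.isEmbedding.isInducing.continuousAt_iff.2 hg.continuousAt

end Derivatives

section Fields

open Filter Topology Set

variable {E : Type*} [NormedAddCommGroup E] [NormedSpace ℝ E]
  {E' : Type*} [NormedAddCommGroup E'] [NormedSpace ℝ E']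
  {E'' : Type*} [NormedAddCommGroup E''] [NormedSpace ℝ E'']
  {X : Type*} [TopologicalSpace X] [ChartedSpace E X] [IsManifold 𝓘(ℝ, E) ∞ X]
  {Y : Type*} [TopologicalSpace Y] [ChartedSpace E' Y] [IsManifold 𝓘(ℝ, E') ∞ Y]
  {W : Type*} [TopologicalSpace W] [ChartedSpace E'' W] [IsManifold 𝓘(ℝ, E'') ∞ W]

/-! ### Smooth vector fields along maps -/

lemma SmoothAt.eventually_diffAt {f : X → Y} {x : X} (h : SmoothAt E E' f x) :
    ∀ᶠ y in 𝓝 x, DiffAt E E' f y := by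
  have h1 : ContMDiffAt 𝓘(ℝ, E) 𝓘(ℝ, E') 1 f x := h.of_le (by norm_cast)
  obtain ⟨u, hu, hfu⟩ := (contMDiffAt_iff_contMDiffOn_nhds (by simp)).1 h1
  filter_upwards [eventually_mem_nhds_iff.2 hu] with y hy
  exact (hfu.contMDiffAt hy).mdifferentiableAt (by simp)

variable (E E') in
/-- Smoothness of a vector field `v` along the map `f`. -/
abbrev SmoothAlong (f : X → Y) (v : X → E') (x : X) : Prop :=
  ContMDiffAt 𝓘(ℝ, E) 𝓘(ℝ, E').tangent ∞
    (fun y => (⟨f y, v y⟩ : TangentBundle 𝓘(ℝ, E') Y)) x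

lemma SmoothAlong.comp {f : X → Y} {v : X → E'} {x : X} (h : SmoothAlong E E' f v x) {g : W → X}
    {w : W} (hg : SmoothAt E'' E g w) (hx : g w = x) :
    SmoothAlong E'' E' (fun y => f (g y)) (fun y => v (g y)) w := by
  subst hx
  exact ContMDiffAt.comp w h hg

lemma SmoothAlong.md {f : X → Y} {v : X → E'} {x : X} (h : SmoothAlong E E' f v x) {g : Y → W}
    (hg : SmoothAt E' E'' g (f x)) :
    SmoothAlong E E'' (fun y => g (f y)) (fun y => md E' E'' g (f y) (v y)) x := by
  -- The tangent map of a C^(n+1) map is C^n. Each `n` is treated separately because the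
  -- neighbourhood on which `g` is C^(n+1) may depend on `n`.
  refine contMDiffAt_infty.2 fun n => ?_
  have hg' : ContMDiffAt 𝓘(ℝ, E') 𝓘(ℝ, E'') ((n + 1 : ℕ) : WithTop ℕ∞) g (f x) :=
    hg.of_le (by exact_mod_cast le_top)
  obtain ⟨t, ht, hgt⟩ := (contMDiffAt_iff_contMDiffOn_nhds (by simp)).1 hg'
  obtain ⟨s, hst, hs, hxs⟩ := mem_nhds_iff.1 ht
  have h1 := (hgt.mono hst).contMDiffOn_tangentMapWithin (m := (n : WithTop ℕ∞)) (by simp)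
    hs.uniqueMDiffOn
  have h2 : ContMDiffAt 𝓘(ℝ, E').tangent 𝓘(ℝ, E'').tangent n
      (tangentMapWithin 𝓘(ℝ, E') 𝓘(ℝ, E'') g s) ⟨f x, v x⟩ := by
    refine h1.contMDiffAt ?_
    exact (hs.preimage (FiberBundle.continuous_proj E' (TangentSpace 𝓘(ℝ, E')))).mem_nhds hxs
  have h0 : ContMDiffAt 𝓘(ℝ, E) 𝓘(ℝ, E').tangent n
      (fun y => (⟨f y, v y⟩ : TangentBundle 𝓘(ℝ, E') Y)) x :=
    h.of_le (by exact_mod_cast le_top)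
  have h3 := ContMDiffAt.comp x h2 h0
  refine h3.congr_of_eventuallyEq ?_
  have h4 : ContinuousAt f x :=
    (FiberBundle.continuous_proj E' (TangentSpace 𝓘(ℝ, E'))).continuousAt.comp h0.continuousAt
  filter_upwards [h4.eventually_mem (hs.mem_nhds hxs)] with y hy
  have h5 := tangentMapWithin_eq_tangentMap (I := 𝓘(ℝ, E')) (I' := 𝓘(ℝ, E''))
    (p := (⟨f y, v y⟩ : TangentBundle 𝓘(ℝ, E') Y)) (hs.uniqueMDiffWithinAt hy)
    (((hgt.mono hst).contMDiffAt (hs.mem_nhds hy)).mdifferentiableAt (by simp))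
  exact h5.symm

lemma SmoothAlong.snd {f : X → E'} {v : X → E'} {x : X} (h : SmoothAlong E E' f v x) :
    SmoothAt E E' v x :=
  ContMDiffAt.comp x
    (g := fun p : TangentBundle 𝓘(ℝ, E') E' => (p.2 : E'))
    ((contMDiff_snd_tangentBundle_modelSpace E' 𝓘(ℝ, E') (n := ∞)).contMDiffAt) h

lemma smoothAlong_id {v : E → E} {x : E} (h : SmoothAt E E v x) :
    SmoothAlong E E (fun y => y) v x :=
  contMDiffAt_vectorSpace_iff_contDiffAt.2 (contMDiffAt_iff_contDiffAt.1 h)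

/-- The representation of a vector field in a chart. -/
noncomputable def chartField (φ : OpenPartialHomeomorph X E) (V : X → E) (y : E) : E :=
  md E E φ (φ.symm y) (V (φ.symm y))

lemma contDiffAt_chartField {φ : OpenPartialHomeomorph X E}
    (hφ : φ ∈ IsManifold.maximalAtlas 𝓘(ℝ, E) ∞ X) {V : X → E} {y : E} (hy : y ∈ φ.target)
    (hV : SmoothAlong E E (fun y => y) V (φ.symm y)) : ContDiffAt ℝ ∞ (chartField φ V) y := by
  have h1 : SmoothAt E E φ (φ.symm y) := contMDiffAt_of_mem_maximalAtlas hφ (φ.map_target hy)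
  have h2 : SmoothAt E E φ.symm y := contMDiffAt_symm_of_mem_maximalAtlas hφ hy
  exact contMDiffAt_iff_contDiffAt.1 ((hV.md h1).snd.comp' h2)

lemma md_symm_chartField {φ : OpenPartialHomeomorph X E}
    (hφ : φ ∈ IsManifold.maximalAtlas 𝓘(ℝ, E) ∞ X) {V : X → E} {y : E} (hy : y ∈ φ.target) :
    md E E φ.symm y (chartField φ V y) = V (φ.symm y) := by
  have h := md_chart_symm_md_chart hφ (φ.map_target hy) (V (φ.symm y))
  rwa [φ.right_inv hy] at h

/-! ### Flows -/

/-- Two integral curves with the same initial point agree on the overlap of their intervals, so the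
curve selected by choice in `flow` can be replaced by any other. -/
lemma flow_eq [T2Space X] {V : VField E X} (hV : SmoothField V) {a b t : ℝ} {c : ℝ → X} {x : X}
    (h0 : (0 : ℝ) ∈ Ioo a b) (ht : t ∈ Ioo a b) (hx : c 0 = x)
    (hc : IsMIntegralCurveOn (I := 𝓘(ℝ, E)) c V (Ioo a b)) : flow V t x = c t := by
  have hex : ∃ y : X, ∃ (a b : ℝ) (c : ℝ → X), (0 : ℝ) ∈ Set.Ioo a b ∧ t ∈ Set.Ioo a b ∧ c 0 = x ∧
      IsMIntegralCurveOn (I := 𝓘(ℝ, E)) c V (Set.Ioo a b) ∧ c t = y :=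
    ⟨c t, a, b, c, h0, ht, hx, hc, rfl⟩
  rw [flow, dif_pos hex]
  obtain ⟨a', b', c', h0', ht', hx', hc', hct⟩ := hex.choose_spec
  rw [← hct]
  have : IsManifold 𝓘(ℝ, E) 1 X := IsManifold.of_le (n := ∞) (by simp)
  have hV1 : ContMDiff 𝓘(ℝ, E) 𝓘(ℝ, E).tangent 1
      (fun x => (⟨x, V x⟩ : TangentBundle 𝓘(ℝ, E) X)) := ContMDiff.of_le hV (by simp)
  have key := isMIntegralCurveOn_Ioo_eqOn_of_contMDiff_boundaryless (I := 𝓘(ℝ, E))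
    (t₀ := 0) (a := max a' a) (b := min b' b) (γ := c') (γ' := c) (v := V)
    ⟨max_lt h0'.1 h0.1, lt_min h0'.2 h0.2⟩ hV1
    (hc'.mono (Ioo_subset_Ioo (le_max_left _ _) (min_le_left _ _)))
    (hc.mono (Ioo_subset_Ioo (le_max_right _ _) (min_le_right _ _))) (hx'.trans hx.symm)
  exact key ⟨max_lt ht'.1 ht.1, lt_min ht'.2 ht.2⟩

/-- The local flow of a vector field on an open subset of a vector space, up to first order in
time. -/
lemma exists_local_flow [CompleteSpace E] {v : E → E} {x₀ : E} (hv : ContDiffAt ℝ 1 v x₀)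
    {U : Set E} (hU : U ∈ 𝓝 x₀) :
    ∃ α : E × ℝ → E, ∃ ε > 0, (∀ᶠ z in 𝓝 x₀, α (z, 0) = z ∧
      ∀ t ∈ Ioo (-ε) ε, HasDerivAt (fun s => α (z, s)) (v (α (z, t))) t ∧ α (z, t) ∈ U) ∧
      (fun p : E × ℝ => α p - p.1 - p.2 • v x₀) =o[𝓝 (x₀, 0)] fun p => p.2 := by
  obtain ⟨ε, hε, a, r, L, K, hr, hP⟩ := IsPicardLindelof.of_contDiffAt_one hv
  obtain ⟨α, hα, hcont⟩ := (hP 0).exists_forall_mem_closedBall_eq_hasDerivWithinAt_continuousOn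
  simp only [zero_sub, zero_add] at hα hcont
  have hr' : (0 : ℝ) < r := hr
  have hα' : ∀ z ∈ Metric.closedBall x₀ r, ∀ t ∈ Ioo (-ε) ε,
      HasDerivAt (fun s => α (z, s)) (v (α (z, t))) t := fun z hz t ht =>
    ((hα z hz).2 t (Ioo_subset_Icc_self ht)).hasDerivAt (Icc_mem_nhds ht.1 ht.2)
  have hα0 : α (x₀, 0) = x₀ := (hα x₀ (Metric.mem_closedBall_self hr'.le)).1
  have hcα : ContinuousAt α (x₀, 0) := by
    refine hcont.continuousAt ?_
    rw [nhds_prod_eq]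
    exact prod_mem_prod (Metric.closedBall_mem_nhds _ hr') (Icc_mem_nhds (by linarith) hε)
  have hsmall : ∀ U ∈ 𝓝 x₀, ∃ δ > 0, δ ≤ ε ∧ δ ≤ r ∧ ∀ z ∈ Metric.ball x₀ δ, ∀ t ∈ Ioo (-δ) δ,
      α (z, t) ∈ U := by
    intro U hU
    have h1 : ∀ᶠ p in 𝓝 (x₀, (0 : ℝ)), α p ∈ U := hcα.eventually_mem (by rwa [hα0])
    obtain ⟨δ, hδ, hb⟩ := Metric.eventually_nhds_iff_ball.1 h1
    refine ⟨min δ (min ε r), lt_min hδ (lt_min hε hr'), (min_le_right _ _).trans (min_le_left _ _),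
      (min_le_right _ _).trans (min_le_right _ _), fun z hz t ht => hb _ ?_⟩
    rw [← ball_prod_same]
    refine ⟨Metric.ball_subset_ball (min_le_left _ _) hz, ?_⟩
    rw [Real.ball_eq_Ioo]
    have := min_le_left δ (min ε r)
    exact ⟨by have := ht.1; linarith, by have := ht.2; linarith⟩
  obtain ⟨δ, hδ, hδε, hδr, hδU⟩ := hsmall U hU
  refine ⟨α, δ, hδ, ?_, ?_⟩
  · filter_upwards [Metric.ball_mem_nhds x₀ hδ] with z hz
    have hz' : z ∈ Metric.closedBall x₀ r :=
      Metric.ball_subset_closedBall (Metric.ball_subset_ball hδr hz)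
    refine ⟨(hα z hz').1, fun t ht => ⟨hα' z hz' t ?_, hδU z hz t ht⟩⟩
    exact ⟨by linarith [ht.1], by linarith [ht.2]⟩
  -- The mean value inequality for `s ↦ α (z, s) - s • v x₀` bounds the error by `η |t|` for all `z`
  -- near `x₀` at once. This uniformity replaces differentiability of the flow in the initial point.
  · rw [Asymptotics.isLittleO_iff]
    intro η hη
    obtain ⟨δ', hδ', hδε', hδr', hb⟩ := hsmall {y | ‖v y - v x₀‖ ≤ η} (by
      have : ∀ᶠ y in 𝓝 x₀, dist (v y) (v x₀) ≤ η :=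
        (hv.continuousAt.eventually (Metric.closedBall_mem_nhds _ hη))
      simp only [dist_eq_norm] at this
      exact this)
    have hn : Metric.ball x₀ δ' ×ˢ Ioo (-δ') δ' ∈ 𝓝 (x₀, (0 : ℝ)) := by
      rw [nhds_prod_eq]
      exact prod_mem_prod (Metric.ball_mem_nhds _ hδ') (Ioo_mem_nhds (by linarith) hδ')
    filter_upwards [hn] with p hp
    obtain ⟨z, t⟩ := p
    obtain ⟨hz, ht⟩ := hp
    simp only at hz ht
    have hz' : z ∈ Metric.closedBall x₀ r :=
      Metric.ball_subset_closedBall (Metric.ball_subset_ball hδr' hz)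
    have h1 : ∀ s ∈ Ioo (-δ') δ', HasDerivWithinAt (fun s => α (z, s) - s • v x₀)
        (v (α (z, s)) - (1 : ℝ) • v x₀) (Ioo (-δ') δ') s := fun s hs =>
      ((hα' z hz' s ⟨by linarith [hs.1], by linarith [hs.2]⟩).sub
        ((hasDerivAt_id s).smul_const _)).hasDerivWithinAt
    have h2 := (convex_Ioo (-δ') δ').norm_image_sub_le_of_norm_hasDerivWithin_le h1
      (C := η) (fun s hs => by simpa using hb z hz s hs) (show (0 : ℝ) ∈ Ioo (-δ') δ' from ⟨by linarith, hδ'⟩) ht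
    have h3 : α (z, 0) = z := (hα z hz').1
    simp only [h3, zero_smul, sub_zero] at h2
    convert h2 using 2
    abel

/-- The local flow of a smooth vector field in a chart. -/
lemma exists_chart_flow [T2Space X] [CompleteSpace E] {V : VField E X} (hV : SmoothField V)
    (u : X) :
    ∃ α : E × ℝ → E,
      (∀ᶠ p in 𝓝 (u, (0 : ℝ)), flow V p.2 p.1 = (chartAt E u).symm (α (chartAt E u p.1, p.2))) ∧
      α (chartAt E u u, 0) = chartAt E u u ∧
      (fun p : E × ℝ => α p - p.1 - p.2 • chartField (chartAt E u) V (chartAt E u u))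
        =o[𝓝 (chartAt E u u, 0)] fun p => p.2 := by
  set φ := chartAt E u with hφdef
  have hφ : φ ∈ IsManifold.maximalAtlas 𝓘(ℝ, E) ∞ X := IsManifold.chart_mem_maximalAtlas u
  have hu : u ∈ φ.source := mem_chart_source E u
  have hφu : φ u ∈ φ.target := φ.map_source hu
  have hv : ContDiffAt ℝ 1 (chartField φ V) (φ u) :=
    (contDiffAt_chartField hφ hφu (hV _)).of_le (by simp)
  obtain ⟨α, ε, hε, hα, ho⟩ := exists_local_flow hv (φ.open_target.mem_nhds hφu)
  refine ⟨α, ?_, hα.self_of_nhds.1, ho⟩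
  have hcont : ContinuousAt φ u := φ.continuousAt hu
  rw [nhds_prod_eq]
  have h1 : ∀ᶠ x in 𝓝 u, x ∈ φ.source ∧ α (φ x, 0) = φ x ∧
      ∀ t ∈ Ioo (-ε) ε, HasDerivAt (fun s => α (φ x, s)) (chartField φ V (α (φ x, t))) t ∧
        α (φ x, t) ∈ φ.target := by
    filter_upwards [φ.open_source.mem_nhds hu, hcont.eventually hα] with x hx hx'
    exact ⟨hx, hx'⟩
  have h2 : ∀ᶠ t in 𝓝 (0 : ℝ), t ∈ Ioo (-ε) ε := Ioo_mem_nhds (by linarith) hε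
  filter_upwards [h1.prod_mk h2] with p hp
  obtain ⟨x, t⟩ := p
  obtain ⟨⟨hx, hx0, hxt⟩, ht⟩ := hp
  refine flow_eq hV (a := -ε) (b := ε) (c := fun t => φ.symm (α (φ x, t)))
    ⟨by linarith, hε⟩ ht ?_ ?_
  · simp only [hx0, φ.left_inv hx]
  · intro s hs
    obtain ⟨hd, hmem⟩ := hxt s hs
    refine HasMFDerivAt.hasMFDerivWithinAt ?_
    have hsm : SmoothAt E E φ.symm (α (φ x, s)) :=
      contMDiffAt_symm_of_mem_maximalAtlas hφ hmem
    have hd' : DiffAt ℝ E (fun s => α (φ x, s)) s :=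
      diffAt_iff_differentiableAt.2 hd.differentiableAt
    refine hasMFDerivAt_iff_md.2 ⟨DiffAt.comp' (g := φ.symm) hsm.diffAt hd', ?_⟩
    refine ContinuousLinearMap.ext_ring ?_
    refine (md_comp_apply (g := φ.symm) (f := fun s => α (φ x, s)) hsm.diffAt hd' 1).trans ?_
    rw [md_eq_fderiv (fun s => α (φ x, s)), hd.hasFDerivAt.fderiv,
      ContinuousLinearMap.toSpanSingleton_apply, one_smul]
    refine (md_symm_chartField hφ (V := V) hmem).trans ?_
    exact (one_smul ℝ (show E from V (φ.symm (α (φ x, s))))).symm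

lemma diffAt_of_chart {u : X} {c : ℝ → X} {d : ℝ → E} {w : E} {v : E}
    (hc : ∀ᶠ t in 𝓝 (0 : ℝ), c t = (chartAt E u).symm (d t)) (hd0 : d 0 = chartAt E u u)
    (hd : HasDerivAt d w 0) (hw : w = md E E (chartAt E u) u v) :
    DiffAt ℝ E c 0 ∧ md ℝ E c 0 1 = v := by
  set φ := chartAt E u with hφdef
  have hφ : φ ∈ IsManifold.maximalAtlas 𝓘(ℝ, E) ∞ X := IsManifold.chart_mem_maximalAtlas u
  have hu : u ∈ φ.source := mem_chart_source E u
  have hsm : SmoothAt E E φ.symm (φ u) :=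
    contMDiffAt_symm_of_mem_maximalAtlas hφ (φ.map_source hu)
  rw [← hd0] at hsm
  have hd' : DiffAt ℝ E d 0 := diffAt_iff_differentiableAt.2 hd.differentiableAt
  refine ⟨DiffAt.congr (DiffAt.comp' (g := φ.symm) hsm.diffAt hd') hc, ?_⟩
  rw [md_congr hc, md_comp_apply (g := φ.symm) hsm.diffAt hd', md_eq_fderiv,
    hd.hasFDerivAt.fderiv, hd0, ← md_chart_symm_md_chart hφ hu v, ← hw]
  simp

lemma md_flow [T2Space X] [CompleteSpace E] {V : X → E}
    (hV : SmoothField (E := E) (X := X) V) (u : X) :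
    DiffAt ℝ E (fun t => flow (E := E) V t u) 0 ∧ md ℝ E (fun t => flow (E := E) V t u) 0 1 = V u ∧
      flow (E := E) V 0 u = u := by
  obtain ⟨α, hα, hα0, ho⟩ := exists_chart_flow hV u
  set φ := chartAt E u with hφdef
  have hu : u ∈ φ.source := mem_chart_source E u
  have hc : ∀ᶠ t in 𝓝 (0 : ℝ), flow (E := E) V t u = φ.symm (α (φ u, t)) :=
    (Continuous.prodMk_right u).continuousAt.eventually hα
  have hd : HasDerivAt (fun t => α (φ u, t)) (chartField φ V (φ u)) 0 := by
    rw [hasDerivAt_iff_isLittleO_nhds_zero]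
    have h1 : Tendsto (fun t : ℝ => (φ u, t)) (𝓝 0) (𝓝 (φ u, 0)) :=
      (Continuous.prodMk_right _).continuousAt
    have h2 := ho.comp_tendsto h1
    simpa [Function.comp_def, hα0] using h2
  have h3 := diffAt_of_chart (v := V u) hc hα0 hd
    (by rw [chartField, φ.left_inv hu])
  refine ⟨h3.1, h3.2, ?_⟩
  rw [hc.self_of_nhds, hα0, φ.left_inv hu]

/-- The starting point moves with `t`, which is why the first-order expansion of the local flow has
to be uniform in it: to first order the motion of `y` and the backward flow simply add up. -/
lemma md_flow_neg [T2Space X] [CompleteSpace E] {V : X → E}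
    (hV : SmoothField (E := E) (X := X) V) {y : ℝ → X}
    (hy : DiffAt ℝ E y 0) :
    DiffAt ℝ E (fun t => flow (E := E) V (-t) (y t)) 0 ∧
      md ℝ E (fun t => flow (E := E) V (-t) (y t)) 0 1 = md ℝ E y 0 1 - V (y 0) := by
  set u := y 0 with hu0
  obtain ⟨α, hα, hα0, ho⟩ := exists_chart_flow hV u
  set φ := chartAt E u with hφdef
  have hφ : φ ∈ IsManifold.maximalAtlas 𝓘(ℝ, E) ∞ X := IsManifold.chart_mem_maximalAtlas u
  have hu : u ∈ φ.source := mem_chart_source E u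
  have hφs : SmoothAt E E φ (y 0) := contMDiffAt_of_mem_maximalAtlas hφ hu
  have hyc : Tendsto y (𝓝 0) (𝓝 u) := hy.continuousAt
  have hneg : Tendsto (fun t : ℝ => -t) (𝓝 0) (𝓝 0) := by
    simpa using (continuous_neg (G := ℝ)).tendsto 0
  have hc : ∀ᶠ t in 𝓝 (0 : ℝ), flow (E := E) V (-t) (y t) = φ.symm (α (φ (y t), -t)) :=
    (hyc.prodMk_nhds hneg).eventually hα
  have hφy : HasDerivAt (fun t => φ (y t)) (md E E φ u (md ℝ E y 0 1)) 0 := by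
    have h1 : DiffAt ℝ E (fun t => φ (y t)) 0 := hφs.diffAt.comp' hy
    have h2 := (diffAt_iff_differentiableAt.1 h1).hasFDerivAt.hasDerivAt
    rwa [← md_eq_fderiv, md_comp_apply hφs.diffAt hy] at h2
  have hd : HasDerivAt (fun t => α (φ (y t), -t))
      (md E E φ u (md ℝ E y 0 1) - chartField φ V (φ u)) 0 := by
    rw [hasDerivAt_iff_isLittleO_nhds_zero]
    have h1 : Tendsto (fun t : ℝ => (φ (y t), -t)) (𝓝 0) (𝓝 (φ u, 0)) :=
      ((φ.continuousAt hu).tendsto.comp hyc).prodMk_nhds hneg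
    have h2 := (ho.comp_tendsto h1).trans_isBigO
      (k := fun t : ℝ => t) (by
        simpa [Function.comp_def] using (Asymptotics.isBigO_refl (fun t : ℝ => t) (𝓝 0)).neg_left)
    have h3 := (hasDerivAt_iff_isLittleO_nhds_zero.1 hφy)
    have h4 := h2.add h3
    refine h4.congr_left fun t => ?_
    simp only [Function.comp_apply, zero_add, neg_zero, ← hu0, hα0, neg_smul, smul_sub]
    abel
  have hd0 : α (φ (y 0), -0) = φ u := by rw [neg_zero, ← hu0, hα0]
  refine diffAt_of_chart hc hd0 hd ?_
  rw [map_sub, chartField, φ.left_inv hu]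

/-- A map `f` satisfies `(d/dt)|_{t=0} Fl^V_{-t} ∘ f ∘ Fl^X_t = 0` if and only if it relates the
vector fields `X` and `V`. -/
lemma hasMFDerivAt_flow_iff [T2Space X] [T2Space Y] [CompleteSpace E] [CompleteSpace E']
    {U : X → E} {V : Y → E'} (hU : SmoothField (E := E) (X := X) U)
    (hV : SmoothField (E := E') (X := Y) V) {f : X → Y}
    {x : X} (hf : DiffAt E E' f x) :
    HasMFDerivAt 𝓘(ℝ, ℝ) 𝓘(ℝ, E') (fun t : ℝ => flow (E := E') V (-t) (f (flow (E := E) U t x))) 0 0 ↔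
      md E E' f x (U x) = V (f x) := by
  obtain ⟨h1, h2, h3⟩ := md_flow hU x
  have hf' : DiffAt E E' f (flow (E := E) U 0 x) := by rwa [h3]
  have h4 : DiffAt ℝ E' (fun t => f (flow (E := E) U t x)) 0 :=
    DiffAt.comp' (f := fun t => flow (E := E) U t x) hf' h1
  obtain ⟨h5, h6⟩ := md_flow_neg hV h4
  have h7 : md ℝ E' (fun t => flow (E := E') V (-t) (f (flow (E := E) U t x))) 0 1
      = md E E' f x (U x) - V (f x) := by
    rw [h6, md_comp_apply (f := fun t => flow (E := E) U t x) hf' h1, h2, h3]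
  constructor
  · intro h
    have h8 := (hasMFDerivAt_iff_md.1 h).2
    rw [h8] at h7
    exact (sub_eq_zero.1 h7.symm)
  · intro h
    refine hasMFDerivAt_iff_md.2 ⟨h5, ContinuousLinearMap.ext_ring ?_⟩
    rw [h7, h]
    exact sub_self _

end Fields

section Bracket

open Filter Topology Set

variable {E : Type*} [NormedAddCommGroup E] [NormedSpace ℝ E]
  {X : Type*} [TopologicalSpace X] [ChartedSpace E X] [IsManifold 𝓘(ℝ, E) ∞ X]

/-! ### The Lie bracket in charts -/

/-- The tangent space at `x` is the model space read through the preferred chart at `x`. -/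
lemma md_chartAt_self (x : X) (v : E) : md E E (chartAt E x) x v = v := by
  have : IsManifold 𝓘(ℝ, E) 1 X := IsManifold.of_le (n := ∞) (by simp)
  have h := congrFun (congrArg DFunLike.coe (mfderiv_extChartAt_self (I := 𝓘(ℝ, E)) (x := x))) v
  exact h

lemma md_chartAt_symm_self (x : X) (v : E) :
    md E E (chartAt E x).symm (chartAt E x x) v = v := by
  have h := md_chart_symm_md_chart (IsManifold.chart_mem_maximalAtlas (I := 𝓘(ℝ, E)) (n := ∞) x)
    (mem_chart_source E x) v
  rwa [md_chartAt_self] at h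

lemma mpullbackWithin_chart_eq (x : X) (V : VField E X) {y : E} (hy : y ∈ (chartAt E x).target) :
    VectorField.mpullbackWithin 𝓘(ℝ, E) 𝓘(ℝ, E) (extChartAt 𝓘(ℝ, E) x).symm V
      (range 𝓘(ℝ, E)) y = chartField (chartAt E x) V y := by
  have hφ : chartAt E x ∈ IsManifold.maximalAtlas 𝓘(ℝ, E) ∞ X :=
    IsManifold.chart_mem_maximalAtlas x
  set φ := chartAt E x with hφdef
  rw [VectorField.mpullbackWithin_apply, ModelWithCorners.range_eq_univ, mfderivWithin_univ]
  have h1 : ContinuousLinearMap.inverse (md E E φ.symm y) = md E E φ (φ.symm y) := by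
    refine ContinuousLinearMap.inverse_eq (ContinuousLinearMap.ext fun v => ?_)
      (ContinuousLinearMap.ext fun v => ?_)
    · have h := md_chart_symm_md_chart hφ (φ.map_target hy) v
      rw [φ.right_inv hy] at h
      exact h
    · exact md_chart_md_chart_symm hφ hy v
  exact congrArg (fun T : E →L[ℝ] E => T (V (φ.symm y))) h1

/-- The bracket is computed by pulling the fields back to the chart; as the chart has identity
derivative at `x`, the flat bracket needs no further correction. -/
lemma mlieBracket_eq_chart (V W : VField E X) (x : X) :
    (VectorField.mlieBracket 𝓘(ℝ, E) V W x : E) =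
      fderiv ℝ (chartField (chartAt E x) W) (chartAt E x x) (V x) -
      fderiv ℝ (chartField (chartAt E x) V) (chartAt E x x) (W x) := by
  have : IsManifold 𝓘(ℝ, E) 1 X := IsManifold.of_le (n := ∞) (by simp)
  set φ := chartAt E x with hφdef
  have hx : x ∈ φ.source := mem_chart_source E x
  have h0 : ∀ V : X → E, chartField φ V (φ x) = V x := fun V => by
    rw [chartField, φ.left_inv hx]
    exact md_chartAt_self x _
  have h1 : ∀ V : VField E X, VectorField.mpullbackWithin 𝓘(ℝ, E) 𝓘(ℝ, E)
      (extChartAt 𝓘(ℝ, E) x).symm V (range 𝓘(ℝ, E)) =ᶠ[𝓝 (φ x)] chartField φ V := fun V => by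
    filter_upwards [φ.open_target.mem_nhds (φ.map_source hx)] with y hy
    exact mpullbackWithin_chart_eq x V hy
  have h2 : ContinuousLinearMap.inverse (md E E φ x) = ContinuousLinearMap.id ℝ E := by
    have : md E E φ x = ContinuousLinearMap.id ℝ E :=
      ContinuousLinearMap.ext fun v => md_chartAt_self x v
    rw [this, ContinuousLinearMap.inverse_id]
  rw [← VectorField.mlieBracketWithin_univ, VectorField.mlieBracketWithin_apply]
  refine (congrArg (fun T : E →L[ℝ] E => T _) h2).trans ?_
  rw [ModelWithCorners.range_eq_univ] at h1 ⊢
  rw [preimage_univ, univ_inter]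
  have h3 := Filter.EventuallyEq.lieBracket_vectorField_eq (𝕜 := ℝ) (h1 V) (h1 W)
  refine (Eq.trans (congrFun (VectorField.lieBracketWithin_univ (𝕜 := ℝ)) (φ x)) h3).trans ?_
  rw [VectorField.lieBracket_eq]
  exact congrArg₂ (fun v w : E => fderiv ℝ (chartField φ W) (φ x) v -
    fderiv ℝ (chartField φ V) (φ x) w) (h0 V) (h0 W)

end Bracket

/-! ### The adjoint representation -/

section Adjoint

open Filter Topology Set

variable {EG : Type*} [NormedAddCommGroup EG] [NormedSpace ℝ EG] [FiniteDimensional ℝ EG]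
  {G : Type*} [TopologicalSpace G] [ChartedSpace EG G] [Group G] [LieGroup 𝓘(ℝ, EG) ∞ G]

/-- A smooth map of two variables on a Lie group in the chart at the identity. -/
noncomputable def chartTwo (a : G → G → G) (p : EG × EG) : EG :=
  chartAt EG (1 : G) (a ((chartAt EG (1 : G)).symm p.1) ((chartAt EG (1 : G)).symm p.2))

variable {a : G → G → G}
  (ha : ContMDiff (𝓘(ℝ, EG).prod 𝓘(ℝ, EG)) 𝓘(ℝ, EG) ∞ (fun q : G × G => a q.1 q.2))

include ha in
lemma contDiffAt_chartTwo {p : EG × EG} (h1 : p.1 ∈ (chartAt EG (1 : G)).target)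
    (h2 : p.2 ∈ (chartAt EG (1 : G)).target)
    (h3 : a ((chartAt EG (1 : G)).symm p.1) ((chartAt EG (1 : G)).symm p.2)
      ∈ (chartAt EG (1 : G)).source) : ContDiffAt ℝ ∞ (chartTwo a) p := by
  set φ := chartAt EG (1 : G)
  have hφ : φ ∈ IsManifold.maximalAtlas 𝓘(ℝ, EG) ∞ G := IsManifold.chart_mem_maximalAtlas 1
  have k1 : SmoothAt (EG × EG) EG (fun p : EG × EG => φ.symm p.1) p :=
    SmoothAt.comp' (g := φ.symm) (contMDiffAt_symm_of_mem_maximalAtlas hφ h1)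
      contDiffAt_fst.contMDiffAt
  have k2 : SmoothAt (EG × EG) EG (fun p : EG × EG => φ.symm p.2) p :=
    SmoothAt.comp' (g := φ.symm) (contMDiffAt_symm_of_mem_maximalAtlas hφ h2)
      contDiffAt_snd.contMDiffAt
  have k3 : SmoothAt EG EG φ (a (φ.symm p.1) (φ.symm p.2)) :=
    contMDiffAt_of_mem_maximalAtlas hφ h3
  exact contMDiffAt_iff_contDiffAt.1
    (SmoothAt.comp' (f := fun p : EG × EG => a (φ.symm p.1) (φ.symm p.2)) k3
      (smoothAt_two ha k1 k2))

include ha in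
lemma diffAt_snd_two (g h : G) : DiffAt EG EG (fun x => a g x) h :=
  diffAt_two ha (mdifferentiableAt_const) (mdifferentiableAt_id)

include ha in
lemma diffAt_fst_two (g h : G) : DiffAt EG EG (fun x => a x g) h :=
  diffAt_two ha (mdifferentiableAt_id) (mdifferentiableAt_const)

include ha in
lemma fderiv_chartTwo_snd {y : EG} (h1 : y ∈ (chartAt EG (1 : G)).target)
    (h3 : a ((chartAt EG (1 : G)).symm y) 1 ∈ (chartAt EG (1 : G)).source) (v : EG) :
    fderiv ℝ (chartTwo a) (y, chartAt EG (1 : G) 1) (0, v)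
      = md EG EG (chartAt EG (1 : G)) (a ((chartAt EG (1 : G)).symm y) 1)
          (md EG EG (fun x => a ((chartAt EG (1 : G)).symm y) x) 1 v) := by
  set φ := chartAt EG (1 : G) with hφdef
  have hφ : φ ∈ IsManifold.maximalAtlas 𝓘(ℝ, EG) ∞ G := IsManifold.chart_mem_maximalAtlas 1
  have hs : (1 : G) ∈ φ.source := mem_chart_source EG 1
  have ht : φ 1 ∈ φ.target := φ.map_source hs
  have hl : φ.symm (φ 1) = 1 := φ.left_inv hs
  have k1 : DifferentiableAt ℝ (chartTwo a) (y, φ 1) :=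
    (contDiffAt_chartTwo ha h1 ht (by rw [hl]; exact h3)).differentiableAt (by simp)
  have k2 : HasFDerivAt (fun w : EG => chartTwo a (y, w)) _ (φ 1) :=
    HasFDerivAt.comp (g := chartTwo a) (f := fun w : EG => (y, w)) (φ 1) k1.hasFDerivAt
      (hasFDerivAt_prodMk_right y (φ 1))
  have k3 : fderiv ℝ (chartTwo a) (y, φ 1) (0, v)
      = fderiv ℝ (fun w : EG => chartTwo a (y, w)) (φ 1) v := by
    rw [k2.fderiv]; rfl
  have hsm : SmoothAt EG EG φ.symm (φ 1) := contMDiffAt_symm_of_mem_maximalAtlas hφ ht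
  have k4 : DiffAt EG EG (fun x => a (φ.symm y) x) 1 := diffAt_snd_two ha _ _
  have k5 : SmoothAt EG EG φ (a (φ.symm y) 1) := contMDiffAt_of_mem_maximalAtlas hφ h3
  have k6 : DiffAt EG EG (fun w => a (φ.symm y) (φ.symm w)) (φ 1) :=
    DiffAt.comp' (g := fun x => a (φ.symm y) x) (f := φ.symm) (by rwa [hl]) hsm.diffAt
  rw [k3, ← md_eq_fderiv]
  refine (md_comp_apply_of_eq (g := φ) (f := fun w => a (φ.symm y) (φ.symm w)) (by rw [hl])
    k5.diffAt k6 v).trans ?_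
  rw [md_comp_apply_of_eq (g := fun x => a (φ.symm y) x) (f := φ.symm) hl k4 hsm.diffAt,
    md_chartAt_symm_self]

include ha in
lemma fderiv_chartTwo_fst {y : EG} (h1 : y ∈ (chartAt EG (1 : G)).target)
    (h3 : a 1 ((chartAt EG (1 : G)).symm y) ∈ (chartAt EG (1 : G)).source) (v : EG) :
    fderiv ℝ (chartTwo a) (chartAt EG (1 : G) 1, y) (v, 0)
      = md EG EG (chartAt EG (1 : G)) (a 1 ((chartAt EG (1 : G)).symm y))
          (md EG EG (fun x => a x ((chartAt EG (1 : G)).symm y)) 1 v) := by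
  set φ := chartAt EG (1 : G) with hφdef
  have hφ : φ ∈ IsManifold.maximalAtlas 𝓘(ℝ, EG) ∞ G := IsManifold.chart_mem_maximalAtlas 1
  have hs : (1 : G) ∈ φ.source := mem_chart_source EG 1
  have ht : φ 1 ∈ φ.target := φ.map_source hs
  have hl : φ.symm (φ 1) = 1 := φ.left_inv hs
  have k1 : DifferentiableAt ℝ (chartTwo a) (φ 1, y) :=
    (contDiffAt_chartTwo ha ht h1 (by rw [hl]; exact h3)).differentiableAt (by simp)
  have k2 : HasFDerivAt (fun w : EG => chartTwo a (w, y)) _ (φ 1) :=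
    HasFDerivAt.comp (g := chartTwo a) (f := fun w : EG => (w, y)) (φ 1) k1.hasFDerivAt
      (hasFDerivAt_prodMk_left (φ 1) y)
  have k3 : fderiv ℝ (chartTwo a) (φ 1, y) (v, 0)
      = fderiv ℝ (fun w : EG => chartTwo a (w, y)) (φ 1) v := by
    rw [k2.fderiv]; rfl
  have hsm : SmoothAt EG EG φ.symm (φ 1) := contMDiffAt_symm_of_mem_maximalAtlas hφ ht
  have k4 : DiffAt EG EG (fun x => a x (φ.symm y)) 1 := diffAt_fst_two ha _ _
  have k5 : SmoothAt EG EG φ (a 1 (φ.symm y)) := contMDiffAt_of_mem_maximalAtlas hφ h3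
  have k6 : DiffAt EG EG (fun w => a (φ.symm w) (φ.symm y)) (φ 1) :=
    DiffAt.comp' (g := fun x => a x (φ.symm y)) (f := φ.symm) (by rwa [hl]) hsm.diffAt
  rw [k3, ← md_eq_fderiv]
  refine (md_comp_apply_of_eq (g := φ) (f := fun w => a (φ.symm w) (φ.symm y)) (by rw [hl])
    k5.diffAt k6 v).trans ?_
  rw [md_comp_apply_of_eq (g := fun x => a x (φ.symm y)) (f := φ.symm) hl k4 hsm.diffAt,
    md_chartAt_symm_self]

omit ha

variable (EG G) in
lemma contMDiff_mul_two : ContMDiff (𝓘(ℝ, EG).prod 𝓘(ℝ, EG)) 𝓘(ℝ, EG) ∞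
    (fun q : G × G => q.1 * q.2) := contMDiff_mul 𝓘(ℝ, EG) ∞

variable (EG G) in
lemma contMDiff_conj_two : ContMDiff (𝓘(ℝ, EG).prod 𝓘(ℝ, EG)) 𝓘(ℝ, EG) ∞
    (fun q : G × G => q.1 * q.2 * q.1⁻¹) :=
  (contMDiff_fst.mul contMDiff_snd).mul contMDiff_fst.inv

variable (EG) in
/-- The second derivative of the multiplication in the chart at the identity. -/
noncomputable def mulHess (A B : EG) : EG :=
  fderiv ℝ (fderiv ℝ (chartTwo (EG := EG) (fun g h : G => g * h)))
    (chartAt EG (1 : G) 1, chartAt EG (1 : G) 1) (A, 0) (0, B)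

variable (EG G) in
lemma contDiffAt_mulChart :
    ContDiffAt ℝ ∞ (chartTwo (EG := EG) (fun g h : G => g * h))
      (chartAt EG (1 : G) 1, chartAt EG (1 : G) 1) := by
  have hs : (1 : G) ∈ (chartAt EG (1 : G)).source := mem_chart_source EG 1
  have ht := (chartAt EG (1 : G)).map_source hs
  refine contDiffAt_chartTwo (contMDiff_mul_two EG G) ht ht ?_
  simp only [(chartAt EG (1 : G)).left_inv hs]
  simp

variable (EG G) in
lemma hasFDerivAt_fderiv_mulChart :
    HasFDerivAt (fderiv ℝ (chartTwo (EG := EG) (fun g h : G => g * h)))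
      (fderiv ℝ (fderiv ℝ (chartTwo (EG := EG) (fun g h : G => g * h)))
        (chartAt EG (1 : G) 1, chartAt EG (1 : G) 1))
      (chartAt EG (1 : G) 1, chartAt EG (1 : G) 1) :=
  (((contDiffAt_mulChart EG G).fderiv_right (m := 1) (by norm_cast)).differentiableAt
    (by simp)).hasFDerivAt

/-- In the chart, the left-invariant field of `B` is the partial derivative of the multiplication in
its second argument at 1, applied to `B`. Its derivative along `A` is the mixed second derivative,
and the bracket of fields antisymmetrizes. -/
lemma bracket_eq_mulHess (A B : GroupLieAlgebra 𝓘(ℝ, EG) G) :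
    (⁅A, B⁆ : GroupLieAlgebra 𝓘(ℝ, EG) G)
      = mulHess EG (G := G) A B - mulHess EG (G := G) B A := by
  set φ := chartAt EG (1 : G) with hφdef
  have hs : (1 : G) ∈ φ.source := mem_chart_source EG 1
  have hl : φ.symm (φ 1) = 1 := φ.left_inv hs
  have hV : ∀ B : EG, chartField φ (mulInvariantVectorField (I := 𝓘(ℝ, EG)) (G := G) B)
      =ᶠ[𝓝 (φ 1)] fun y => fderiv ℝ (chartTwo (EG := EG) (fun g h : G => g * h)) (y, φ 1) (0, B) := by
    intro B
    filter_upwards [φ.open_target.mem_nhds (φ.map_source hs)] with y hy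
    rw [fderiv_chartTwo_snd (contMDiff_mul_two EG G) hy (by simpa using φ.map_target hy), mul_one]
    rfl
  have hD : ∀ A B : EG, fderiv ℝ (chartField φ (mulInvariantVectorField (I := 𝓘(ℝ, EG)) (G := G) B))
      (φ 1) A = mulHess EG (G := G) A B := by
    intro A B
    rw [(hV B).fderiv_eq]
    have h1 := HasFDerivAt.comp (f := fun w : EG => (w, φ 1)) (φ 1)
      (hasFDerivAt_fderiv_mulChart EG G) (hasFDerivAt_prodMk_left (𝕜 := ℝ) (φ 1) (φ 1))
    have h2 := h1.clm_apply (hasFDerivAt_const ((0 : EG), B) (φ 1))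
    have h3 := congrArg (fun T : EG →L[ℝ] EG => T A) h2.fderiv
    refine h3.trans ?_
    simp [mulHess, hφdef]
  have h1 : ∀ A : EG, (mulInvariantVectorField (I := 𝓘(ℝ, EG)) (G := G) A 1 : EG) = A := by
    intro A
    have h2 := mulInvariantVectorField (I := 𝓘(ℝ, EG)) (G := G) A 1
    change md EG EG (fun x : G => 1 * x) 1 A = A
    have h3 : (fun x : G => 1 * x) = fun x => x := by funext x; simp
    rw [h3, md_id]
    rfl
  rw [GroupLieAlgebra.bracket_def]
  refine (mlieBracket_eq_chart _ _ _).trans ?_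
  rw [← hφdef]
  exact congrArg₂ (fun x y : EG => x - y)
    ((congrArg (fun v : EG => fderiv ℝ (chartField φ
      (mulInvariantVectorField (I := 𝓘(ℝ, EG)) (G := G) B)) (φ 1) v) (h1 A)).trans (hD A B))
    ((congrArg (fun v : EG => fderiv ℝ (chartField φ
      (mulInvariantVectorField (I := 𝓘(ℝ, EG)) (G := G) A)) (φ 1) v) (h1 B)).trans (hD B A))

variable (EG) in
/-- The adjoint action, as a linear map on the model space. -/
noncomputable def adm (g : G) : EG →L[ℝ] EG := md EG EG (fun x : G => g * x * g⁻¹) 1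

variable (EG G) in
/-- The Lie bracket, as an operation on the model space. -/
noncomputable def brk (A B : EG) : EG :=
  (⁅(show GroupLieAlgebra 𝓘(ℝ, EG) G from A), (show GroupLieAlgebra 𝓘(ℝ, EG) G from B)⁆ :
    GroupLieAlgebra 𝓘(ℝ, EG) G)

lemma adm_one (B : EG) : adm EG (1 : G) B = B := Ad_one EG B

/-- The derivative of the adjoint action along a curve is the Lie bracket. -/
lemma hasDerivAt_adm {c : ℝ → G} (hc : DiffAt ℝ EG c 0) (hc0 : c 0 = 1)
    (A B : EG) (hA : md ℝ EG c 0 1 = A) :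
    HasDerivAt (fun t => adm EG (c t) B) (brk EG G A B) 0 := by
  set φ := chartAt EG (1 : G) with hφdef
  have hφ : φ ∈ IsManifold.maximalAtlas 𝓘(ℝ, EG) ∞ G := IsManifold.chart_mem_maximalAtlas 1
  have hs : (1 : G) ∈ φ.source := mem_chart_source EG 1
  have ht : φ 1 ∈ φ.target := φ.map_source hs
  have hl : φ.symm (φ 1) = 1 := φ.left_inv hs
  set K := chartTwo (EG := EG) (fun g h : G => g * h * g⁻¹) with hK
  set m := chartTwo (EG := EG) (fun g h : G => g * h) with hm
  have hcs : ∀ᶠ t in 𝓝 (0 : ℝ), c t ∈ φ.source :=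
    hc.continuousAt.eventually_mem (φ.open_source.mem_nhds (by rw [hc0]; exact hs))
  let y : ℝ → EG := fun t => φ (c t)
  have hy0 : y 0 = φ 1 := by simp only [y, hc0]
  have hφd : DiffAt EG EG φ (1 : G) := SmoothAt.diffAt (contMDiffAt_of_mem_maximalAtlas hφ hs)
  have hy : HasDerivAt y A 0 := by
    have h1 : DiffAt ℝ EG y 0 := DiffAt.comp' (g := φ) (by rwa [hc0]) hc
    have h2 := (diffAt_iff_differentiableAt.1 h1).hasFDerivAt.hasDerivAt
    rw [← md_eq_fderiv, md_comp_apply_of_eq (g := φ) hc0 hφd hc, hA, md_chartAt_self] at h2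
    exact h2
  have hAd : ∀ᶠ t in 𝓝 (0 : ℝ), adm EG (c t) B = fderiv ℝ K (y t, φ 1) (0, B) := by
    filter_upwards [hcs] with t ht
    have h1 := fderiv_chartTwo_snd (a := fun g h : G => g * h * g⁻¹) (contMDiff_conj_two EG G) (φ.map_source ht)
      (by simp) B
    refine Eq.trans ?_ h1.symm
    simp only [← hφdef, φ.left_inv ht, mul_one, mul_inv_cancel]
    rw [md_chartAt_self]
    rfl
  have hKd : DifferentiableAt ℝ (fderiv ℝ K) (y 0, φ 1) := by
    rw [hy0]
    have h1 : ContDiffAt ℝ ∞ K (φ 1, φ 1) :=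
      contDiffAt_chartTwo (contMDiff_conj_two EG G) ht ht
        (by simp only [← hφdef, hl]; simpa using hs)
    exact (h1.fderiv_right (m := 1) (by norm_cast)).differentiableAt (by simp)
  -- Conjugation in the chart shows only that the derivative exists; its value comes from comparing
  -- two expressions for the differential of left translation.
  have hadiff : DifferentiableAt ℝ (fun t => adm EG (c t) B) 0 := by
    refine DifferentiableAt.congr_of_eventuallyEq ?_ hAd
    exact (DifferentiableAt.comp (0 : ℝ) (f := fun t => (y t, φ 1)) hKd
      (hy.differentiableAt.prodMk (differentiableAt_const _))).clm_apply
        (differentiableAt_const _)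
  have hder := hadiff.hasDerivAt
  set a' := deriv (fun t => adm EG (c t) B) 0 with ha'
  have hF := hasFDerivAt_fderiv_mulChart EG G
  -- This is `c x = (c x c⁻¹) c` differentiated at `x = 1`. Differentiating again at `t = 0` gives
  -- `mulHess A B = mulHess B A + a'`.
  have hrel : (fun t => fderiv ℝ m (y t, φ 1) (0, B)) =ᶠ[𝓝 (0 : ℝ)]
      fun t => fderiv ℝ m (φ 1, y t) (adm EG (c t) B, 0) := by
    filter_upwards [hcs] with t htt
    have h1 := fderiv_chartTwo_snd (contMDiff_mul_two EG G) (φ.map_source htt)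
      (by simp only [← hφdef, φ.left_inv htt, mul_one]; exact htt) B
    have h2 := fderiv_chartTwo_fst (contMDiff_mul_two EG G) (φ.map_source htt)
      (by simp only [← hφdef, φ.left_inv htt, one_mul]; exact htt) (adm EG (c t) B)
    refine h1.trans (Eq.trans ?_ h2.symm)
    simp only [← hφdef, φ.left_inv htt, mul_one, one_mul]
    congr 1
    have h1 : (fun x : G => c t * x) = fun x => (c t * x * (c t)⁻¹) * c t := by
      funext x; group
    rw [h1]
    exact md_comp_apply_of_eq (g := fun x => x * c t) (f := fun x : G => c t * x * (c t)⁻¹)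
      (by simp) (diffAt_fst_two (contMDiff_mul_two EG G) _ _) (mdifferentiableAt_conj EG (c t) 1) B
  have hF' : HasFDerivAt (fderiv ℝ m) (fderiv ℝ (fderiv ℝ m) (φ 1, φ 1)) (y 0, φ 1) := by
    rw [hy0]; exact hF
  have hF'' : HasFDerivAt (fderiv ℝ m) (fderiv ℝ (fderiv ℝ m) (φ 1, φ 1)) (φ 1, y 0) := by
    rw [hy0]; exact hF
  have hL : HasDerivAt (fun t => fderiv ℝ m (y t, φ 1) (0, B)) (mulHess EG (G := G) A B) 0 := by
    have h1 := (hF'.comp_hasDerivAt (0 : ℝ) (f := fun t => (y t, φ 1))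
      (hy.prodMk (hasDerivAt_const (0 : ℝ) (φ 1)))).clm_apply
        (hasDerivAt_const (0 : ℝ) ((0 : EG), (B : EG)))
    simpa [mulHess] using h1
  have hR : HasDerivAt (fun t => fderiv ℝ m (φ 1, y t) (adm EG (c t) B, 0))
      (mulHess EG (G := G) B A + a') 0 := by
    have h1 := (hF''.comp_hasDerivAt (0 : ℝ) (f := fun t => (φ 1, y t))
      ((hasDerivAt_const (0 : ℝ) (φ 1)).prodMk hy)).clm_apply
        (hder.prodMk (hasDerivAt_const (0 : ℝ) (0 : EG)))
    -- Here the first slot is fixed and the second one moves, so symmetry of the second derivative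
    -- is needed to recognize `mulHess B A`.
    have hsymm := (contDiffAt_mulChart EG G).isSymmSndFDerivAt (by
      rw [minSmoothness_of_isRCLikeNormedField]; norm_cast)
    have h2 : adm EG (c 0) B = B := by rw [hc0]; exact adm_one B
    have h3 : fderiv ℝ m (φ 1, φ 1) (a', 0) = a' := by
      refine (fderiv_chartTwo_fst (contMDiff_mul_two EG G) ht
        (by simp only [← hφdef, hl, one_mul]; exact hs) a').trans ?_
      simp only [← hφdef, hl, mul_one]
      rw [md_id, md_chartAt_self]
      rfl
    refine h1.congr_deriv ?_
    simp only [Function.comp_apply, hy0, h2]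
    rw [h3, mulHess]
    congr 1
    exact hsymm _ _
  have key := (hL.congr_of_eventuallyEq hrel.symm).unique hR
  have hfin : a' = brk EG G A B := by
    rw [brk, bracket_eq_mulHess]
    exact eq_sub_of_add_eq' key.symm
  rw [← hfin]
  exact hder

end Adjoint

/-! ### Curves with given velocity, and curves confined to a linear subspace -/

section Curves

open Filter Topology Set

variable {E : Type*} [NormedAddCommGroup E] [NormedSpace ℝ E]
  {X : Type*} [TopologicalSpace X] [ChartedSpace E X] [IsManifold 𝓘(ℝ, E) ∞ X]

lemma exists_curve (x : X) (v : E) :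
    ∃ c : ℝ → X, SmoothAt ℝ E c 0 ∧ c 0 = x ∧ md ℝ E c 0 1 = v := by
  set φ := chartAt E x with hφdef
  have hφ : φ ∈ IsManifold.maximalAtlas 𝓘(ℝ, E) ∞ X := IsManifold.chart_mem_maximalAtlas x
  have hx : x ∈ φ.source := mem_chart_source E x
  have h2 : SmoothAt E E φ.symm (φ x) :=
    contMDiffAt_symm_of_mem_maximalAtlas hφ (φ.map_source hx)
  have h3 : SmoothAt ℝ E (fun t : ℝ => φ x + t • v) 0 :=
    (contDiff_const.add (contDiff_id.smul contDiff_const)).contMDiff 0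
  have h4 : φ x + (0 : ℝ) • v = φ x := by simp
  have h5 : HasDerivAt (fun t : ℝ => φ x + t • v) v 0 := by
    simpa using ((hasDerivAt_id (0 : ℝ)).smul_const v).const_add (φ x)
  refine ⟨fun t => φ.symm (φ x + t • v), h2.comp_of_eq' h3 h4, ?_, ?_⟩
  · simp only [h4, φ.left_inv hx]
  · rw [md_comp_apply_of_eq (g := φ.symm) (f := fun t : ℝ => φ x + t • v) h4 h2.diffAt h3.diffAt, md_eq_fderiv (fun t : ℝ => _),
      h5.hasFDerivAt.fderiv, md_chartAt_symm_self]
    simp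

variable [FiniteDimensional ℝ E]

lemma mem_of_hasDerivAt (S : Submodule ℝ E) {f : ℝ → E} {f' : E} (hf : HasDerivAt f f' 0)
    (h : ∀ᶠ t in 𝓝 0, f t - f 0 ∈ S) : f' ∈ S := by
  have hcl : IsClosed (S : Set E) := S.closed_of_finiteDimensional
  refine hcl.mem_of_tendsto (hasDerivAt_iff_tendsto_slope.1 hf) ?_
  filter_upwards [nhdsWithin_le_nhds h] with t ht
  rw [slope_def_module]
  exact S.smul_mem _ ht

/-- A linear functional vanishing on `S` is constant along `f`, and such functionals separate points
from `S`. -/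
lemma sub_mem_of_hasDerivAt (S : Submodule ℝ E) {f f' : ℝ → E} (hf : ∀ t, HasDerivAt f (f' t) t)
    (h : ∀ t, f' t ∈ S) (t s : ℝ) : f t - f s ∈ S := by
  by_contra hn
  obtain ⟨l, hl, hS⟩ := Submodule.exists_le_ker_of_notMem hn
  have h1 : ∀ t, HasDerivAt (fun t => l (f t)) 0 t := fun t => by
    have h2 := l.toContinuousLinearMap.hasFDerivAt.comp_hasDerivAt t (hf t)
    have h3 : l.toContinuousLinearMap (f' t) = 0 := hS (h t)
    rw [h3] at h2
    exact h2
  have h4 := is_const_of_deriv_eq_zero (fun t => (h1 t).differentiableAt) (fun t => (h1 t).deriv) t s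
  exact hl (by rw [map_sub, sub_eq_zero]; exact h4)

end Curves

/-! ### The adjoint action, the filtration of the Lie algebra, and the groups `G_0` and `P_+` -/

section Adjoint

open Filter Topology Set

variable {EG : Type*} [NormedAddCommGroup EG] [NormedSpace ℝ EG] [FiniteDimensional ℝ EG]
  {G : Type*} [TopologicalSpace G] [ChartedSpace EG G] [Group G] [LieGroup 𝓘(ℝ, EG) ∞ G]

instance instFiniteDimensionalGroupLieAlgebra :
    FiniteDimensional ℝ (GroupLieAlgebra 𝓘(ℝ, EG) G) :=
  inferInstanceAs (FiniteDimensional ℝ EG)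

lemma adm_mul (g h : G) (A : EG) : adm EG (g * h) A = adm EG g (adm EG h A) := Ad_mul EG g h A

/-- Differentiate `Ad g (Ad (c t) B) = Ad (g c(t) g⁻¹) (Ad g B)` at `t = 0` along a curve `c` with
velocity `A`. -/
lemma adm_brk (g : G) (A B : EG) :
    adm EG g (brk EG G A B) = brk EG G (adm EG g A) (adm EG g B) := by
  obtain ⟨c, hc, hc0, hcA⟩ := exists_curve (1 : G) A
  have h1 := hasDerivAt_adm hc.diffAt hc0 A B hcA
  have h2 := (adm EG g).hasFDerivAt.comp_hasDerivAt 0 h1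
  have hg : DiffAt EG EG (fun x : G => g * x * g⁻¹) 1 := mdifferentiableAt_conj EG g 1
  have h3 : DiffAt ℝ EG (fun t => g * c t * g⁻¹) 0 :=
    DiffAt.comp' (g := fun x : G => g * x * g⁻¹) (by rwa [hc0]) hc.diffAt
  have h4 := hasDerivAt_adm h3 (by simp [hc0]) (adm EG g A) (adm EG g B) (by
    rw [md_comp_apply_of_eq (g := fun x : G => g * x * g⁻¹) hc0 hg hc.diffAt, hcA]
    rfl)
  refine HasDerivAt.unique h2 (HasDerivAt.congr_of_eventuallyEq (F := EG) h4
    (Eventually.of_forall fun t => ?_))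
  simp only [Function.comp_apply, ← adm_mul]
  congr 2
  group

lemma Ad_lie (g : G) (A B : GroupLieAlgebra 𝓘(ℝ, EG) G) :
    Ad EG g ⁅A, B⁆ = ⁅Ad EG g A, Ad EG g B⁆ := adm_brk (EG := EG) g A B

lemma Ad_inv_Ad (g : G) (A : GroupLieAlgebra 𝓘(ℝ, EG) G) : Ad EG g⁻¹ (Ad EG g A) = A := by
  rw [← Ad_mul, inv_mul_cancel, Ad_one]

lemma Ad_Ad_inv (g : G) (A : GroupLieAlgebra 𝓘(ℝ, EG) G) : Ad EG g (Ad EG g⁻¹ A) = A := by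
  rw [← Ad_mul, mul_inv_cancel, Ad_one]

variable (EG) in
/-- The adjoint action is by Lie algebra automorphisms. -/
noncomputable def AdEquiv (g : G) :
    GroupLieAlgebra 𝓘(ℝ, EG) G ≃ₗ⁅ℝ⁆ GroupLieAlgebra 𝓘(ℝ, EG) G where
  toFun := Ad EG g
  map_add' := (Ad EG g).map_add
  map_smul' := (Ad EG g).map_smul
  map_lie' := fun {A B} => Ad_lie g A B
  invFun := Ad EG g⁻¹
  left_inv := Ad_inv_Ad g
  right_inv := Ad_Ad_inv g

lemma killingForm_Ad (g : G) (A B : GroupLieAlgebra 𝓘(ℝ, EG) G) :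
    killingForm ℝ _ (Ad EG g A) (Ad EG g B) = killingForm ℝ _ A B :=
  LieAlgebra.killingForm_of_equiv_apply (AdEquiv EG g) A B

variable {k : ℕ} (gr : Grading (GroupLieAlgebra 𝓘(ℝ, EG) G) k) {P : Subgroup G}

/-- The one-parameter group law carries the derivative at 0 to every time. -/
lemma hasDerivAt_adm_exp {A : EG} {c : ℝ → G} (hc : IsExpCurve EG A c) (B : EG) (t : ℝ) :
    HasDerivAt (fun t => adm EG (c t) B) (adm EG (c t) (brk EG G A B)) t := by
  have h0 : c 0 = 1 := by
    have := hc.map_add 0 0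
    simpa using this
  have h1 := hasDerivAt_adm (SmoothAt.diffAt (hc.smooth 0)) h0 A B hc.velocity
  have h2 := (adm EG (c t)).hasFDerivAt.comp_hasDerivAt 0 h1
  have h3 : HasDerivAt (fun s => adm EG (c (t + s)) B) (adm EG (c t) (brk EG G A B)) 0 := by
    refine h2.congr_of_eventuallyEq (Eventually.of_forall fun s => ?_)
    simp only [Function.comp_apply, hc.map_add, adm_mul]
  have h4 := HasDerivAt.comp_add_const (f := fun s => adm EG (c (t + s)) B) t (-t)
    (by rw [add_neg_cancel]; exact h3)
  refine h4.congr_of_eventuallyEq (Eventually.of_forall fun s => ?_)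
  simp

/-- Elements of `P_+` act trivially on the graded object associated to the filtration of `𝔤`. -/
lemma Ad_sub_mem_filt {p : P} (hp : p ∈ unip gr P) :
    ∀ (i : ℤ), ∀ B ∈ gr.filt i, Ad EG (p : G) B - B ∈ gr.filt (i + 1) := by
  induction hp using Subgroup.closure_induction with
  | mem p h =>
    obtain ⟨A, hA, c, hc, hcp⟩ := h
    have h0 : c 0 = 1 := by
      have := hc.map_add 0 0
      simpa using this
    -- Descending induction on the filtration degree, which starts above `k`, where the filtration
    -- is zero. The derivative of `Ad (c t) B` is `Ad (c t) ⁅A, B⁆`; as `⁅A, B⁆` lies one step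
    -- deeper, the induction hypothesis keeps this derivative in `filt (i + 1)`.
    have key : ∀ (n : ℕ) (i : ℤ), (k : ℤ) < i + n → ∀ B ∈ gr.filt i, ∀ t,
        Ad EG (c t) B - B ∈ gr.filt (i + 1) := by
      intro n
      induction n with
      | zero =>
        intro i hi B hB t
        rw [gr.filt_eq_bot (by simpa using hi), Submodule.mem_bot] at hB
        rw [hB, map_zero, sub_zero]
        exact zero_mem _
      | succ n ih =>
        intro i hi B hB t
        have h1 : ⁅A, B⁆ ∈ gr.filt (i + 1) := by
          rw [add_comm]
          exact gr.lie_mem_filt hA hB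
        have h2 : ∀ t, Ad EG (c t) ⁅A, B⁆ ∈ gr.filt (i + 1) := fun t => by
          have h3 := gr.filt_anti (show i + 1 ≤ i + 1 + 1 by lia)
            (ih (i + 1) (by push_cast at hi ⊢; lia) _ h1 t)
          have h4 := add_mem h3 h1
          rwa [sub_add_cancel] at h4
        have h5 := sub_mem_of_hasDerivAt (E := EG) (gr.filt (i + 1))
          (fun t => hasDerivAt_adm_exp hc B t) h2 t 0
        rw [h0] at h5
        change Ad EG (c t) B - Ad EG 1 B ∈ gr.filt (i + 1) at h5
        rwa [Ad_one] at h5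
    intro i B hB
    rw [← hcp]
    exact key (k + 1 - i).toNat i (by lia) B hB 1
  | one =>
    intro i B _
    rw [Subgroup.coe_one, Ad_one, sub_self]
    exact zero_mem _
  | mul p q _ _ hp hq =>
    intro i B hB
    have h1 := hq i B hB
    have h2 : Ad EG (q : G) B ∈ gr.filt i := by
      have := add_mem (gr.filt_anti (show i ≤ i + 1 by lia) h1) hB
      rwa [sub_add_cancel] at this
    have h3 := add_mem (hp i _ h2) h1
    rw [sub_add_sub_cancel, ← Ad_mul] at h3
    exact h3
  | inv p _ hp =>
    intro i B hB
    -- `Ad p` maps the filtration space into itself, hence onto itself by dimension. So `B = Ad p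
    -- C`, and the claim for the inverse is the negative of the claim for `p` at `C`.
    have h1 : (gr.filt i).map (Ad EG (p : G)) ≤ gr.filt i := by
      rintro _ ⟨C, hC, rfl⟩
      have := add_mem (gr.filt_anti (show i ≤ i + 1 by lia) (hp i C hC)) hC
      rwa [sub_add_cancel] at this
    have h2 : (gr.filt i).map (Ad EG (p : G)) = gr.filt i :=
      Submodule.eq_of_le_of_finrank_eq h1
        (LinearEquiv.finrank_map_eq (AdEquiv EG (p : G)).toLinearEquiv (gr.filt i))
    rw [← h2] at hB
    obtain ⟨C, hC, rfl⟩ := hB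
    rw [Subgroup.coe_inv, Ad_inv_Ad, ← neg_sub]
    exact neg_mem (hp i C hC)

/-- Curves in `P_+` are tangent to `𝔭_+`. -/
lemma velocity_mem_pos [LieAlgebra.IsKilling ℝ (GroupLieAlgebra 𝓘(ℝ, EG) G)] {c : ℝ → P}
    (hc : DiffAt ℝ EG (fun t => (c t : G)) 0) (hc0 : c 0 = 1)
    (hmem : ∀ᶠ t in 𝓝 0, c t ∈ unip gr P) {A : GroupLieAlgebra 𝓘(ℝ, EG) G}
    (hA : md ℝ EG (fun t => (c t : G)) 0 1 = A) : A ∈ gr.pos := by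
  -- No manifold structure on `P_+` enters: differentiating `Ad (c t) y - y ∈ filt (j + 1)` shows
  -- that `ad A` raises the filtration.
  refine gr.mem_pos_of_lie fun j y hy => ?_
  have h0 : ((c 0 : P) : G) = 1 := by rw [hc0]; rfl
  refine mem_of_hasDerivAt (E := EG) (gr.filt (j + 1)) (hasDerivAt_adm hc h0 A y hA) ?_
  filter_upwards [hmem] with t ht
  rw [h0]
  change Ad EG (c t : G) y - Ad EG 1 y ∈ gr.filt (j + 1)
  rw [Ad_one]
  exact Ad_sub_mem_filt gr ht j y (gr.comp_le_filt le_rfl hy)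

variable {gr}
variable [LieAlgebra.IsKilling ℝ (GroupLieAlgebra 𝓘(ℝ, EG) G)]
  {Z : GroupLieAlgebra 𝓘(ℝ, EG) G}

/-- Since `Ad g` preserves each `𝔤_i`, the elements `Ad g Z` and `Z` act on `𝔤_i` by the same
scalar; their difference is central, hence zero. -/
lemma Ad_scaling (hZ : gr.IsScaling Z) {g : P} (hg : g ∈ levi gr P) : Ad EG (g : G) Z = Z := by
  obtain ⟨c, -, hc⟩ := hZ.exists_scalar
  rw [← sub_eq_zero]
  refine Grading.eq_zero_of_central fun y => ?_
  rw [← Ad_Ad_inv (g : G) y]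
  induction Ad EG (g : G)⁻¹ y using gr.induction_comp with
  | hz => simp
  | ha x y hx hy => rw [map_add, lie_add, hx, hy, add_zero]
  | hc i x hx =>
    have h1 : Ad EG (g : G) x ∈ gr.comp i := by
      rw [← hg i]
      exact Submodule.mem_map_of_mem hx
    rw [sub_lie, ← Ad_lie, hc i x hx, hc i _ h1, map_smul, sub_self]

/-- An automorphism fixing `Z` commutes with `ad Z` and so preserves its eigenspaces, which are the
`𝔤_i`. -/
lemma mem_levi_of_Ad_scaling (hZ : gr.IsScaling Z) {p : P} (hp : Ad EG (p : G) Z = Z) :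
    p ∈ levi gr P := by
  obtain ⟨c, hc0, hc⟩ := hZ.exists_scalar
  have key : ∀ q : G, Ad EG q Z = Z → ∀ i, ∀ x ∈ gr.comp i, Ad EG q x ∈ gr.comp i := by
    intro q hq i x hx
    refine Grading.IsScaling.mem_comp_of_lie hc0 hc ?_
    rw [← map_smul, ← hc i x hx, Ad_lie, hq]
  intro i
  refine le_antisymm ?_ fun x hx => ?_
  · rintro _ ⟨x, hx, rfl⟩
    exact key _ hp i x hx
  · refine ⟨Ad EG (p : G)⁻¹ x, key _ ?_ i x hx, Ad_Ad_inv _ _⟩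
    conv_lhs => rw [← hp]
    exact Ad_inv_Ad _ _

end Adjoint

/-! ### One-forms in charts -/

section Flat

variable {E : Type*} [NormedAddCommGroup E] [NormedSpace ℝ E]
  {E' : Type*} [NormedAddCommGroup E'] [NormedSpace ℝ E']
  {ψ : E → E'} {θ : E' → E' →L[ℝ] ℝ} {x : E}

lemma fderiv_pullback_flat (hψ : ContDiffAt ℝ ∞ ψ x) (hθ : DifferentiableAt ℝ θ (ψ x)) (v w : E) :
    fderiv ℝ (fun y => (θ (ψ y)).comp (fderiv ℝ ψ y)) x v w
      = fderiv ℝ θ (ψ x) (fderiv ℝ ψ x v) (fderiv ℝ ψ x w)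
        + θ (ψ x) (fderiv ℝ (fderiv ℝ ψ) x v w) := by
  have h1 : DifferentiableAt ℝ ψ x := hψ.differentiableAt (by simp)
  have h2 : DifferentiableAt ℝ (fderiv ℝ ψ) x :=
    (hψ.fderiv_right (m := 1) (by norm_cast)).differentiableAt (by simp)
  have h3 := HasFDerivAt.clm_comp (hθ.hasFDerivAt.comp x h1.hasFDerivAt) h2.hasFDerivAt
  have h4 := congrArg (fun T => T v w) h3.fderiv
  refine h4.trans ?_
  simp [add_comm]

lemma fderiv_defect_flat (hψ : ContDiffAt ℝ ∞ ψ x) {V : E' → E'} {W : E → E}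
    (hV : DifferentiableAt ℝ V (ψ x)) (hW : DifferentiableAt ℝ W x) :
    HasFDerivAt (fun y => V (ψ y) - fderiv ℝ ψ y (W y))
      ((fderiv ℝ V (ψ x)).comp (fderiv ℝ ψ x) - ((fderiv ℝ ψ x).comp (fderiv ℝ W x) +
        (fderiv ℝ (fderiv ℝ ψ) x).flip (W x))) x := by
  have h1 : DifferentiableAt ℝ ψ x := hψ.differentiableAt (by simp)
  have h2 : DifferentiableAt ℝ (fderiv ℝ ψ) x :=
    (hψ.fderiv_right (m := 1) (by norm_cast)).differentiableAt (by simp)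
  exact (hV.hasFDerivAt.comp x h1.hasFDerivAt).sub (h2.hasFDerivAt.clm_apply hW.hasFDerivAt)

lemma isSymm_flat (hψ : ContDiffAt ℝ ∞ ψ x) : IsSymmSndFDerivAt ℝ ψ x :=
  hψ.isSymmSndFDerivAt (by rw [minSmoothness_of_isRCLikeNormedField]; norm_cast)

lemma fderiv_eval_flat {D : E → E'} (hψ : DifferentiableAt ℝ ψ x)
    (hθ : DifferentiableAt ℝ θ (ψ x)) (hD : DifferentiableAt ℝ D x) :
    HasFDerivAt (fun y => θ (ψ y) (D y)) ((θ (ψ x)).comp (fderiv ℝ D x) +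
      ((fderiv ℝ θ (ψ x)).comp (fderiv ℝ ψ x)).flip (D x)) x :=
  (hθ.hasFDerivAt.comp x hψ.hasFDerivAt).clm_apply hD.hasFDerivAt

/-- The Lie derivative of a pullback along a map which does not relate the vector fields. -/
lemma lie_pullback_flat (hψ : ContDiffAt ℝ ∞ ψ x) (hθ : DifferentiableAt ℝ θ (ψ x))
    {V : E' → E'} {W : E → E} (hV : DifferentiableAt ℝ V (ψ x)) (hW : DifferentiableAt ℝ W x)
    {D : E → E'} (hD : ∀ y, D y = V (ψ y) - fderiv ℝ ψ y (W y)) (v : E) :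
    fderiv ℝ (fun y => (θ (ψ y)).comp (fderiv ℝ ψ y)) x (W x) v
        + θ (ψ x) (fderiv ℝ ψ x (fderiv ℝ W x v))
      = (fderiv ℝ θ (ψ x) (V (ψ x)) (fderiv ℝ ψ x v)
          + θ (ψ x) (fderiv ℝ V (ψ x) (fderiv ℝ ψ x v)))
        - (fderiv ℝ θ (ψ x) (D x) (fderiv ℝ ψ x v) - fderiv ℝ θ (ψ x) (fderiv ℝ ψ x v) (D x))
        - fderiv ℝ (fun y => θ (ψ y) (D y)) x v := by
  obtain rfl : D = fun y => V (ψ y) - fderiv ℝ ψ y (W y) := funext hD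
  have h1 := fderiv_defect_flat hψ hV hW
  -- In coordinates this is `L_W ψ^*θ = ψ^*(L_V θ) - dθ(D, ψ' ·) - d(θ(D))`. The second derivative
  -- of `ψ` appears twice with its arguments exchanged, and cancels by symmetry.
  rw [fderiv_pullback_flat hψ hθ,
    (fderiv_eval_flat (hψ.differentiableAt (by simp)) hθ h1.differentiableAt).fderiv, h1.fderiv,
    isSymm_flat hψ (W x) v]
  simp only [add_apply, ContinuousLinearMap.comp_apply,
    sub_apply, ContinuousLinearMap.flip_apply, map_add, map_sub]
  ring

end Flat

/-! ### Lie and exterior derivatives of one-forms, and their behaviour under pullback -/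

section Charts

open Filter Topology Set

variable {E : Type*} [NormedAddCommGroup E] [NormedSpace ℝ E] [FiniteDimensional ℝ E]
  {E' : Type*} [NormedAddCommGroup E'] [NormedSpace ℝ E'] [FiniteDimensional ℝ E']
  {X : Type*} [TopologicalSpace X] [ChartedSpace E X] [IsManifold 𝓘(ℝ, E) ∞ X]
  {Y : Type*} [TopologicalSpace Y] [ChartedSpace E' Y] [IsManifold 𝓘(ℝ, E') ∞ Y]

/-- The representation of a scalar one-form in a chart. -/
noncomputable def formChart (φ : OpenPartialHomeomorph X E) (θ : X → E →ₗ[ℝ] ℝ) (y : E) :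
    E →L[ℝ] ℝ :=
  (θ (φ.symm y)).toContinuousLinearMap.comp (md E E φ.symm y)

lemma formChart_apply (φ : OpenPartialHomeomorph X E) (θ : X → E →ₗ[ℝ] ℝ) (y v : E) :
    formChart φ θ y v = θ (φ.symm y) (md E E φ.symm y v) := rfl

/-- Smooth scalar one-forms. -/
def SmoothScalar (θ : X → E →ₗ[ℝ] ℝ) : Prop := ContMDiff 𝓘(ℝ, E).tangent 𝓘(ℝ, ℝ) ∞
    (fun v : TangentBundle 𝓘(ℝ, E) X => θ v.proj v.snd)

lemma SmoothScalar.eval {θ : Y → E' →ₗ[ℝ] ℝ} (hθ : SmoothScalar θ) {f : X → Y} {v : X → E'}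
    {x : X} (h : SmoothAlong E E' f v x) : SmoothAt E ℝ (fun y => θ (f y) (v y)) x :=
  ContMDiffAt.comp (I' := 𝓘(ℝ, E').tangent) x
    (g := fun v : TangentBundle 𝓘(ℝ, E') Y => θ v.proj v.snd) (hθ _) h

lemma contDiffAt_formChart {φ : OpenPartialHomeomorph X E}
    (hφ : φ ∈ IsManifold.maximalAtlas 𝓘(ℝ, E) ∞ X) {θ : X → E →ₗ[ℝ] ℝ} (hθ : SmoothScalar θ)
    {y : E} (hy : y ∈ φ.target) : ContDiffAt ℝ ∞ (formChart φ θ) y := by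
  have h : ContDiffOn ℝ ∞ (formChart φ θ) φ.target := by
    refine contDiffOn_clm_apply.2 fun v z hz => ContDiffAt.contDiffWithinAt ?_
    have h1 : SmoothAlong E E (fun y : E => y) (fun _ => v) z := smoothAlong_id contMDiffAt_const
    have h2 := h1.md (g := φ.symm) (contMDiffAt_symm_of_mem_maximalAtlas hφ hz)
    exact contMDiffAt_iff_contDiffAt.1 (hθ.eval h2)
  exact h.contDiffAt (φ.open_target.mem_nhds hy)

/-- The Lie derivative of a one-form. -/
noncomputable def lieForm (V : X → E) (θ : X → E →ₗ[ℝ] ℝ) (x : X) (v : E) : ℝ :=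
  fderiv ℝ (formChart (chartAt E x) θ) (chartAt E x x) (V x) v
    + θ x (fderiv ℝ (chartField (chartAt E x) V) (chartAt E x x) v)

/-- The exterior derivative of a one-form. -/
noncomputable def dForm (θ : X → E →ₗ[ℝ] ℝ) (x : X) (v w : E) : ℝ :=
  fderiv ℝ (formChart (chartAt E x) θ) (chartAt E x x) v w
    - fderiv ℝ (formChart (chartAt E x) θ) (chartAt E x x) w v

lemma formChart_chartAt (θ : X → E →ₗ[ℝ] ℝ) (x : X) (v : E) :
    formChart (chartAt E x) θ (chartAt E x x) v = θ x v := by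
  rw [formChart_apply, md_chartAt_symm_self, (chartAt E x).left_inv (mem_chart_source E x)]

lemma chartField_chartAt (V : X → E) (x : X) : chartField (chartAt E x) V (chartAt E x x) = V x := by
  rw [chartField, (chartAt E x).left_inv (mem_chart_source E x), md_chartAt_self]

/-- The derivative of a function on a manifold, in a chart. -/
lemma md_eq_fderiv_chart {f : X → E'} {x : X} (hf : DiffAt E E' f x) (v : E) :
    md E E' f x v = fderiv ℝ (fun y => f ((chartAt E x).symm y)) (chartAt E x x) v := by
  have hφ : chartAt E x ∈ IsManifold.maximalAtlas 𝓘(ℝ, E) ∞ X := IsManifold.chart_mem_maximalAtlas x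
  have hx := mem_chart_source E x
  rw [← md_eq_fderiv, md_comp_apply_of_eq (g := f) (f := (chartAt E x).symm)
    ((chartAt E x).left_inv hx) hf
    (SmoothAt.diffAt (contMDiffAt_symm_of_mem_maximalAtlas hφ ((chartAt E x).map_source hx))),
    md_chartAt_symm_self]

/-- The formula defining `LieDerivFormZero`, in charts. -/
lemma lieForm_eq {V W : X → E} {θ : X → E →ₗ[ℝ] ℝ} (hθ : SmoothScalar θ) {x : X}
    (hW : SmoothAlong E E (fun y => y) W x) :
    md E ℝ (fun y => θ y (W y)) x (V x)
      - θ x (VectorField.mlieBracket 𝓘(ℝ, E) V W x : E) = lieForm V θ x (W x) := by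
  set φ := chartAt E x with hφdef
  have hφ : φ ∈ IsManifold.maximalAtlas 𝓘(ℝ, E) ∞ X := IsManifold.chart_mem_maximalAtlas x
  have hx : x ∈ φ.source := mem_chart_source E x
  have ht : φ x ∈ φ.target := φ.map_source hx
  have h1 : (fun y => θ (φ.symm y) (W (φ.symm y))) =ᶠ[𝓝 (φ x)]
      fun y => formChart φ θ y (chartField φ W y) := by
    filter_upwards [φ.open_target.mem_nhds ht] with y hy
    rw [formChart_apply, md_symm_chartField hφ hy]
  have h2 := (contDiffAt_formChart hφ hθ ht).differentiableAt (by simp)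
  have h3 := (contDiffAt_chartField hφ ht (V := W) (by rwa [φ.left_inv hx])).differentiableAt
    (by simp)
  rw [md_eq_fderiv_chart (hθ.eval hW).diffAt, ← hφdef, h1.fderiv_eq,
    (h2.hasFDerivAt.clm_apply h3.hasFDerivAt).fderiv]
  have h4 := mlieBracket_eq_chart V W x
  rw [h4, lieForm, ← hφdef]
  simp only [add_apply, ContinuousLinearMap.comp_apply,
    ContinuousLinearMap.flip_apply, map_sub]
  rw [hφdef, formChart_chartAt, chartField_chartAt]
  ring

/-- The representation of a map in the target chart. -/
lemma formChart_pullback {f : E → Y} {x : E} (hf : SmoothAt E E' f x) (θ : Y → E' →ₗ[ℝ] ℝ) :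
    ContDiffAt ℝ ∞ (fun q => chartAt E' (f x) (f q)) x ∧
    ∀ᶠ q in 𝓝 x, ∀ v, md E' E' (chartAt E' (f x)) (f q) (md E E' f q v)
        = fderiv ℝ (fun q => chartAt E' (f x) (f q)) q v ∧
      θ (f q) (md E E' f q v) = formChart (chartAt E' (f x)) θ (chartAt E' (f x) (f q))
        (fderiv ℝ (fun q => chartAt E' (f x) (f q)) q v) := by
  set φ := chartAt E' (f x) with hφdef
  have hφ : φ ∈ IsManifold.maximalAtlas 𝓘(ℝ, E') ∞ Y := IsManifold.chart_mem_maximalAtlas _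
  have hx : f x ∈ φ.source := mem_chart_source E' _
  have hs : ∀ y ∈ φ.source, SmoothAt E' E' φ y := fun y hy => contMDiffAt_of_mem_maximalAtlas hφ hy
  refine ⟨contMDiffAt_iff_contDiffAt.1 ((hs _ hx).comp' hf), ?_⟩
  filter_upwards [hf.eventually_diffAt, hf.continuousAt.eventually_mem (φ.open_source.mem_nhds hx)]
    with q hq hqs v
  have h1 : md E' E' φ (f q) (md E E' f q v) = fderiv ℝ (fun q => φ (f q)) q v := by
    rw [← md_comp_apply (hs _ hqs).diffAt hq, md_eq_fderiv]
  refine ⟨h1, ?_⟩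
  rw [← h1, formChart_apply, md_chart_symm_md_chart hφ hqs, φ.left_inv hqs]

/-- The exterior derivative commutes with the pullback along maps defined on a vector space. -/
lemma dForm_pullback {f : E → Y} {x : E} (hf : SmoothAt E E' f x) {θ : Y → E' →ₗ[ℝ] ℝ}
    (hθ : SmoothScalar θ) :
    (∀ v, DifferentiableAt ℝ (fun q => θ (f q) (md E E' f q v)) x) ∧
    ∀ v w, dForm θ (f x) (md E E' f x v) (md E E' f x w) =
      fderiv ℝ (fun q => θ (f q) (md E E' f q w)) x v
        - fderiv ℝ (fun q => θ (f q) (md E E' f q v)) x w := by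
  obtain ⟨hψ, h⟩ := formChart_pullback hf θ
  set φ := chartAt E' (f x) with hφdef
  have hφ : φ ∈ IsManifold.maximalAtlas 𝓘(ℝ, E') ∞ Y := IsManifold.chart_mem_maximalAtlas _
  have hx : f x ∈ φ.source := mem_chart_source E' _
  have hθ' : DifferentiableAt ℝ (formChart φ θ) (φ (f x)) :=
    (contDiffAt_formChart hφ hθ (φ.map_source hx)).differentiableAt (by simp)
  set ψ := fun q => φ (f q) with hψdef
  have hd : DifferentiableAt ℝ (fun q => (formChart φ θ (ψ q)).comp (fderiv ℝ ψ q)) x :=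
    DifferentiableAt.clm_comp
      (DifferentiableAt.comp (g := formChart φ θ) (f := ψ) x hθ' (hψ.differentiableAt (by simp)))
      ((hψ.fderiv_right (m := 1) (by norm_cast)).differentiableAt (by simp))
  have he : ∀ v, (fun q => θ (f q) (md E E' f q v)) =ᶠ[𝓝 x]
      fun q => (formChart φ θ (ψ q)).comp (fderiv ℝ ψ q) v := fun v => by
    filter_upwards [h] with q hq using (hq v).2
  refine ⟨fun v => ?_, fun v w => ?_⟩
  · exact (hd.clm_apply (differentiableAt_const v)).congr_of_eventuallyEq (he v)
  · have h1 : ∀ v w, fderiv ℝ (fun q => θ (f q) (md E E' f q w)) x v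
        = fderiv ℝ (formChart φ θ) (ψ x) (fderiv ℝ ψ x v) (fderiv ℝ ψ x w)
        + formChart φ θ (ψ x) (fderiv ℝ (fderiv ℝ ψ) x v w) := fun v w => by
      rw [(he w).fderiv_eq, (hd.hasFDerivAt.clm_apply (hasFDerivAt_const w x)).fderiv,
        ← fderiv_pullback_flat hψ hθ']
      simp
    have h2 : ∀ v, fderiv ℝ ψ x v = md E E' f x v := fun v => by
      rw [← (h.self_of_nhds v).1, md_chartAt_self]
    rw [h1, h1, isSymm_flat hψ v w, dForm, ← hφdef, h2, h2]
    ring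

/-- The Lie derivative of the pullback of a one-form `θ` along a map `f` which relates two vector
fields up to a field `D` annihilated by `θ`. -/
lemma lieForm_pullback {f : X → Y} {x : X} (hf : SmoothAt E E' f x) {θ : Y → E' →ₗ[ℝ] ℝ}
    (hθ : SmoothScalar θ) {V : Y → E'} (hV : SmoothAlong E' E' (fun y => y) V (f x)) {W : X → E}
    (hW : SmoothAlong E E (fun y => y) W x)
    (h0 : ∀ᶠ y in 𝓝 x, θ (f y) (V (f y) - md E E' f y (W y)) = 0) (v : E) :
    lieForm W (fun y => (θ (f y)).comp (md E E' f y).toLinearMap) x v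
      = lieForm V θ (f x) (md E E' f x v)
        - dForm θ (f x) (V (f x) - md E E' f x (W x)) (md E E' f x v) := by
  set φ := chartAt E x with hφdef
  have hφ : φ ∈ IsManifold.maximalAtlas 𝓘(ℝ, E) ∞ X := IsManifold.chart_mem_maximalAtlas x
  have hx : x ∈ φ.source := mem_chart_source E x
  have ht : φ x ∈ φ.target := φ.map_source hx
  have hl : φ.symm (φ x) = x := φ.left_inv hx
  set χ := chartAt E' (f x) with hχdef
  have hχ : χ ∈ IsManifold.maximalAtlas 𝓘(ℝ, E') ∞ Y := IsManifold.chart_mem_maximalAtlas _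
  have hfx : f x ∈ χ.source := mem_chart_source E' _
  have hsymm : SmoothAt E E φ.symm (φ x) := contMDiffAt_symm_of_mem_maximalAtlas hφ ht
  have hF : SmoothAt E E' (fun q => f (φ.symm q)) (φ x) := hf.comp_of_eq' hsymm hl
  obtain ⟨hψ, h⟩ := formChart_pullback hF θ
  simp only [hl, ← hχdef] at hψ h
  set ψ := fun q => χ (f (φ.symm q)) with hψdef
  have hψx : ψ (φ x) = χ (f x) := by simp only [hψdef, hl]
  have hθ' : DifferentiableAt ℝ (formChart χ θ) (ψ (φ x)) := by
    rw [hψx]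
    exact (contDiffAt_formChart hχ hθ (χ.map_source hfx)).differentiableAt (by simp)
  have hV' : DifferentiableAt ℝ (chartField χ V) (ψ (φ x)) := by
    rw [hψx]
    exact (contDiffAt_chartField hχ (χ.map_source hfx)
      (by rwa [χ.left_inv hfx])).differentiableAt (by simp)
  have hW' : DifferentiableAt ℝ (chartField φ W) (φ x) :=
    (contDiffAt_chartField hφ ht (by rwa [hl])).differentiableAt (by simp)
  have hmd : ∀ᶠ q in 𝓝 (φ x), ∀ v, md E E' (fun q => f (φ.symm q)) q v
      = md E E' f (φ.symm q) (md E E φ.symm q v) := by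
    have h1 : ∀ᶠ q in 𝓝 (φ x), DiffAt E E' f (φ.symm q) := by
      have h2 := hsymm.continuousAt
      refine h2.eventually ?_
      rw [hl]
      exact hf.eventually_diffAt
    filter_upwards [h1, hsymm.eventually_diffAt] with q h1 h2 v
    exact md_comp_apply (g := f) h1 h2 v
  have hα : formChart φ (fun y => (θ (f y)).comp (md E E' f y).toLinearMap) =ᶠ[𝓝 (φ x)]
      fun q => (formChart χ θ (ψ q)).comp (fderiv ℝ ψ q) := by
    filter_upwards [h, hmd] with q h1 h2
    refine ContinuousLinearMap.ext fun v => ?_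
    refine Eq.trans ?_ (h1 v).2
    rw [h2, formChart_apply]
    rfl
  have hsrc : ∀ᶠ q in 𝓝 (φ x), f (φ.symm q) ∈ χ.source :=
    hF.continuousAt.eventually_mem (χ.open_source.mem_nhds (by rwa [hl]))
  -- The coordinate expression of `θ(D)`. It vanishes on a neighbourhood, so the exact term
  -- `d(θ(D))` drops out of the flat formula.
  have hD : (fun q => formChart χ θ (ψ q) (chartField χ V (ψ q) - fderiv ℝ ψ q (chartField φ W q)))
      =ᶠ[𝓝 (φ x)] fun _ => 0 := by
    have h0' : ∀ᶠ q in 𝓝 (φ x), θ (f (φ.symm q)) (V (f (φ.symm q))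
        - md E E' f (φ.symm q) (W (φ.symm q))) = 0 := by
      have h2 := hsymm.continuousAt
      refine h2.eventually (p := fun y => θ (f y) (V (f y) - md E E' f y (W y)) = 0) ?_
      rwa [hl]
    filter_upwards [h, hmd, hsrc, φ.open_target.mem_nhds ht, h0'] with q h1 h2 h3 h4 h5
    rw [map_sub, ← (h1 _).2, h2, md_symm_chartField hφ h4, formChart_apply,
      md_symm_chartField hχ (χ.map_source h3), χ.left_inv h3, ← map_sub, h5]
  have key := lie_pullback_flat hψ hθ' hV' hW' (fun _ => rfl) v
  rw [hD.fderiv_eq, ← hα.fderiv_eq] at key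
  have h2 : ∀ v, fderiv ℝ ψ (φ x) v = md E E' f x v := fun v => by
    rw [← (h.self_of_nhds v).1, hmd.self_of_nhds, hl, md_chartAt_self, md_chartAt_symm_self]
  simp only [h2, hψx] at key
  rw [hφdef, chartField_chartAt, ← hφdef, hχdef, chartField_chartAt, formChart_chartAt,
    formChart_chartAt, ← hχdef] at key
  rw [lieForm, ← hφdef]
  refine key.trans ?_
  simp [lieForm, dForm, ← hχdef]

variable {F : Type*} [AddCommGroup F] [Module ℝ F]

/-- `L_V θ = 0` in terms of the scalar components of `θ`. -/
lemma lieDerivFormZero_iff {V : X → E} (θ : X → E →ₗ[ℝ] F)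
    (hθ : SmoothForm (E := E) (X := X) θ) :
    LieDerivFormZero (E := E) (X := X) V θ ↔
      ∀ (l : F →ₗ[ℝ] ℝ) x v, lieForm V (fun y => l ∘ₗ θ y) x v = 0 := by
  have hl : ∀ l : F →ₗ[ℝ] ℝ, SmoothScalar (fun y => l ∘ₗ θ y) := fun l => hθ l
  constructor
  · intro h l x v
    set φ := chartAt E x with hφdef
    have hφ : φ ∈ IsManifold.maximalAtlas 𝓘(ℝ, E) ∞ X := IsManifold.chart_mem_maximalAtlas x
    have hx : x ∈ φ.source := mem_chart_source E x
    have h1 : SmoothAlong E E (fun y : E => y) (fun _ => v) (φ x) :=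
      smoothAlong_id contMDiffAt_const
    have h2 := (h1.md (g := φ.symm) (contMDiffAt_symm_of_mem_maximalAtlas hφ
      (φ.map_source hx))).comp (g := φ) (w := x) (contMDiffAt_of_mem_maximalAtlas hφ hx) rfl
    -- `LieDerivFormZero` is tested on local fields; the field that is constant in the chart
    -- realizes an arbitrary value `v` at `x`.
    let W : X → E := fun y => md E E φ.symm (φ y) v
    have hW : SmoothAlong E E (fun y => y) W x := by
      refine ContMDiffAt.congr_of_eventuallyEq h2 ?_
      filter_upwards [φ.open_source.mem_nhds hx] with y hy
      rw [φ.left_inv hy]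
    have h3 := lieForm_eq (V := V) (hl l) hW
    have h4 := h x W hW l
    have h5 : W x = v := md_chartAt_symm_self x v
    rw [h5] at h3
    rw [← h3, sub_eq_zero]
    exact h4
  · intro h x W hW l
    have h3 := lieForm_eq (V := V) (hl l) hW
    exact sub_eq_zero.1 (h3.trans (h l x (W x)))

end Charts

/-! ### Descent of smooth vector fields and pullback of smooth forms -/

section Fields

open Filter Topology Set

variable {E : Type*} [NormedAddCommGroup E] [NormedSpace ℝ E]
  {E' : Type*} [NormedAddCommGroup E'] [NormedSpace ℝ E']
  {X : Type*} [TopologicalSpace X] [ChartedSpace E X] [IsManifold 𝓘(ℝ, E) ∞ X]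
  {Y : Type*} [TopologicalSpace Y] [ChartedSpace E' Y] [IsManifold 𝓘(ℝ, E') ∞ Y]

/-- Smoothness of vector fields descends along maps with local sections. -/
lemma smoothField_of_related {f : X → Y} (hf : ∀ x, SmoothAt E E' f x)
    (hs : ∀ y, ∃ s : Y → X, SmoothAt E' E s y ∧ ∀ᶠ z in 𝓝 y, f (s z) = z) {V : X → E}
    (hV : SmoothField (E := E) (X := X) V) {W : Y → E'} (h : ∀ x, W (f x) = md E E' f x (V x)) :
    SmoothField (E := E') (X := Y) W := by
  intro y
  obtain ⟨s, hsm, hfs⟩ := hs y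
  have h1 : SmoothAlong E E (fun y => y) V (s y) := hV _
  have h2 := (h1.md (hf (s y))).comp (w := y) hsm rfl
  refine ContMDiffAt.congr_of_eventuallyEq h2 ?_
  filter_upwards [hfs] with z hz
  rw [← h, hz]

variable {F : Type*} [AddCommGroup F] [Module ℝ F]

lemma SmoothForm.comp_linear {θ : X → E →ₗ[ℝ] F} (hθ : SmoothForm (E := E) (X := X) θ)
    {F' : Type*} [AddCommGroup F'] [Module ℝ F'] (T : F →ₗ[ℝ] F') :
    SmoothForm (E := E) (X := X) (fun x => T ∘ₗ θ x) := fun l => hθ (l ∘ₗ T)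

lemma SmoothForm.pullback {θ : Y → E' →ₗ[ℝ] F} (hθ : SmoothForm (E := E') (X := Y) θ) {f : X → Y}
    (hf : ContMDiff 𝓘(ℝ, E) 𝓘(ℝ, E') ∞ f) :
    SmoothForm (E := E) (X := X) (fun x => (θ (f x)).comp (md E E' f x).toLinearMap) := fun l =>
  (hθ l).comp (hf.contMDiff_tangentMap (by simp))

end Fields

section Bundle

open Filter Topology Set

variable {EG : Type*} [NormedAddCommGroup EG] [NormedSpace ℝ EG] [FiniteDimensional ℝ EG]
  {G : Type*} [TopologicalSpace G] [ChartedSpace EG G] [Group G] [LieGroup 𝓘(ℝ, EG) ∞ G]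
  {k : ℕ} {gr : Grading (GroupLieAlgebra 𝓘(ℝ, EG) G) k}
  {EP : Type*} [NormedAddCommGroup EP] [NormedSpace ℝ EP]
  {P : Subgroup G} [ChartedSpace EP P] [LieGroup 𝓘(ℝ, EP) ∞ P]
  {EB : Type*} [NormedAddCommGroup EB] [NormedSpace ℝ EB]
  {B : Type*} [TopologicalSpace B] [ChartedSpace EB B] [IsManifold 𝓘(ℝ, EB) ∞ B]
  [MulAction (↥P)ᵐᵒᵖ B]
  {EM : Type*} [NormedAddCommGroup EM] [NormedSpace ℝ EM]
  {M : Type*} [TopologicalSpace M] [ChartedSpace EM M]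
  {N : Type*} {EN : Type*} [NormedAddCommGroup EN] [NormedSpace ℝ EN] [TopologicalSpace N]
  [ChartedSpace EN N] [IsManifold 𝓘(ℝ, EN) ∞ N]

/-! ### Principal bundles -/

namespace IsPrincipalBundle

variable {π : B → M} (h : IsPrincipalBundle EP EB EM P π)

include h

lemma act_eq_self {u : B} {p : P} (hp : u <• p = u) : p = 1 := by
  obtain ⟨U, -, hx, e, s, -, -, -, he, -⟩ := h.locally_trivial (π u)
  have h1 := he u hx p
  rw [hp] at h1
  exact left_eq_mul.1 h1

lemma act_injective {u : B} {p q : P} (hp : u <• p = u <• q) : p = q := by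
  have h1 : u <• (p * q⁻¹) = u := by
    rw [MulOpposite.op_mul, mul_smul, hp, ← mul_smul, ← MulOpposite.op_mul, mul_inv_cancel]
    simp
  exact mul_inv_eq_one.1 (h.act_eq_self h1)

lemma exists_act {u v : B} (huv : π u = π v) : ∃ p : P, u <• p = v := by
  obtain ⟨U, -, hx, e, s, -, -, -, -, hs⟩ := h.locally_trivial (π u)
  refine ⟨(e u)⁻¹ * e v, ?_⟩
  have h1 := hs u hx
  have h2 := hs v (huv ▸ hx)
  rw [← huv] at h2
  calc u <• ((e u)⁻¹ * e v) = (s (π u) <• e u) <• ((e u)⁻¹ * e v) := by rw [h1]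
    _ = s (π u) <• e v := by rw [← mul_smul, ← MulOpposite.op_mul, mul_inv_cancel_left]
    _ = v := h2

lemma smoothAt_proj (u : B) : SmoothAt EB EM π u := h.smooth_proj u

lemma smoothAt_act (u : B) (p : P) : SmoothAt EB EB (fun u : B => u <• p) u :=
  smoothAt_two (a := fun (u : B) (p : P) => u <• p) (f := fun u => u) (g := fun _ => p)
    h.smooth_act contMDiffAt_id contMDiffAt_const

lemma smoothAt_orbit (u : B) (p : P) : SmoothAt EP EB (fun p : P => u <• p) p :=
  smoothAt_two (a := fun (u : B) (p : P) => u <• p) (f := fun _ => u) (g := fun p => p)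
    h.smooth_act contMDiffAt_const contMDiffAt_id

/-- The quotient of two maps with the same projection to the base is smooth. -/
lemma exists_division {f g : N → B} {x : N} (hf : SmoothAt EN EB f x) (hg : SmoothAt EN EB g x)
    (hfg : ∀ᶠ y in 𝓝 x, π (f y) = π (g y)) :
    ∃ p : N → P, SmoothAt EN EP p x ∧ ∀ᶠ y in 𝓝 x, f y <• p y = g y := by
  obtain ⟨U, hU, hx, e, s, he, -, -, -, hs⟩ := h.locally_trivial (π (f x))
  have hU' : IsOpen (π ⁻¹' U) := hU.preimage h.smooth_proj.continuous
  have hgx : g x ∈ π ⁻¹' U := by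
    rw [mem_preimage, ← hfg.self_of_nhds]
    exact hx
  have h1 : SmoothAt EN EP (fun y => e (f y)) x :=
    SmoothAt.comp' (g := e) (he.contMDiffAt (hU'.mem_nhds hx)) hf
  have h2 : SmoothAt EN EP (fun y => e (g y)) x :=
    SmoothAt.comp' (g := e) (he.contMDiffAt (hU'.mem_nhds hgx)) hg
  refine ⟨fun y => (e (f y))⁻¹ * e (g y), h1.inv.mul h2, ?_⟩
  filter_upwards [hfg, hf.continuousAt.eventually_mem (hU'.mem_nhds hx)] with y hy hyU
  have h3 := hs _ hyU
  have h4 := hs (g y) (by rw [← hy]; exact hyU)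
  rw [← hy] at h4
  calc f y <• ((e (f y))⁻¹ * e (g y))
      = (s (π (f y)) <• e (f y)) <• ((e (f y))⁻¹ * e (g y)) := by rw [h3]
    _ = s (π (f y)) <• e (g y) := by rw [← mul_smul, ← MulOpposite.op_mul, mul_inv_cancel_left]
    _ = g y := h4

lemma exists_section (u : B) :
    ∃ s : M → B, SmoothAt EM EB s (π u) ∧ s (π u) = u ∧ ∀ᶠ y in 𝓝 (π u), π (s y) = y := by
  obtain ⟨U, hU, hx, e, s, -, hs, hπs, -, hsu⟩ := h.locally_trivial (π u)
  refine ⟨fun y => s y <• e u, ?_, hsu u hx, ?_⟩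
  · exact SmoothAt.comp' (g := fun v : B => v <• e u) (h.smoothAt_act _ _)
      (hs.contMDiffAt (hU.mem_nhds hx))
  · filter_upwards [hU.mem_nhds hx] with y hy
    rw [h.proj_act, hπs y hy]

lemma md_proj_surjective (u : B) : Function.Surjective (md EB EM π u) := by
  obtain ⟨s, hs, hsu, hπs⟩ := h.exists_section u
  intro w
  refine ⟨md EM EB s (π u) w, ?_⟩
  rw [← md_comp_apply_of_eq (g := π) hsu (h.smoothAt_proj u).diffAt hs.diffAt]
  have h1 : (fun y => π (s y)) =ᶠ[𝓝 (π u)] fun y => y := hπs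
  rw [md_congr h1, md_id]
  rfl

/-- From `u · q = (u · p) · (p⁻¹ q)`: velocities at `p` are moved to the identity, where the orbit
map generates fundamental vectors, on which the Cartan connection is known. -/
lemma md_orbit (u : B) (p : P) {q : N → P} {x : N} (hq : SmoothAt EN EP q x) (hqx : q x = p)
    (v : EN) : md EP EB (fun p : P => u <• p) p (md EN EP q x v)
      = md EP EB (fun p' : P => (u <• p) <• p') 1 (md EN EP (fun y => p⁻¹ * q y) x v) := by
  have h1 : SmoothAt EN EP (fun y => p⁻¹ * q y) x := contMDiffAt_const.mul hq
  rw [← md_comp_apply_of_eq (g := fun p : P => u <• p) hqx (h.smoothAt_orbit u p).diffAt hq.diffAt,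
    ← md_comp_apply_of_eq (g := fun p' : P => (u <• p) <• p') (by simp [hqx])
      (h.smoothAt_orbit _ _).diffAt h1.diffAt]
  congr 1
  refine congrArg (fun f => md EN EB f x) (funext fun y => ?_)
  rw [← mul_smul, ← MulOpposite.op_mul, mul_inv_cancel_left]

/-- Vertical tangent vectors are values of fundamental vector fields. -/
lemma exists_fundamental {u : B} {v : EB} (hv : md EB EM π u v = 0) :
    ∃ A : EP, md EP EB (fun p : P => u <• p) 1 A = v := by
  obtain ⟨U, hU, hx, e, s, he, hs, -, -, hsu⟩ := h.locally_trivial (π u)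
  have hU' : IsOpen (π ⁻¹' U) := hU.preimage h.smooth_proj.continuous
  have he' : SmoothAt EB EP e u := he.contMDiffAt (hU'.mem_nhds hx)
  have hs' : SmoothAt EM EB s (π u) := hs.contMDiffAt (hU.mem_nhds hx)
  have hsπ : SmoothAt EB EB (fun u => s (π u)) u := SmoothAt.comp' (g := s) hs' (h.smoothAt_proj u)
  have h1 : (fun w => s (π w) <• e w) =ᶠ[𝓝 u] fun w => w := by
    filter_upwards [hU'.mem_nhds hx] with w hw using hsu w hw
  -- Differentiate `w = s (π w) · e w`. On a vertical vector the contribution of `s ∘ π` vanishes,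
  -- and the rest is tangent to the orbit through `u`.
  have h2 := md_two (a := fun (u : B) (p : P) => u <• p) h.smooth_act hsπ.diffAt he'.diffAt v
  rw [md_congr h1, md_id, md_comp_apply (g := s) hs'.diffAt (h.smoothAt_proj u).diffAt, hv, map_zero,
    map_zero, zero_add, h.md_orbit (s (π u)) (e u) he' rfl, hsu u hx] at h2
  exact ⟨_, h2.symm⟩

end IsPrincipalBundle

/-! ### Cartan connections -/

namespace CartanGeometry

variable (C : CartanGeometry EG EP EB EM P B M)

/-- The Cartan connection, as a linear map on the model space. -/
def om (u : B) : EB →ₗ[ℝ] GroupLieAlgebra 𝓘(ℝ, EG) G := C.form u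

lemma om_act (p : P) (u : B) (v : EB) :
    C.om (u <• p) (md EB EB (fun u : B => u <• p) u v) = Ad EG ((p⁻¹ : P) : G) (C.om u v) :=
  C.equivariant p u v

lemma om_fundamental (u : B) (A : EP) :
    C.om u (md EP EB (fun p : P => u <• p) 1 A)
      = (md EP EG (fun p : P => (p : G)) 1 A : EG) := C.fundamental u A

lemma om_eq_zero {u : B} {v : EB} (h : C.om u v = 0) : v = 0 :=
  (C.bijective u).1 (h.trans (map_zero (C.om u)).symm)

/-- The one-form `B(Z, ω)`. -/
noncomputable def scaleForm (Z : GroupLieAlgebra 𝓘(ℝ, EG) G) (u : B) : EB →ₗ[ℝ] ℝ :=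
  killingForm ℝ (GroupLieAlgebra 𝓘(ℝ, EG) G) Z ∘ₗ C.om u

lemma smoothScalar_scaleForm (Z : GroupLieAlgebra 𝓘(ℝ, EG) G) : SmoothScalar (C.scaleForm Z) :=
  C.smooth_form (killingForm ℝ (GroupLieAlgebra 𝓘(ℝ, EG) G) Z)

variable {C} (hP : IsParabolicSubgroup gr P EP)

include hP in
lemma om_mem_nonneg {u : B} {v : EB} (hv : md EB EM C.proj u v = 0) : C.om u v ∈ gr.nonneg := by
  obtain ⟨A, rfl⟩ := C.principal.exists_fundamental hv
  rw [om_fundamental]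
  exact (hP.lieAlgebra _).2 ⟨A, rfl⟩

include hP in
/-- The velocity of a smooth curve in `P_+`. -/
lemma md_coe_mem_pos [LieAlgebra.IsKilling ℝ (GroupLieAlgebra 𝓘(ℝ, EG) G)] {c : ℝ → P}
    (hc : SmoothAt ℝ EP c 0) (hc0 : c 0 = 1) (hmem : ∀ᶠ t in 𝓝 0, c t ∈ unip gr P) :
    (md EP EG (fun p : P => (p : G)) 1 (md ℝ EP c 0 1) : GroupLieAlgebra 𝓘(ℝ, EG) G) ∈ gr.pos := by
  have h1 : SmoothAt EP EG (fun p : P => (p : G)) 1 := hP.embedded.contMDiff 1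
  refine velocity_mem_pos gr (c := c) ?_ hc0 hmem ?_
  · exact SmoothAt.diffAt (SmoothAt.comp_of_eq' (g := fun p : P => (p : G)) h1 hc hc0)
  · exact md_comp_apply_of_eq (g := fun p : P => (p : G)) hc0 h1.diffAt hc.diffAt 1

end CartanGeometry

end Bundle

section Weyl

open Filter Topology Set

variable {EG : Type*} [NormedAddCommGroup EG] [NormedSpace ℝ EG] [FiniteDimensional ℝ EG]
  {G : Type*} [TopologicalSpace G] [ChartedSpace EG G] [Group G] [LieGroup 𝓘(ℝ, EG) ∞ G]
  {k : ℕ} {gr : Grading (GroupLieAlgebra 𝓘(ℝ, EG) G) k}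
  {EP : Type*} [NormedAddCommGroup EP] [NormedSpace ℝ EP]
  {P : Subgroup G} [ChartedSpace EP P] [LieGroup 𝓘(ℝ, EP) ∞ P]
  {EB : Type*} [NormedAddCommGroup EB] [NormedSpace ℝ EB]
  {B : Type*} [TopologicalSpace B] [ChartedSpace EB B] [IsManifold 𝓘(ℝ, EB) ∞ B]
  [MulAction (↥P)ᵐᵒᵖ B]
  {EM : Type*} [NormedAddCommGroup EM] [NormedSpace ℝ EM]
  {M : Type*} [TopologicalSpace M] [ChartedSpace EM M]
  {N : Type*} {EN : Type*} [NormedAddCommGroup EN] [NormedSpace ℝ EN] [TopologicalSpace N]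
  [ChartedSpace EN N] [IsManifold 𝓘(ℝ, EN) ∞ N]
  {E0 : Type*} [NormedAddCommGroup E0] [NormedSpace ℝ E0] [ChartedSpace E0 (GZero gr P B)]
  [IsManifold 𝓘(ℝ, E0) ∞ (GZero gr P B)]
  {C : CartanGeometry EG EP EB EM P B M}
  {Z : GroupLieAlgebra 𝓘(ℝ, EG) G}

/-! ### Vertical vectors and maps with the same projection to `𝒢_0` -/

lemma piPlus_eq_iff {u v : B} :
    piPlus gr P B u = piPlus gr P B v ↔ ∃ p ∈ unip gr P, u <• p = v := Quotient.eq

lemma piPlus_act {u : B} {p : P} (hp : p ∈ unip gr P) :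
    piPlus gr P B (u <• p) = piPlus gr P B u := (piPlus_eq_iff.2 ⟨p, hp, rfl⟩).symm

variable (C) in
lemma proj_eq_of_piPlus {u v : B} (h : piPlus gr P B u = piPlus gr P B v) : C.proj u = C.proj v :=
  congrArg (C.projZero gr) h

/-- If `f` is transversal to the fibres of `𝒢 → M`, any tangent vector differs from one in the image
of `Tf` by a vertical vector, and `ω` maps vertical vectors into `𝔭`. -/
lemma range_sup_nonneg (hP : IsParabolicSubgroup gr P EP) {f : N → B} {x : N}
    (hf : DiffAt EN EB f x) (hs : Function.Surjective (md EN EM (fun y => C.proj (f y)) x)) :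
    LinearMap.range (C.om (f x) ∘ₗ (md EN EB f x).toLinearMap) ⊔ gr.nonneg = ⊤ := by
  refine top_le_iff.1 fun A _ => ?_
  obtain ⟨w, rfl⟩ : ∃ w : EB, C.om (f x) w = A := (C.bijective (f x)).2 A
  obtain ⟨v, hv⟩ := hs (md EB EM C.proj (f x) w)
  rw [md_comp_apply (C.principal.smoothAt_proj _).diffAt hf] at hv
  have h1 := C.om_mem_nonneg hP (u := f x) (v := w - md EN EB f x v) (by rw [map_sub, hv, sub_self])
  refine Submodule.mem_sup.2 ⟨_, ⟨v, rfl⟩, _, h1, ?_⟩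
  rw [map_sub]
  exact add_sub_cancel _ _

variable [LieAlgebra.IsKilling ℝ (GroupLieAlgebra 𝓘(ℝ, EG) G)]

/-- This controls the vertical term in the derivative of `f · p` for `p` valued in `P_+`; it is
checked along curves by `velocity_mem_pos`. -/
lemma om_division_mem_pos (hP : IsParabolicSubgroup gr P EP) {p : N → P} {x : N}
    (hp : SmoothAt EN EP p x) (hp1 : p x = 1) (hmem : ∀ᶠ y in 𝓝 x, p y ∈ unip gr P) (u : B)
    (v : EN) : C.om u (md EP EB (fun q : P => u <• q) 1 (md EN EP p x v)) ∈ gr.pos := by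
  obtain ⟨c, hc, hc0, hcv⟩ := exists_curve x v
  have h1 : SmoothAt ℝ EP (fun t => p (c t)) 0 := SmoothAt.comp_of_eq' (g := p) hp hc hc0
  have h2 := C.om_fundamental u (md EN EP p x v)
  have h3 : ∀ᶠ t in 𝓝 (0 : ℝ), p (c t) ∈ unip gr P := by
    have h4 := hc.continuousAt
    refine h4.eventually (p := fun y => p y ∈ unip gr P) ?_
    rwa [hc0]
  have h5 := CartanGeometry.md_coe_mem_pos hP h1 (by rw [hc0, hp1]) h3
  rw [md_comp_apply_of_eq (g := p) hc0 hp.diffAt hc.diffAt, hcv] at h5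
  rw [h2]
  exact h5

/-- Vectors tangent to the fibres of `𝒢 → 𝒢_0`. -/
lemma om_mem_pos (hP : IsParabolicSubgroup gr P EP)
    (hzero : Manifold.IsSubmersion 𝓘(ℝ, EB) 𝓘(ℝ, E0) ∞ (piPlus gr P B)) {u : B} {v : EB}
    (hv : md EB E0 (piPlus gr P B) u v = 0) : C.om u v ∈ gr.pos := by
  -- Lifting the constant curve realizes `v` as the velocity of a curve in a fibre of `π_+`, which
  -- has the form `u · p(t)` with `p(t) ∈ P_+`.
  obtain ⟨c, hc, hc0, hcv, hcm⟩ := (hzero.isSubmersionAt u).exists_lift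
    (m := fun _ => piPlus gr P B u) contMDiffAt_const rfl (v := v) (by rw [md_const, hv]; rfl)
  obtain ⟨p, hp, hpc⟩ := C.principal.exists_division (f := fun _ : ℝ => u) (g := c)
    contMDiffAt_const hc (by
      filter_upwards [hcm] with t ht using (proj_eq_of_piPlus C ht).symm)
  have hp0 : p 0 = 1 := C.principal.act_eq_self (hpc.self_of_nhds.trans hc0)
  have hmem : ∀ᶠ t in 𝓝 0, p t ∈ unip gr P := by
    filter_upwards [hcm, hpc] with t ht ht'
    obtain ⟨q, hq, hqc⟩ := piPlus_eq_iff.1 ht.symm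
    rwa [C.principal.act_injective (ht'.trans hqc.symm)]
  have h1 : md ℝ EB (fun t => u <• p t) 0 1 = v := by
    rw [← hcv]
    exact congrArg (fun T : ℝ →L[ℝ] EB => T 1) (md_congr hpc)
  rw [md_comp_apply_of_eq (g := fun q : P => u <• q) hp0 (C.principal.smoothAt_orbit u 1).diffAt
    hp.diffAt] at h1
  rw [← h1]
  exact om_division_mem_pos hP hp hp0 hmem u 1

lemma scaleForm_eq_zero_of_mem_pos (hZ : gr.IsScaling Z) {u : B} {v : EB}
    (hv : C.om u v ∈ gr.pos) : C.scaleForm Z u v = 0 :=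
  gr.killingForm_filt_eq_zero (by norm_num) (gr.comp_le_filt le_rfl hZ.mem) hv

omit [LieAlgebra.IsKilling ℝ (GroupLieAlgebra 𝓘(ℝ, EG) G)] in
lemma scaleForm_act (p : P) (u : B) (v : EB) :
    C.scaleForm Z (u <• p) (md EB EB (fun u : B => u <• p) u v)
      = killingForm ℝ _ Z (Ad EG ((p⁻¹ : P) : G) (C.om u v)) := by
  rw [← C.om_act p u v]
  rfl

omit [LieAlgebra.IsKilling ℝ (GroupLieAlgebra 𝓘(ℝ, EG) G)] in
lemma scaleForm_fundamental (u : B) (A : EP) :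
    C.scaleForm Z u (md EP EB (fun p : P => u <• p) 1 A)
      = killingForm ℝ (GroupLieAlgebra 𝓘(ℝ, EG) G) Z (md EP EG (fun p : P => (p : G)) 1 A) := by
  rw [← C.om_fundamental u A]
  rfl

/-- Two maps into `𝒢` with the same projection to `𝒢_0` which pull back `B(Z, ω)` to the same
form coincide. -/
theorem eq_of_scaleForm_eq (hP : IsParabolicSubgroup gr P EP) (hZ : gr.IsScaling Z)
    (hlu : ∀ p ∈ levi gr P, p ∈ unip gr P → p = 1)
    {f g : N → B} {x : N} (hf : SmoothAt EN EB f x) (hg : SmoothAt EN EB g x)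
    (hfg : ∀ᶠ y in 𝓝 x, piPlus gr P B (f y) = piPlus gr P B (g y))
    (hs : Function.Surjective (md EN EM (fun y => C.proj (f y)) x))
    (hθ : ∀ v, C.scaleForm Z (f x) (md EN EB f x v) = C.scaleForm Z (g x) (md EN EB g x v)) :
    g x = f x := by
  obtain ⟨p, hp, hpg⟩ := C.principal.exists_division hf hg
    (by filter_upwards [hfg] with y hy using proj_eq_of_piPlus C hy)
  have hmem : ∀ᶠ y in 𝓝 x, p y ∈ unip gr P := by
    filter_upwards [hfg, hpg] with y hy hy'
    obtain ⟨q, hq, hqc⟩ := piPlus_eq_iff.1 hy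
    rwa [C.principal.act_injective (hy'.trans hqc.symm)]
  have hpx := hmem.self_of_nhds
  have hgx : f x <• p x = g x := hpg.self_of_nhds
  -- The derivative of `g = f · p` is the translate of `Tf v` plus a fundamental vector with
  -- `ω`-value in `𝔭_+`, which `B(Z, ·)` annihilates.
  have hom : ∀ v, C.scaleForm Z (g x) (md EN EB g x v)
      = killingForm ℝ _ Z (Ad EG (((p x)⁻¹ : P) : G) (C.om (f x) (md EN EB f x v))) := by
    intro v
    have h1 : (fun y => f y <• p y) =ᶠ[𝓝 x] g := hpg
    have h2 := md_two (a := fun (u : B) (p : P) => u <• p) C.principal.smooth_act hf.diffAt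
      hp.diffAt v
    rw [md_congr h1, C.principal.md_orbit (f x) (p x) hp rfl] at h2
    have h3 := om_division_mem_pos (C := C) hP (p := fun y => (p x)⁻¹ * p y) (x := x)
      (contMDiffAt_const.mul hp) (by simp)
      (by filter_upwards [hmem] with y hy using mul_mem (inv_mem hpx) hy) (f x <• p x) v
    have h4 := scaleForm_eq_zero_of_mem_pos hZ h3
    rw [← hgx, h2, map_add, h4, add_zero]
    exact scaleForm_act _ _ _
  have hY : Ad EG (p x : G) Z - Z ∈ gr.filt 1 :=
    Ad_sub_mem_filt gr hpx 0 Z (gr.comp_le_filt le_rfl hZ.mem)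
  -- By invariance the hypothesis says that `Ad p Z - Z` is orthogonal to `ω(Tf v)`. As it lies in
  -- `𝔭_+`, it is also orthogonal to `𝔭`, and together these exhaust `𝔤`.
  have h5 : Ad EG (p x : G) Z - Z = 0 := by
    refine Grading.eq_zero_of_killingForm fun y => ?_
    have h6 : LinearMap.range (C.om (f x) ∘ₗ (md EN EB f x).toLinearMap) ⊔ gr.nonneg
        ≤ LinearMap.ker (killingForm ℝ _ (Ad EG (p x : G) Z - Z)) := by
      refine sup_le ?_ fun y hy => gr.killingForm_filt_eq_zero (by norm_num) hY hy
      rintro _ ⟨v, rfl⟩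
      have h7 := killingForm_Ad (p x : G) Z (Ad EG (p x : G)⁻¹ (C.om (f x) (md EN EB f x v)))
      rw [Ad_Ad_inv] at h7
      have h8 := h7.trans ((hom v).symm.trans (hθ v).symm)
      have h9 := LinearMap.map_sub₂ (killingForm ℝ (GroupLieAlgebra 𝓘(ℝ, EG) G))
        (Ad EG (p x : G) Z) Z (C.om (f x) (md EN EB f x v))
      exact h9.trans (sub_eq_zero.2 h8)
    exact h6 (range_sup_nonneg (C := C) hP hf.diffAt hs ▸ Submodule.mem_top)
  have h8 := hlu _ (mem_levi_of_Ad_scaling hZ (sub_eq_zero.1 h5)) hpx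
  rw [← hgx, h8, MulOpposite.op_one, one_smul]

variable [FiniteDimensional ℝ EB] [FiniteDimensional ℝ EN]

omit [LieAlgebra.IsKilling ℝ (GroupLieAlgebra 𝓘(ℝ, EG) G)] [FiniteDimensional ℝ EN] in
/-- The exterior derivative of `B(Z, ω)` on vertical vectors. -/
lemma dForm_fundamental (hP : IsParabolicSubgroup gr P EP) {u : B} (A : EP) (w : EB) :
    dForm (C.scaleForm Z) u (md EP EB (fun p : P => u <• p) 1 A) w
      = - killingForm ℝ _ Z ⁅C.om u (md EP EB (fun p : P => u <• p) 1 A), C.om u w⁆ := by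
  obtain ⟨p, hp, hp0, hpA⟩ := exists_curve (1 : P) A
  obtain ⟨c, hc, hc0, hcw⟩ := exists_curve u w
  -- A surface through `u` whose coordinate vectors at the origin are the fundamental vector of `A`
  -- and `w`. On it `dθ` is a difference of two ordinary derivatives, and both can be computed.
  set F : ℝ × ℝ → B := fun q => c q.2 <• p q.1 with hFdef
  have h1 : ∀ q, SmoothAt (ℝ × ℝ) ℝ (fun q : ℝ × ℝ => q.1) q := fun q =>
    contDiffAt_fst.contMDiffAt
  have h2 : ∀ q, SmoothAt (ℝ × ℝ) ℝ (fun q : ℝ × ℝ => q.2) q := fun q =>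
    contDiffAt_snd.contMDiffAt
  have m1 : ∀ q v, md (ℝ × ℝ) ℝ (fun q : ℝ × ℝ => q.1) q v = v.1 := fun q v => by
    rw [md_eq_fderiv, fderiv_fst]; rfl
  have m2 : ∀ q v, md (ℝ × ℝ) ℝ (fun q : ℝ × ℝ => q.2) q v = v.2 := fun q v => by
    rw [md_eq_fderiv, fderiv_snd]; rfl
  have hF : SmoothAt (ℝ × ℝ) EB F 0 :=
    smoothAt_two (a := fun (u : B) (p : P) => u <• p) (f := fun q : ℝ × ℝ => c q.2)
      (g := fun q : ℝ × ℝ => p q.1) C.principal.smooth_act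
      (SmoothAt.comp' (g := c) (f := fun q : ℝ × ℝ => q.2) hc (h2 0))
      (SmoothAt.comp' (g := p) (f := fun q : ℝ × ℝ => q.1) hp (h1 0))
  have hF0 : F 0 = u := by simp [hFdef, hc0, hp0]
  have hmd : ∀ q : ℝ × ℝ, DiffAt ℝ EP p q.1 → DiffAt ℝ EB c q.2 → ∀ v,
      md (ℝ × ℝ) EB F q v = md EB EB (fun u : B => u <• p q.1) (c q.2) (md ℝ EB c q.2 v.2)
        + md EP EB (fun p : P => c q.2 <• p) (p q.1) (md ℝ EP p q.1 v.1) := fun q hq1 hq2 v => by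
    have h3 := md_two (a := fun (u : B) (p : P) => u <• p) (f := fun q : ℝ × ℝ => c q.2)
      (g := fun q : ℝ × ℝ => p q.1) (x := q) C.principal.smooth_act
      (DiffAt.comp' (g := c) (f := fun q : ℝ × ℝ => q.2) hq2 (h2 q).diffAt)
      (DiffAt.comp' (g := p) (f := fun q : ℝ × ℝ => q.1) hq1 (h1 q).diffAt) v
    rw [md_comp_apply (g := c) (f := fun q : ℝ × ℝ => q.2) hq2 (h2 q).diffAt,
      md_comp_apply (g := p) (f := fun q : ℝ × ℝ => q.1) hq1 (h1 q).diffAt, m1, m2] at h3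
    exact h3
  have hact1 : (fun u : B => u <• (1 : P)) = fun u => u := by funext u; simp
  have hv1 : md (ℝ × ℝ) EB F 0 (1, 0) = md EP EB (fun p : P => u <• p) 1 A := by
    have h3 := hmd 0 hp.diffAt hc.diffAt (1, 0)
    simp only [Prod.fst_zero, Prod.snd_zero, hp0, hc0, hpA, map_zero, zero_add] at h3
    exact h3
  have hv2 : md (ℝ × ℝ) EB F 0 (0, 1) = w := by
    have h3 := hmd 0 hp.diffAt hc.diffAt (0, 1)
    simp only [Prod.fst_zero, Prod.snd_zero, hp0, hc0, hcw, map_zero, add_zero, hact1] at h3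
    rw [h3, md_id]
    rfl
  obtain ⟨hd, hdF⟩ := dForm_pullback hF (C.smoothScalar_scaleForm Z)
  have key := hdF (1, 0) (0, 1)
  rw [hv1, hv2, hF0] at key
  rw [key]
  set a := C.om u (md EP EB (fun p : P => u <• p) 1 A) with ha
  have hcoe : SmoothAt EP EG (fun p : P => (p : G)) 1 := hP.embedded.contMDiff 1
  have hl1 : HasDerivAt (fun t : ℝ => (t, (0 : ℝ))) (1, 0) 0 :=
    (hasDerivAt_id (0 : ℝ)).prodMk (hasDerivAt_const _ _)
  have hl2 : HasDerivAt (fun t : ℝ => ((0 : ℝ), t)) (0, 1) 0 :=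
    (hasDerivAt_const _ _).prodMk (hasDerivAt_id (0 : ℝ))
  -- Along the orbit of `u`, equivariance gives `θ = B(Ad (p t) Z, ω(w))`, whose derivative at 0 is
  -- `B([a, Z], ω(w))`.
  have e1 : fderiv ℝ (fun q => C.scaleForm Z (F q) (md (ℝ × ℝ) EB F q (0, 1))) 0 (1, 0)
      = - killingForm ℝ _ Z ⁅a, C.om u w⁆ := by
    have h3 := HasFDerivAt.comp_hasDerivAt (f := fun t : ℝ => (t, (0 : ℝ))) (0 : ℝ)
      (hd (0, 1)).hasFDerivAt hl1
    have h4 := hasDerivAt_adm (c := fun t => (p t : G)) (SmoothAt.diffAt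
      (SmoothAt.comp_of_eq' (g := fun p : P => (p : G)) hcoe hp hp0)) (by simp [hp0]) a Z (by
        rw [md_comp_apply_of_eq (g := fun p : P => (p : G)) hp0 hcoe.diffAt hp.diffAt, hpA, ha,
          C.om_fundamental])
    let l : EG →ₗ[ℝ] ℝ := (killingForm ℝ (GroupLieAlgebra 𝓘(ℝ, EG) G)).flip (C.om u w)
    have h5 := l.toContinuousLinearMap.hasFDerivAt.comp_hasDerivAt 0 h4
    have h6 : (fun t : ℝ => C.scaleForm Z (F (t, 0)) (md (ℝ × ℝ) EB F (t, 0) (0, 1)))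
        =ᶠ[𝓝 0] fun t => l (adm EG (p t : G) Z) := by
      filter_upwards [hp.eventually_diffAt] with t ht
      have h7 := hmd (t, 0) ht hc.diffAt (0, 1)
      simp only [hc0, hcw, map_zero, add_zero] at h7
      have h8 : F (t, 0) = u <• p t := by simp [hFdef, hc0]
      rw [h7, h8]
      refine (scaleForm_act _ _ _).trans ?_
      rw [← killingForm_Ad (p t : G) Z, Subgroup.coe_inv, Ad_Ad_inv]
      rfl
    have h9 := h3.unique (h5.congr_of_eventuallyEq h6)
    refine h9.trans ?_
    change killingForm ℝ _ ⁅a, Z⁆ (C.om u w) = _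
    rw [← lie_skew, map_neg, LinearMap.neg_apply, LieModule.traceForm_apply_lie_apply]
  -- Along `c` the other coordinate vector is fundamental for the same `A`, so `θ` is constant on
  -- it.
  have e2 : fderiv ℝ (fun q => C.scaleForm Z (F q) (md (ℝ × ℝ) EB F q (1, 0))) 0 (0, 1) = 0 := by
    have h3 := HasFDerivAt.comp_hasDerivAt (f := fun t : ℝ => ((0 : ℝ), t)) (0 : ℝ)
      (hd (1, 0)).hasFDerivAt hl2
    have h6 : (fun t : ℝ => C.scaleForm Z (F (0, t)) (md (ℝ × ℝ) EB F (0, t) (1, 0)))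
        =ᶠ[𝓝 0] fun t => killingForm ℝ _ Z (md EP EG (fun p : P => (p : G)) 1 A) := by
      filter_upwards [hc.eventually_diffAt] with t ht
      have h7 := hmd (0, t) hp.diffAt ht (1, 0)
      simp only [hp0, hpA, map_zero, zero_add] at h7
      have h8 : F (0, t) = c t := by simp [hFdef, hp0]
      rw [h7, h8]
      exact scaleForm_fundamental _ _
    exact h3.unique ((hasDerivAt_const _ _).congr_of_eventuallyEq h6)
  rw [e1, e2, sub_zero]

/-- Let `V` and `W` be vector fields on `𝒢` and `N` which are related by `N → 𝒢_0`. If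
`B(Z, ω)` is preserved by `V` and its pullback is preserved by `W`, then they are related by
`N → 𝒢`. -/
theorem eq_of_lieForm_eq (hP : IsParabolicSubgroup gr P EP) (hZ : gr.IsScaling Z)
    (hzero : Manifold.IsSubmersion 𝓘(ℝ, EB) 𝓘(ℝ, E0) ∞ (piPlus gr P B))
    {f : N → B} {x : N} (hf : SmoothAt EN EB f x) {V : B → EB} {W : N → EN}
    (hV : SmoothAlong EB EB (fun y => y) V (f x)) (hW : SmoothAlong EN EN (fun y => y) W x)
    (hVW : ∀ᶠ y in 𝓝 x, md EB E0 (piPlus gr P B) (f y) (V (f y) - md EN EB f y (W y)) = 0)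
    (hs : Function.Surjective (md EN EM (fun y => C.proj (f y)) x))
    (hθV : ∀ w, lieForm V (C.scaleForm Z) (f x) w = 0)
    (hθW : ∀ v, lieForm W (fun y => (C.scaleForm Z (f y)).comp (md EN EB f y).toLinearMap) x v = 0) :
    md EN EB f x (W x) = V (f x) := by
  have h0 : ∀ᶠ y in 𝓝 x, C.scaleForm Z (f y) (V (f y) - md EN EB f y (W y)) = 0 := by
    filter_upwards [hVW] with y hy
    exact scaleForm_eq_zero_of_mem_pos hZ (om_mem_pos hP hzero hy)
  have h1 : ∀ v, dForm (C.scaleForm Z) (f x) (V (f x) - md EN EB f x (W x)) (md EN EB f x v) = 0 := by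
    intro v
    have h2 := lieForm_pullback hf (C.smoothScalar_scaleForm Z) hV hW h0 v
    rw [hθV, hθW] at h2
    linarith
  set D := V (f x) - md EN EB f x (W x) with hD
  have hDpos : C.om (f x) D ∈ gr.pos := om_mem_pos hP hzero hVW.self_of_nhds
  -- `D` is the velocity of a curve in a fibre of `π_+`, which projects to a single point of `M`; so
  -- `D` is vertical over `M` and hence a fundamental vector.
  obtain ⟨A, hA⟩ := C.principal.exists_fundamental (u := f x) (v := D) (by
    have h3 : SmoothAt EB E0 (piPlus gr P B) (f x) := (hzero.isSubmersionAt _).contMDiffAt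
    obtain ⟨c, hc, hc0, hcv, hcm⟩ := (hzero.isSubmersionAt (f x)).exists_lift
      (m := fun _ => piPlus gr P B (f x)) contMDiffAt_const rfl (v := D)
      (by rw [md_const, hVW.self_of_nhds]; rfl)
    rw [← hcv, ← md_comp_apply_of_eq (g := C.proj) hc0 (C.principal.smoothAt_proj _).diffAt hc.diffAt]
    have h4 : (fun t => C.proj (c t)) =ᶠ[𝓝 0] fun _ => C.proj (f x) := by
      filter_upwards [hcm] with t ht using proj_eq_of_piPlus C ht
    rw [md_congr h4, md_const]
    rfl)
  have h5 : C.om (f x) D = 0 := by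
    refine hZ.eq_zero_of_mem_pos hDpos (range_sup_nonneg (C := C) hP hf.diffAt hs) ?_
    rintro _ ⟨v, rfl⟩
    have h6 := h1 v
    rw [← hA, dForm_fundamental hP, hA, neg_eq_zero] at h6
    exact h6
  have h7 := C.om_eq_zero h5
  rw [hD, sub_eq_zero] at h7
  exact h7.symm

end Weyl

section Induced

open Filter Topology Set

variable {EG : Type*} [NormedAddCommGroup EG] [NormedSpace ℝ EG] [FiniteDimensional ℝ EG]
  {G : Type*} [TopologicalSpace G] [ChartedSpace EG G] [Group G] [LieGroup 𝓘(ℝ, EG) ∞ G]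
  {k : ℕ} {gr : Grading (GroupLieAlgebra 𝓘(ℝ, EG) G) k}
  {EP : Type*} [NormedAddCommGroup EP] [NormedSpace ℝ EP]
  {P : Subgroup G} [ChartedSpace EP P] [LieGroup 𝓘(ℝ, EP) ∞ P]
  {EB : Type*} [NormedAddCommGroup EB] [NormedSpace ℝ EB]
  {B : Type*} [TopologicalSpace B] [ChartedSpace EB B] [IsManifold 𝓘(ℝ, EB) ∞ B]
  [MulAction (↥P)ᵐᵒᵖ B]
  {EM : Type*} [NormedAddCommGroup EM] [NormedSpace ℝ EM]
  {M : Type*} [TopologicalSpace M] [ChartedSpace EM M] [IsManifold 𝓘(ℝ, EM) ∞ M]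
  {E0 : Type*} [NormedAddCommGroup E0] [NormedSpace ℝ E0] [ChartedSpace E0 (GZero gr P B)]
  [IsManifold 𝓘(ℝ, E0) ∞ (GZero gr P B)]
  {C : CartanGeometry EG EP EB EM P B M}
  {Z : GroupLieAlgebra 𝓘(ℝ, EG) G} {lam : ScaleRep gr P Z}
  {EL : Type*} [NormedAddCommGroup EL] [NormedSpace ℝ EL] [ChartedSpace EL (ScaleBundle B lam)]
  [IsManifold 𝓘(ℝ, EL) ∞ (ScaleBundle B lam)]

/-! ### Maps and vector fields induced on the quotients -/

lemma piPlus_surjective : Function.Surjective (piPlus gr P B) := Quotient.mk_surjective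

lemma piLam_surjective : Function.Surjective (piLam (gr := gr) (P := P) B lam) :=
  Quotient.mk_surjective

lemma rightZero_piPlus (g : levi gr P) (u : B) :
    rightZero gr P B g (piPlus gr P B u) = piPlus gr P B (u <• (g : P)) := rfl

lemma piLam_eq_iff {x y : GZero gr P B} : piLam B lam x = piLam B lam y ↔
    ∃ g : levi gr P, lam.hom g = 1 ∧ rightZero gr P B g x = y := Quotient.eq

/-- `P_+` acts trivially on `𝒢_0`, so equivariance of `σ` makes an element of `G_0 ∩ P_+` fix
`σ(x)`, and the action of `P` is free. The mere existence of a Weyl structure thus gives `G_0 ∩ P_+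
= 1`. -/
lemma WeylStructure.eq_one_of_mem (σ : WeylStructure gr C E0) (x : GZero gr P B) {p : P}
    (hp : p ∈ levi gr P) (hp' : p ∈ unip gr P) : p = 1 := by
  obtain ⟨u, rfl⟩ := piPlus_surjective x
  have h1 := σ.equivariant ⟨p, hp⟩ (piPlus gr P B u)
  rw [rightZero_piPlus, piPlus_act hp'] at h1
  exact C.principal.act_eq_self h1.symm

lemma proj_toFun (σ : WeylStructure gr C E0) (x : GZero gr P B) :
    C.proj (σ.toFun x) = C.projZero gr x := by
  conv_rhs => rw [← σ.isSection x]
  rfl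

lemma baseMap_proj (Φ : C.Aut) (u : B) : baseMap Φ (C.proj u) = C.proj (Φ.toDiffeo u) := by
  obtain ⟨p, hp⟩ := C.principal.exists_act
    (Function.surjInv_eq C.proj_surjective (C.proj u)).symm
  rw [baseMap, ← hp]
  exact (congrArg C.proj (Φ.equivariant p u)).trans (C.principal.proj_act _ p)

/-- The vector field `𝐗`, with values in the model space. -/
def vecB (V : C.Inf) : B → EB := V.field

variable (gr E0) in
/-- The vector field `𝐗_0`, with values in the model space. -/
noncomputable def vecZero (V : C.Inf) : GZero gr P B → E0 := (zeroField gr V : VField E0 _)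

/-- The vector field underlying `𝐗` on `M`, with values in the model space. -/
noncomputable def vecM (V : C.Inf) : M → EM := baseField V

variable (lam E0 EL) in
/-- The vector field `𝐗_λ`, with values in the model space. -/
noncomputable def vecLam (V : C.Inf) : ScaleBundle B lam → EL := lamField lam E0 V

lemma vecB_act (V : C.Inf) (u : B) (p : P) :
    vecB V (u <• p) = md EB EB (fun u : B => u <• p) u (vecB V u) := (V.invariant p u).symm

section Zero

variable (hzero : Manifold.IsSubmersion 𝓘(ℝ, EB) 𝓘(ℝ, E0) ∞ (piPlus gr P B))
include hzero

lemma smoothAt_piPlus (u : B) : SmoothAt EB E0 (piPlus gr P B) u :=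
  (hzero.isSubmersionAt u).contMDiffAt

/-- The chosen representative in `zeroField` is immaterial because `𝐗` is `P`-invariant. -/
lemma vecZero_piPlus (V : C.Inf) (u : B) :
    vecZero gr E0 V (piPlus gr P B u) = md EB E0 (piPlus gr P B) u (vecB V u) := by
  obtain ⟨p, hp, hpu⟩ := piPlus_eq_iff.1
    (Quotient.out_eq (piPlus gr P B u)).symm
  have h1 : vecZero gr E0 V (piPlus gr P B u)
      = md EB E0 (piPlus gr P B) (u <• p) (vecB V (u <• p)) := by
    rw [hpu]
    rfl
  rw [h1, vecB_act, ← md_comp_apply (smoothAt_piPlus hzero _).diffAt (C.principal.smoothAt_act u p).diffAt]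
  refine congrArg (fun f => md EB E0 f u (vecB V u)) (funext fun v => piPlus_act hp)

lemma smoothAt_rightZero (g : levi gr P) (x : GZero gr P B) (C : CartanGeometry EG EP EB EM P B M) :
    SmoothAt E0 E0 (rightZero gr P B g) x := by
  obtain ⟨u, rfl⟩ := piPlus_surjective x
  refine hzero.smoothAt_of_comp (g := rightZero gr P B g) (f := piPlus gr P B) ?_
  exact SmoothAt.comp' (g := piPlus gr P B) (f := fun u : B => u <• (g : P))
    (smoothAt_piPlus hzero _) (C.principal.smoothAt_act u g)

lemma vecZero_rightZero (V : C.Inf) (g : levi gr P) (x : GZero gr P B) :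
    md E0 E0 (rightZero gr P B g) x (vecZero gr E0 V x) = vecZero gr E0 V (rightZero gr P B g x) := by
  obtain ⟨u, rfl⟩ := piPlus_surjective x
  have h1 := vecZero_piPlus hzero V u
  have h2 := vecZero_piPlus hzero V (u <• (g : P))
  rw [rightZero_piPlus, h1, h2, vecB_act, ← md_comp_apply (smoothAt_piPlus hzero _).diffAt (C.principal.smoothAt_act u g).diffAt,
    ← md_comp_apply (smoothAt_rightZero hzero g _ C).diffAt (smoothAt_piPlus hzero _).diffAt]
  rfl

lemma exists_section_piPlus (x : GZero gr P B) :
    ∃ s : GZero gr P B → B, SmoothAt E0 EB s x ∧ ∀ᶠ y in 𝓝 x, piPlus gr P B (s y) = y := by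
  obtain ⟨u, rfl⟩ := piPlus_surjective x
  obtain ⟨s, h1, -, h2⟩ := (hzero.isSubmersionAt u).exists_smooth_section
  exact ⟨s, h1, h2⟩

lemma smoothField_zeroField (V : C.Inf) : SmoothField (zeroField gr V : VField E0 (GZero gr P B)) :=
  smoothField_of_related (smoothAt_piPlus hzero) (exists_section_piPlus hzero) V.smooth
    (vecZero_piPlus hzero V)

variable (C) in
lemma smoothAt_projZero (x : GZero gr P B) : SmoothAt E0 EM (C.projZero gr) x := by
  obtain ⟨u, rfl⟩ := piPlus_surjective x
  exact hzero.smoothAt_of_comp (g := C.projZero gr) (f := piPlus gr P B)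
    (C.principal.smoothAt_proj u)

variable (C) in
lemma md_projZero_piPlus (u : B) (v : EB) :
    md E0 EM (C.projZero gr) (piPlus gr P B u) (md EB E0 (piPlus gr P B) u v)
      = md EB EM C.proj u v := by
  rw [← md_comp_apply (smoothAt_projZero C hzero _).diffAt (smoothAt_piPlus hzero u).diffAt]
  rfl

variable (C) in
lemma md_projZero_surjective (x : GZero gr P B) :
    Function.Surjective (md E0 EM (C.projZero gr) x) := by
  obtain ⟨u, rfl⟩ := piPlus_surjective x
  intro w
  obtain ⟨v, rfl⟩ := C.principal.md_proj_surjective u w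
  exact ⟨_, md_projZero_piPlus C hzero u v⟩

lemma contMDiff_mapZero (Φ : C.Aut) :
    ContMDiff 𝓘(ℝ, E0) 𝓘(ℝ, E0) ∞ (mapZero gr P Φ.toDiffeo Φ.equivariant) := by
  intro x
  obtain ⟨u, rfl⟩ := piPlus_surjective x
  refine hzero.smoothAt_of_comp (f := piPlus gr P B)
    (g := mapZero gr P Φ.toDiffeo Φ.equivariant) ?_
  exact SmoothAt.comp' (g := piPlus gr P B) (f := Φ.toDiffeo) (smoothAt_piPlus hzero _)
    (Φ.toDiffeo.contMDiff u)

lemma contMDiff_mapZero_symm (Φ : C.Aut) :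
    ContMDiff 𝓘(ℝ, E0) 𝓘(ℝ, E0) ∞ (mapZero gr P Φ.toDiffeo.symm Φ.symm_equivariant) := by
  intro x
  obtain ⟨u, rfl⟩ := piPlus_surjective x
  refine hzero.smoothAt_of_comp (f := piPlus gr P B)
    (g := mapZero gr P Φ.toDiffeo.symm Φ.symm_equivariant) ?_
  exact SmoothAt.comp' (g := piPlus gr P B) (f := Φ.toDiffeo.symm) (smoothAt_piPlus hzero _)
    (Φ.toDiffeo.symm.contMDiff u)

end Zero

lemma mapZero_symm_mapZero (Φ : C.Aut) (x : GZero gr P B) :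
    mapZero gr P Φ.toDiffeo.symm Φ.symm_equivariant (zeroMap gr Φ x) = x := by
  obtain ⟨u, rfl⟩ := piPlus_surjective x
  exact congrArg (piPlus gr P B) (Φ.toDiffeo.symm_apply_apply u)

lemma mapZero_mapZero_symm (Φ : C.Aut) (x : GZero gr P B) :
    zeroMap gr Φ (mapZero gr P Φ.toDiffeo.symm Φ.symm_equivariant x) = x := by
  obtain ⟨u, rfl⟩ := piPlus_surjective x
  exact congrArg (piPlus gr P B) (Φ.toDiffeo.apply_symm_apply u)

/-- The diffeomorphism `Φ_0`. -/
noncomputable def zeroDiffeo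
    (hzero : Manifold.IsSubmersion 𝓘(ℝ, EB) 𝓘(ℝ, E0) ∞ (piPlus gr P B)) (Φ : C.Aut) :
    GZero gr P B ≃ₘ^∞⟮𝓘(ℝ, E0), 𝓘(ℝ, E0)⟯ GZero gr P B where
  toFun := zeroMap gr Φ
  invFun := mapZero gr P Φ.toDiffeo.symm Φ.symm_equivariant
  left_inv := mapZero_symm_mapZero Φ
  right_inv := mapZero_mapZero_symm Φ
  contMDiff_toFun := contMDiff_mapZero hzero Φ
  contMDiff_invFun := contMDiff_mapZero_symm hzero Φ

lemma vecM_proj (V : C.Inf) (u : B) :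
    vecM V (C.proj u) = md EB EM C.proj u (vecB V u) := by
  obtain ⟨p, hp⟩ := C.principal.exists_act
    (Function.surjInv_eq C.proj_surjective (C.proj u)).symm
  have h1 : vecM V (C.proj u) = md EB EM C.proj (u <• p) (vecB V (u <• p)) := by
    rw [hp]
    rfl
  rw [h1, vecB_act, ← md_comp_apply (C.principal.smoothAt_proj _).diffAt (C.principal.smoothAt_act u p).diffAt]
  exact congrArg (fun f => md EB EM f u (vecB V u)) (funext fun v => C.principal.proj_act v p)

lemma smoothField_baseField (V : C.Inf) : SmoothField (baseField V : VField EM M) := by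
  refine smoothField_of_related C.principal.smoothAt_proj (fun y => ?_) V.smooth (vecM_proj V)
  obtain ⟨u, rfl⟩ := C.proj_surjective y
  obtain ⟨s, h1, -, h2⟩ := C.principal.exists_section u
  exact ⟨s, h1, h2⟩

section Lam

variable (hzero : Manifold.IsSubmersion 𝓘(ℝ, EB) 𝓘(ℝ, E0) ∞ (piPlus gr P B))
  (hlam : Manifold.IsSubmersion 𝓘(ℝ, E0) 𝓘(ℝ, EL) ∞ (piLam (gr := gr) (P := P) B lam))

include hlam

lemma smoothAt_piLam (x : GZero gr P B) : SmoothAt E0 EL (piLam B lam) x :=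
  (hlam.isSubmersionAt x).contMDiffAt

lemma exists_section_piLam (y : ScaleBundle B lam) :
    ∃ s : ScaleBundle B lam → GZero gr P B,
      SmoothAt EL E0 s y ∧ ∀ᶠ z in 𝓝 y, piLam B lam (s z) = z := by
  obtain ⟨x, rfl⟩ := piLam_surjective y
  obtain ⟨s, h1, -, h2⟩ := (hlam.isSubmersionAt x).exists_smooth_section
  exact ⟨s, h1, h2⟩

-- Likewise the representative in `lamField` is immaterial, since `𝐗_0` is invariant under `Ker λ`.
include hzero in
lemma vecLam_piLam (V : C.Inf) (x : GZero gr P B) :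
    vecLam E0 lam EL V (piLam B lam x) = md E0 EL (piLam B lam) x (vecZero gr E0 V x) := by
  obtain ⟨g, hg, hgx⟩ := piLam_eq_iff.1 (Quotient.out_eq (piLam B lam x)).symm
  have h1 : vecLam E0 lam EL V (piLam B lam x)
      = md E0 EL (piLam B lam) (rightZero gr P B g x) (vecZero gr E0 V (rightZero gr P B g x)) := by
    rw [hgx]
    rfl
  rw [h1, ← vecZero_rightZero hzero, ← md_comp_apply (smoothAt_piLam hlam _).diffAt (smoothAt_rightZero hzero g x C).diffAt]
  exact congrArg (fun f => md E0 EL f x (vecZero gr E0 V x))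
    (funext fun y => (piLam_eq_iff.2 ⟨g, hg, rfl⟩).symm)

include hzero in
lemma smoothField_lamField (V : C.Inf) :
    SmoothField (lamField lam E0 V : VField EL (ScaleBundle B lam)) :=
  smoothField_of_related (smoothAt_piLam hlam) (exists_section_piLam hlam)
    (smoothField_zeroField hzero V) (vecLam_piLam hzero hlam V)

include hzero in
lemma smoothAt_mapLam (Φ : C.Aut) (y : ScaleBundle B lam) :
    SmoothAt EL EL (mapLam lam Φ.toDiffeo Φ.equivariant) y := by
  obtain ⟨x, rfl⟩ := piLam_surjective y
  refine hlam.smoothAt_of_comp (f := piLam B lam) (g := mapLam lam Φ.toDiffeo Φ.equivariant) ?_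
  exact SmoothAt.comp' (g := piLam B lam) (f := mapZero gr P Φ.toDiffeo Φ.equivariant)
    (smoothAt_piLam hlam _) (contMDiff_mapZero hzero Φ x)

end Lam

end Induced

section WeylForms

open Filter Topology Set

variable {EG : Type*} [NormedAddCommGroup EG] [NormedSpace ℝ EG] [FiniteDimensional ℝ EG]
  {G : Type*} [TopologicalSpace G] [ChartedSpace EG G] [Group G] [LieGroup 𝓘(ℝ, EG) ∞ G]
  [LieAlgebra.IsKilling ℝ (GroupLieAlgebra 𝓘(ℝ, EG) G)]
  {k : ℕ} {gr : Grading (GroupLieAlgebra 𝓘(ℝ, EG) G) k}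
  {EP : Type*} [NormedAddCommGroup EP] [NormedSpace ℝ EP]
  {P : Subgroup G} [ChartedSpace EP P] [LieGroup 𝓘(ℝ, EP) ∞ P]
  {EB : Type*} [NormedAddCommGroup EB] [NormedSpace ℝ EB]
  {B : Type*} [TopologicalSpace B] [ChartedSpace EB B] [IsManifold 𝓘(ℝ, EB) ∞ B]
  [MulAction (↥P)ᵐᵒᵖ B]
  {EM : Type*} [NormedAddCommGroup EM] [NormedSpace ℝ EM]
  {M : Type*} [TopologicalSpace M] [ChartedSpace EM M] [IsManifold 𝓘(ℝ, EM) ∞ M]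
  {E0 : Type*} [NormedAddCommGroup E0] [NormedSpace ℝ E0] [ChartedSpace E0 (GZero gr P B)]
  [IsManifold 𝓘(ℝ, E0) ∞ (GZero gr P B)]
  {C : CartanGeometry EG EP EB EM P B M}
  {Z : GroupLieAlgebra 𝓘(ℝ, EG) G} {lam : ScaleRep gr P Z}
  {EL : Type*} [NormedAddCommGroup EL] [NormedSpace ℝ EL] [ChartedSpace EL (ScaleBundle B lam)]
  [IsManifold 𝓘(ℝ, EL) ∞ (ScaleBundle B lam)]
  (σ : WeylStructure gr C E0)
  (hzero : Manifold.IsSubmersion 𝓘(ℝ, EB) 𝓘(ℝ, E0) ∞ (piPlus gr P B))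
  (hlam : Manifold.IsSubmersion 𝓘(ℝ, E0) 𝓘(ℝ, EL) ∞ (piLam (gr := gr) (P := P) B lam))

/-! ### The connection form on the scale bundle -/

lemma WeylStructure.smoothAt (x : GZero gr P B) : SmoothAt E0 EB σ.toFun x := σ.smooth x

variable (Z) in
/-- The pullback `σ^* B(Z, ω)`. -/
noncomputable def weylScale (x : GZero gr P B) : E0 →ₗ[ℝ] ℝ :=
  (C.scaleForm Z (σ.toFun x)).comp (md E0 EB σ.toFun x).toLinearMap

variable (lam) in
/-- The form `λ' ∘ σ^* ω_0`, as a linear map on the model space. -/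
noncomputable def formLam (x : GZero gr P B) : E0 →ₗ[ℝ] ℝ := weylFormLam σ lam x

lemma formLam_eq (hZ : gr.IsScaling Z) : formLam lam σ = weylScale Z σ := by
  funext x
  refine LinearMap.ext fun v => ?_
  exact hZ.killingForm_proj _

-- Equivariance of `σ` and `ω` introduces `Ad g⁻¹`, which preserves the Killing form and, for `g ∈
-- G_0`, fixes `Z`.
include hzero in
lemma weylScale_rightZero (hZ : gr.IsScaling Z) (g : levi gr P) (x : GZero gr P B) (v : E0) :
    weylScale Z σ (rightZero gr P B g x) (md E0 E0 (rightZero gr P B g) x v)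
      = weylScale Z σ x v := by
  have h1 : md E0 EB σ.toFun (rightZero gr P B g x) (md E0 E0 (rightZero gr P B g) x v)
      = md EB EB (fun u : B => u <• (g : P)) (σ.toFun x) (md E0 EB σ.toFun x v) := by
    rw [← md_comp_apply (σ.smoothAt _).diffAt (smoothAt_rightZero hzero g x C).diffAt,
      ← md_comp_apply (g := fun u : B => u <• (g : P)) (C.principal.smoothAt_act _ _).diffAt
        (σ.smoothAt _).diffAt]
    exact congrArg (fun f => md E0 EB f x v) (funext fun y => σ.equivariant g y)
  change C.scaleForm Z (σ.toFun (rightZero gr P B g x)) (md E0 EB σ.toFun (rightZero gr P B g x)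
    (md E0 E0 (rightZero gr P B g) x v)) = C.scaleForm Z (σ.toFun x) (md E0 EB σ.toFun x v)
  rw [h1, σ.equivariant, scaleForm_act]
  have h2 := killingForm_Ad (((g : P)⁻¹ : P) : G) Z (C.om (σ.toFun x) (md E0 EB σ.toFun x v))
  rw [Ad_scaling hZ (inv_mem g.2)] at h2
  exact h2

-- A vector killed by `Tπ_λ` is the velocity of a curve in a `Ker λ`-orbit. On such a curve `λ` is
-- constant, and its derivative is `B(Z, ·)`.
include hlam in
lemma weylScale_eq_zero {x : GZero gr P B} {v : E0} (hP : IsParabolicSubgroup gr P EP)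
    (hv : md E0 EL (piLam B lam) x v = 0) : weylScale Z σ x v = 0 := by
  obtain ⟨c, hc, hc0, hcv, hcm⟩ := (hlam.isSubmersionAt x).exists_lift
    (m := fun _ => piLam B lam x) contMDiffAt_const rfl (v := v) (by rw [md_const, hv]; rfl)
  have hσc : SmoothAt ℝ EB (fun t => σ.toFun (c t)) 0 :=
    SmoothAt.comp' (g := σ.toFun) (σ.smoothAt _) hc
  have hg : ∀ᶠ t in 𝓝 0, ∃ g : levi gr P, lam.hom g = 1 ∧ σ.toFun x <• (g : P) = σ.toFun (c t) := by
    filter_upwards [hcm] with t ht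
    obtain ⟨g, hg, hgx⟩ := piLam_eq_iff.1 ht.symm
    exact ⟨g, hg, by rw [← hgx, σ.equivariant]⟩
  obtain ⟨p, hp, hpc⟩ := C.principal.exists_division (f := fun _ : ℝ => σ.toFun x)
    (g := fun t => σ.toFun (c t)) contMDiffAt_const hσc (by
      filter_upwards [hg] with t ht
      obtain ⟨g, -, hg⟩ := ht
      rw [← hg, C.principal.proj_act])
  have hpx := hpc.self_of_nhds
  have hp0 : p 0 = 1 := C.principal.act_eq_self (by rw [hpx, hc0])
  have hpl : ∀ᶠ t in 𝓝 0, ∃ g : levi gr P, lam.hom g = 1 ∧ (g : P) = p t := by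
    filter_upwards [hg, hpc] with t ht ht'
    obtain ⟨g, hg, hgx⟩ := ht
    exact ⟨g, hg, C.principal.act_injective (hgx.trans ht'.symm)⟩
  classical
  -- `ScaleRep.deriv_hom` requires a curve defined for all times with values in `G_0`. Away from 0
  -- the default value 1 is harmless and keeps `λ ∘ q` identically 1.
  let q : ℝ → levi gr P := fun t => if h : ∃ g : levi gr P, lam.hom g = 1 ∧ (g : P) = p t
    then h.choose else 1
  have hq1 : ∀ t, lam.hom (q t) = 1 := fun t => by
    by_cases h : ∃ g : levi gr P, lam.hom g = 1 ∧ (g : P) = p t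
    · simp only [q, dif_pos h]
      exact h.choose_spec.1
    · simp only [q, dif_neg h, map_one]
  have hqp : ∀ᶠ t in 𝓝 0, (q t : P) = p t := by
    filter_upwards [hpl] with t ht
    simp only [q, dif_pos ht]
    exact ht.choose_spec.2
  have hq0 : q 0 = 1 := by
    have h := hqp.self_of_nhds
    rw [hp0] at h
    exact Subtype.ext h
  have hcoe : SmoothAt EP EG (fun p : P => (p : G)) 1 := hP.embedded.contMDiff 1
  have hpG : SmoothAt ℝ EG (fun t => (p t : G)) 0 :=
    SmoothAt.comp_of_eq' (g := fun p : P => (p : G)) hcoe hp hp0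
  set A : EG := md EP EG (fun p : P => (p : G)) 1 (md ℝ EP p 0 1) with hA
  have hpA : md ℝ EG (fun t => (p t : G)) 0 1 = A :=
    md_comp_apply_of_eq (g := fun p : P => (p : G)) hp0 hcoe.diffAt hp.diffAt 1
  have hqG : (fun t => ((q t : P) : G)) =ᶠ[𝓝 0] fun t => (p t : G) := by
    filter_upwards [hqp] with t ht
    rw [ht]
  have hder := lam.deriv_hom q A hq0 (by
    refine hasMFDerivAt_iff_md.2 ⟨hpG.diffAt.congr hqG, ContinuousLinearMap.ext_ring ?_⟩
    rw [md_congr hqG, hpA]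
    exact (one_smul ℝ A).symm)
  simp only [hq1] at hder
  have hBA := hder.unique (hasDerivAt_const _ _)
  have h1 : md ℝ EB (fun t => σ.toFun (c t)) 0 1 = md E0 EB σ.toFun x v := by
    rw [md_comp_apply_of_eq (g := σ.toFun) hc0 (σ.smoothAt _).diffAt hc.diffAt, hcv]
  have h2 : (fun t => σ.toFun x <• p t) =ᶠ[𝓝 0] fun t => σ.toFun (c t) := hpc
  rw [← md_congr h2, md_comp_apply_of_eq (g := fun q : P => σ.toFun x <• q) hp0
    (C.principal.smoothAt_orbit _ 1).diffAt hp.diffAt] at h1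
  change C.scaleForm Z (σ.toFun x) (md E0 EB σ.toFun x v) = 0
  rw [← h1, scaleForm_fundamental]
  exact hBA

variable (lam EL) in
/-- The connection form on the scale bundle, with values in the dual of the model space. -/
noncomputable def scaleConn : ScaleBundle B lam → EL →ₗ[ℝ] ℝ := scaleConnection (EL := EL) σ lam

-- `scaleConnection` is chosen by `epsilon`, so its defining property depends on the existence of a
-- descended form. The form `σ^* B(Z, ω)` descends because it is invariant under `G_0` and vanishes
-- on the kernel of `Tπ_λ`.
include hzero hlam in
lemma scaleConn_piLam (hP : IsParabolicSubgroup gr P EP) (hZ : gr.IsScaling Z) (x : GZero gr P B)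
    (v : E0) : scaleConn lam EL σ (piLam B lam x) (md E0 EL (piLam B lam) x v)
      = weylScale Z σ x v := by
  have hex : ∃ θ : OneForm EL (ScaleBundle B lam) ℝ,
      pullbackForm (piLam B lam) θ = weylFormLam σ lam := by
    have hinv : ∀ q : ScaleBundle B lam, ∃ S : EL →ₗ[ℝ] E0,
        (md E0 EL (piLam B lam) q.out).toLinearMap ∘ₗ S = LinearMap.id := fun q =>
      LinearMap.exists_rightInverse_of_surjective _ (LinearMap.range_eq_top.2
        (hlam.isSubmersionAt q.out).md_surjective)
    choose S hS using hinv
    -- Evaluate at an arbitrary representative of the orbit on an arbitrary linear lift of the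
    -- tangent vector; `pullbackForm` asks for no smoothness.
    refine ⟨fun q => weylScale Z σ q.out ∘ₗ S q, ?_⟩
    change _ = formLam lam σ
    rw [formLam_eq σ hZ]
    funext x
    refine LinearMap.ext fun (v : E0) => ?_
    obtain ⟨g, hg, hgx⟩ := piLam_eq_iff.1 (Quotient.out_eq (piLam B lam x)).symm
    change weylScale Z σ (piLam B lam x).out (S (piLam B lam x) (md E0 EL (piLam B lam) x v))
      = weylScale Z σ x v
    have h1 : md E0 EL (piLam B lam) (rightZero gr P B g x) (md E0 E0 (rightZero gr P B g) x v)
        = md E0 EL (piLam B lam) x v := by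
      rw [← md_comp_apply (smoothAt_piLam hlam _).diffAt (smoothAt_rightZero hzero g x C).diffAt]
      exact congrArg (fun f => md E0 EL f x v) (funext fun y => (piLam_eq_iff.2 ⟨g, hg, rfl⟩).symm)
    have h2 := LinearMap.congr_fun (hS (piLam B lam x)) (md E0 EL (piLam B lam) x v)
    -- The chosen lift and the translate of `v` have the same image under `Tπ_λ`, so the form does
    -- not distinguish them.
    have h3 : weylScale Z σ (piLam B lam x).out (S (piLam B lam x) (md E0 EL (piLam B lam) x v)
        - md E0 E0 (rightZero gr P B g) x v) = 0 := by
      refine weylScale_eq_zero σ hlam hP ?_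
      rw [map_sub, sub_eq_zero]
      refine h2.trans ?_
      rw [← hgx]
      exact h1.symm
    rw [map_sub, sub_eq_zero] at h3
    rw [h3, ← hgx]
    exact weylScale_rightZero σ hzero hZ g x v
  have h1 : pullbackForm (piLam B lam) (scaleConnection (EL := EL) σ lam) = weylFormLam σ lam :=
    Classical.epsilon_spec hex
  refine (LinearMap.congr_fun (congrFun h1 x) v).trans ?_
  exact LinearMap.congr_fun (congrFun (formLam_eq (lam := lam) σ hZ) x) v

end WeylForms

section PullbackLe

open Filter Topology Set

variable {EG : Type*} [NormedAddCommGroup EG] [NormedSpace ℝ EG] [FiniteDimensional ℝ EG]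
  {G : Type*} [TopologicalSpace G] [T2Space G] [ChartedSpace EG G] [Group G]
  [LieGroup 𝓘(ℝ, EG) ∞ G]
  [LieAlgebra.IsKilling ℝ (GroupLieAlgebra 𝓘(ℝ, EG) G)]
  {k : ℕ} {gr : Grading (GroupLieAlgebra 𝓘(ℝ, EG) G) k}
  {EP : Type*} [NormedAddCommGroup EP] [NormedSpace ℝ EP] [FiniteDimensional ℝ EP]
  {P : Subgroup G} [ChartedSpace EP P] [LieGroup 𝓘(ℝ, EP) ∞ P]
  {EB : Type*} [NormedAddCommGroup EB] [NormedSpace ℝ EB] [FiniteDimensional ℝ EB]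
  {B : Type*} [TopologicalSpace B] [T2Space B] [ChartedSpace EB B] [IsManifold 𝓘(ℝ, EB) ∞ B]
  [MulAction (↥P)ᵐᵒᵖ B]
  {EM : Type*} [NormedAddCommGroup EM] [NormedSpace ℝ EM] [FiniteDimensional ℝ EM]
  {M : Type*} [TopologicalSpace M] [T2Space M] [ChartedSpace EM M] [IsManifold 𝓘(ℝ, EM) ∞ M]
  {C : CartanGeometry EG EP EB EM P B M}
  {E0 : Type*} [NormedAddCommGroup E0] [NormedSpace ℝ E0] [FiniteDimensional ℝ E0]
  [T2Space (GZero gr P B)] [ChartedSpace E0 (GZero gr P B)]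
  [IsManifold 𝓘(ℝ, E0) ∞ (GZero gr P B)]
  {Z : GroupLieAlgebra 𝓘(ℝ, EG) G}
  {N : Type*} {EN : Type*} [NormedAddCommGroup EN] [NormedSpace ℝ EN] [FiniteDimensional ℝ EN]
  [TopologicalSpace N] [ChartedSpace EN N] [IsManifold 𝓘(ℝ, EN) ∞ N]

/-! ### Pullbacks of the components of the Cartan connection of nonpositive degree -/

variable (gr C) in
/-- The pullback of `ω_≤` along a map into `𝒢`. -/
noncomputable def pullLe (f : N → B) (x : N) : EN →ₗ[ℝ] GroupLieAlgebra 𝓘(ℝ, EG) G :=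
  gr.projLe ∘ₗ C.om (f x) ∘ₗ (md EN EB f x).toLinearMap

variable (C Z) in
/-- The pullback of `B(Z, ω)` along a map into `𝒢`. -/
noncomputable def pullScale (f : N → B) (x : N) : EN →ₗ[ℝ] ℝ :=
  (C.scaleForm Z (f x)).comp (md EN EB f x).toLinearMap

/-- This linear functional turns invariance of `f^*ω_≤` into invariance of `f^* B(Z, ω)`, both for
maps and for Lie derivatives. -/
lemma killingForm_pullLe (hZ : gr.IsScaling Z) (f : N → B) (x : N) :
    (killingForm ℝ _ Z ∘ₗ gr.proj 0) ∘ₗ pullLe (EN := EN) gr C f x = pullScale C Z f x := by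
  refine LinearMap.ext fun v => ?_
  refine (congrArg (killingForm ℝ _ Z) (gr.proj_zero_projLe _)).trans ?_
  exact hZ.killingForm_proj _

lemma smoothForm_pullLe {f : N → B} (hf : ContMDiff 𝓘(ℝ, EN) 𝓘(ℝ, EB) ∞ f) :
    SmoothForm (E := EN) (X := N) (pullLe (EN := EN) gr C f) :=
  (SmoothForm.comp_linear C.smooth_form gr.projLe).pullback hf

/-! ### Automorphisms -/

lemma om_aut (Φ : C.Aut) (u : B) (v : EB) :
    C.om (Φ.toDiffeo u) (md EB EB Φ.toDiffeo u v) = C.om u v :=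
  LinearMap.congr_fun (congrFun Φ.preserves u) v

lemma SmoothAt.aut (Φ : C.Aut) (u : B) : SmoothAt EB EB Φ.toDiffeo u := Φ.toDiffeo.contMDiff u

lemma SmoothAt.aut_symm (Φ : C.Aut) (u : B) : SmoothAt EB EB Φ.toDiffeo.symm u :=
  Φ.toDiffeo.symm.contMDiff u

lemma om_aut_symm (Φ : C.Aut) (u : B) (v : EB) :
    C.om (Φ.toDiffeo.symm u) (md EB EB Φ.toDiffeo.symm u v) = C.om u v := by
  have h1 := om_aut Φ (Φ.toDiffeo.symm u) (md EB EB Φ.toDiffeo.symm u v)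
  rw [← md_comp_apply (g := Φ.toDiffeo) (SmoothAt.aut Φ _).diffAt
    (SmoothAt.aut_symm Φ u).diffAt] at h1
  have h2 : (fun y => Φ.toDiffeo (Φ.toDiffeo.symm y)) = fun y => y :=
    funext fun y => Φ.toDiffeo.apply_symm_apply y
  rw [h2, md_id, Φ.toDiffeo.apply_symm_apply] at h1
  exact h1.symm

lemma pullLe_aut (Φ : C.Aut) {f : N → B} {H : N → N} (hf : ∀ x, SmoothAt EN EB f x)
    (hH : ∀ x, SmoothAt EN EN H x) (hfH : ∀ x, f (H x) = Φ.toDiffeo (f x)) (x : N) (v : EN) :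
    pullLe gr C f (H x) (md EN EN H x v) = pullLe gr C f x v := by
  have h1 : C.om (f (H x)) (md EN EB f (H x) (md EN EN H x v)) = C.om (f x) (md EN EB f x v) := by
    rw [← md_comp_apply (hf _).diffAt (hH x).diffAt, funext hfH, hfH,
      md_comp_apply (SmoothAt.aut Φ _).diffAt (hf x).diffAt, om_aut]
  exact congrArg gr.projLe h1

lemma pullScale_of_pullLe (hZ : gr.IsScaling Z) {f : N → B} {H : N → N} {x : N} {v : EN}
    (h : pullLe gr C f (H x) (md EN EN H x v) = pullLe gr C f x v) :
    pullScale C Z f (H x) (md EN EN H x v) = pullScale C Z f x v := by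
  rw [← killingForm_pullLe hZ f, ← killingForm_pullLe hZ f]
  exact congrArg (killingForm ℝ _ Z ∘ₗ gr.proj 0) h

/-- A bundle map covered by an automorphism and preserving the pullback of `B(Z, ω)` commutes
with the given map into `𝒢`. -/
lemma eq_aut_of_pullScale (hP : IsParabolicSubgroup gr P EP) (hZ : gr.IsScaling Z)
    (hlu : ∀ p ∈ levi gr P, p ∈ unip gr P → p = 1) (Φ : C.Aut) {f : N → B} {H : N → N}
    (hf : ∀ x, SmoothAt EN EB f x) (hH : ∀ x, SmoothAt EN EN H x)
    (hfH : ∀ x, piPlus gr P B (f (H x)) = zeroMap gr Φ (piPlus gr P B (f x))) (x : N)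
    (hs : Function.Surjective (md EN EM (fun y => C.proj (f y)) x))
    (hθ : ∀ v, pullScale C Z f (H x) (md EN EN H x v) = pullScale C Z f x v) :
    Φ.toDiffeo.symm (f (H x)) = f x := by
  have hfHs : ∀ x, SmoothAt EN EB (fun y => f (H y)) x := fun x => (hf _).comp' (hH x)
  -- Compare `f` with `Φ⁻¹ ∘ f ∘ H`: they agree over `𝒢_0`, and `Φ` preserves `B(Z, ω)`.
  refine eq_of_scaleForm_eq (gr := gr) (g := fun y => Φ.toDiffeo.symm (f (H y))) hP hZ hlu (hf x)
    (SmoothAt.comp' (SmoothAt.aut_symm Φ _) (hfHs x)) (Eventually.of_forall fun y => ?_) hs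
    fun v => ?_
  · have h1 := mapZero_symm_mapZero (gr := gr) Φ (piPlus gr P B (f y))
    rw [← hfH] at h1
    exact h1.symm
  · rw [md_comp_apply (SmoothAt.aut_symm Φ _).diffAt (hfHs x).diffAt]
    refine (hθ v).symm.trans ?_
    refine congrArg (killingForm ℝ _ Z) ?_
    have h1 := om_aut_symm Φ (f (H x)) (md EN EB (fun y => f (H y)) x v)
    rw [md_comp_apply (hf _).diffAt (hH x).diffAt] at h1 ⊢
    exact h1.symm

/-! ### Infinitesimal automorphisms -/

lemma lieForm_inf (V : C.Inf) (l : GroupLieAlgebra 𝓘(ℝ, EG) G →ₗ[ℝ] ℝ) (u : B) (v : EB) :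
    lieForm (vecB V) (fun u => l ∘ₗ C.om u) u v = 0 :=
  (lieDerivFormZero_iff C.om C.smooth_form).1 V.lie l u v

/-- When `f` relates `W` to `𝐗` the defect `D` is zero, so the Lie derivative commutes with the
pullback, and `L_𝐗 ω = 0`. -/
lemma lieDerivFormZero_pullLe (V : C.Inf) {f : N → B} (hf : ContMDiff 𝓘(ℝ, EN) 𝓘(ℝ, EB) ∞ f)
    {W : N → EN} (hW : SmoothField (E := EN) (X := N) W)
    (h : ∀ x, md EN EB f x (W x) = vecB V (f x)) :
    LieDerivFormZero (E := EN) (X := N) W (pullLe (EN := EN) gr C f) := by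
  refine (lieDerivFormZero_iff _ (smoothForm_pullLe hf)).2 fun l x v => ?_
  have h1 : SmoothScalar (E := EB) (X := B) (fun u => (l ∘ₗ gr.projLe) ∘ₗ C.om u) :=
    C.smooth_form (l ∘ₗ gr.projLe)
  have h2 := lieForm_pullback (hf x) h1 (V := vecB V) (V.smooth (f x)) (hW x)
    (Eventually.of_forall fun y => by rw [h, sub_self, map_zero]) v
  rw [h, sub_self, lieForm_inf] at h2
  refine Eq.trans h2 ?_
  simp [dForm]

lemma lieForm_pullScale (hZ : gr.IsScaling Z) {f : N → B}
    (hf : ContMDiff 𝓘(ℝ, EN) 𝓘(ℝ, EB) ∞ f) {W : N → EN}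
    (h : LieDerivFormZero (E := EN) (X := N) W (pullLe (EN := EN) gr C f)) (x : N) (v : EN) :
    lieForm W (pullScale C Z f) x v = 0 := by
  have h1 := (lieDerivFormZero_iff _ (smoothForm_pullLe hf)).1 h
    (killingForm ℝ _ Z ∘ₗ gr.proj 0) x v
  rwa [funext (killingForm_pullLe (C := C) (EN := EN) hZ f)] at h1

/-- Over `𝒢_0` the map `f` relates `W` to `𝐗_0`, so the defect is tangent to the fibres of `π_+`;
invariance of the single form `f^* B(Z, ω)` then removes it. -/
lemma eq_inf_of_lieForm (hP : IsParabolicSubgroup gr P EP) (hZ : gr.IsScaling Z)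
    (hzero : Manifold.IsSubmersion 𝓘(ℝ, EB) 𝓘(ℝ, E0) ∞ (piPlus gr P B)) (V : C.Inf)
    {f : N → B} (hf : ContMDiff 𝓘(ℝ, EN) 𝓘(ℝ, EB) ∞ f) {W : N → EN} (hW : SmoothField (E := EN) (X := N) W)
    (hVW : ∀ y, md EN E0 (fun y => piPlus gr P B (f y)) y (W y)
      = vecZero gr E0 V (piPlus gr P B (f y))) (x : N)
    (hs : Function.Surjective (md EN EM (fun y => C.proj (f y)) x))
    (hθ : ∀ v, lieForm W (pullScale C Z f) x v = 0) :
    md EN EB f x (W x) = vecB V (f x) := by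
  refine eq_of_lieForm_eq hP hZ hzero (hf x) (V.smooth (f x)) (hW x)
    (Eventually.of_forall fun y => ?_) hs (fun w => lieForm_inf V _ _ w) hθ
  have h1 := hVW y
  rw [vecZero_piPlus hzero, md_comp_apply (smoothAt_piPlus hzero _).diffAt
    (SmoothAt.diffAt (hf y))] at h1
  rw [map_sub, h1, sub_self]

end PullbackLe

section WeylAutomorphisms

open Filter Topology Set

variable {EG : Type*} [NormedAddCommGroup EG] [NormedSpace ℝ EG] [FiniteDimensional ℝ EG]
  {G : Type*} [TopologicalSpace G] [T2Space G] [ChartedSpace EG G] [Group G]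
  [LieGroup 𝓘(ℝ, EG) ∞ G]
  [LieAlgebra.IsKilling ℝ (GroupLieAlgebra 𝓘(ℝ, EG) G)]
  {k : ℕ} {gr : Grading (GroupLieAlgebra 𝓘(ℝ, EG) G) k}
  {EP : Type*} [NormedAddCommGroup EP] [NormedSpace ℝ EP] [FiniteDimensional ℝ EP]
  {P : Subgroup G} [ChartedSpace EP P] [LieGroup 𝓘(ℝ, EP) ∞ P]
  {EB : Type*} [NormedAddCommGroup EB] [NormedSpace ℝ EB] [FiniteDimensional ℝ EB]
  {B : Type*} [TopologicalSpace B] [T2Space B] [ChartedSpace EB B] [IsManifold 𝓘(ℝ, EB) ∞ B]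
  [MulAction (↥P)ᵐᵒᵖ B]
  {EM : Type*} [NormedAddCommGroup EM] [NormedSpace ℝ EM] [FiniteDimensional ℝ EM]
  {M : Type*} [TopologicalSpace M] [T2Space M] [ChartedSpace EM M] [IsManifold 𝓘(ℝ, EM) ∞ M]
  {C : CartanGeometry EG EP EB EM P B M}
  {E0 : Type*} [NormedAddCommGroup E0] [NormedSpace ℝ E0] [FiniteDimensional ℝ E0]
  [T2Space (GZero gr P B)] [ChartedSpace E0 (GZero gr P B)]
  [IsManifold 𝓘(ℝ, E0) ∞ (GZero gr P B)]
  {Z : GroupLieAlgebra 𝓘(ℝ, EG) G} {lam : ScaleRep gr P Z}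
  {EL : Type*} [NormedAddCommGroup EL] [NormedSpace ℝ EL] [FiniteDimensional ℝ EL]
  [T2Space (ScaleBundle B lam)] [ChartedSpace EL (ScaleBundle B lam)]
  [IsManifold 𝓘(ℝ, EL) ∞ (ScaleBundle B lam)]
  (σ : WeylStructure gr C E0)
  (hzero : Manifold.IsSubmersion 𝓘(ℝ, EB) 𝓘(ℝ, E0) ∞ (piPlus gr P B))
  (hlam : Manifold.IsSubmersion 𝓘(ℝ, E0) 𝓘(ℝ, EL) ∞ (piLam (gr := gr) (P := P) B lam))

/-! ### Automorphisms of Weyl structures -/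

lemma WeylStructure.levi_inter_unip [Nonempty B] (σ : WeylStructure gr C E0) (p : P) (hp : p ∈ levi gr P)
    (hp' : p ∈ unip gr P) : p = 1 :=
  σ.eq_one_of_mem (piPlus gr P B (Classical.arbitrary B)) hp hp'

include hzero in
lemma md_proj_toFun_surjective (x : GZero gr P B) :
    Function.Surjective (md E0 EM (fun y => C.proj (σ.toFun y)) x) := by
  rw [funext (proj_toFun σ)]
  exact md_projZero_surjective C hzero x

include hzero in
lemma smoothAt_zeroMap (Φ : C.Aut) (x : GZero gr P B) : SmoothAt E0 E0 (zeroMap gr Φ) x :=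
  contMDiff_mapZero hzero Φ x

include hzero hlam in
lemma scaleConn_mapLam (hP : IsParabolicSubgroup gr P EP) (hZ : gr.IsScaling Z) (Φ : C.Aut)
    (x : GZero gr P B) (v : E0) :
    scaleConn lam EL σ (mapLam lam Φ.toDiffeo Φ.equivariant (piLam B lam x))
      (md EL EL (mapLam lam Φ.toDiffeo Φ.equivariant) (piLam B lam x) (md E0 EL (piLam B lam) x v))
      = weylScale Z σ (zeroMap gr Φ x) (md E0 E0 (zeroMap gr Φ) x v) := by
  rw [← scaleConn_piLam σ hzero hlam hP hZ,
    ← md_comp_apply (smoothAt_mapLam hzero hlam Φ _).diffAt (smoothAt_piLam hlam x).diffAt,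
    ← md_comp_apply (smoothAt_piLam hlam _).diffAt (smoothAt_zeroMap hzero Φ x).diffAt]
  rfl

/-- An automorphism of `σ` preserves `σ^*ω_≤` because `Φ` preserves `ω`; taking the `λ'`-component
and descending along `π_λ` gives invariance of `σ^λ`; pulled back to `𝒢_0`, that invariance is the
input of the uniqueness theorem for `σ`. -/
theorem weylAut_tfae (hP : IsParabolicSubgroup gr P EP) (hZ : gr.IsScaling Z)
    (hzero : Manifold.IsSubmersion 𝓘(ℝ, EB) 𝓘(ℝ, E0) ∞ (piPlus gr P B))
    (hlam : Manifold.IsSubmersion 𝓘(ℝ, E0) 𝓘(ℝ, EL) ∞ (piLam (gr := gr) (P := P) B lam))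
    (Φ : C.Aut) : List.TFAE
      [IsWeylAut σ Φ,
       ∃ Ψ : GeomAut (rightZero gr P B) (weylFormLe σ), ∀ x, Ψ.toDiffeo x = zeroMap gr Φ x,
       pullbackForm (mapLam lam Φ.toDiffeo Φ.equivariant) (scaleConnection (EL := EL) σ lam)
        = scaleConnection (EL := EL) σ lam] := by
  tfae_have 1 → 2 := fun h => by
    have h1 : ∀ x, σ.toFun (zeroMap gr Φ x) = Φ.toDiffeo (σ.toFun x) := fun x => by
      rw [← congrFun h x]
      exact (Φ.toDiffeo.apply_symm_apply _).symm
    refine ⟨⟨zeroDiffeo hzero Φ, mapZero_rightZero gr P Φ.toDiffeo Φ.equivariant, ?_⟩,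
      fun x => rfl⟩
    funext x
    refine LinearMap.ext fun (v : E0) => ?_
    exact pullLe_aut (gr := gr) Φ σ.smoothAt (smoothAt_zeroMap hzero Φ) h1 x v
  tfae_have 2 → 3 := fun ⟨Ψ, hΨ⟩ => by
    have h1 : ⇑Ψ.toDiffeo = zeroMap gr Φ := funext hΨ
    funext y
    obtain ⟨x, rfl⟩ := piLam_surjective y
    refine LinearMap.ext fun (w : EL) => ?_
    obtain ⟨v, rfl⟩ := (hlam.isSubmersionAt x).md_surjective w
    refine (scaleConn_mapLam σ hzero hlam hP hZ Φ x v).trans ?_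
    refine Eq.trans ?_ (scaleConn_piLam σ hzero hlam hP hZ x v).symm
    have h2 := LinearMap.congr_fun (congrFun Ψ.preserves x) v
    rw [h1] at h2
    exact pullScale_of_pullLe (gr := gr) (C := C) hZ (f := σ.toFun) h2
  tfae_have 3 → 1 := fun h => by
    funext x
    -- A point of `𝒢` is needed to derive `G_0 ∩ P_+ = 1` from the section.
    have : Nonempty B := ⟨σ.toFun x⟩
    refine eq_aut_of_pullScale (gr := gr) hP hZ σ.levi_inter_unip Φ σ.smoothAt
      (smoothAt_zeroMap hzero Φ) (fun y => by rw [σ.isSection, σ.isSection]) x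
      (md_proj_toFun_surjective σ hzero x) fun v => ?_
    have h1 := LinearMap.congr_fun (congrFun h (piLam B lam x)) (md E0 EL (piLam B lam) x v)
    exact (scaleConn_mapLam σ hzero hlam hP hZ Φ x v).symm.trans
      (h1.trans (scaleConn_piLam σ hzero hlam hP hZ x v))
  tfae_finish

include hzero in
lemma isWeylInf_iff (V : C.Inf) :
    IsWeylInf σ V ↔ ∀ x, md E0 EB σ.toFun x (vecZero gr E0 V x) = vecB V (σ.toFun x) :=
  forall_congr' fun x => hasMFDerivAt_flow_iff (smoothField_zeroField hzero V) V.smooth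
    (σ.smoothAt x).diffAt

-- The flow condition says that `σ` relates `𝐗_0` to `𝐗`. Invariance of `σ^*ω_≤` then follows by
-- pullback, and conversely its `λ'`-component suffices to remove the defect.
include hzero in
theorem weylInf_iff (hP : IsParabolicSubgroup gr P EP) (hZ : gr.IsScaling Z) (V : C.Inf) :
    IsWeylInf σ V ↔
      ∃ W : InfAut (rightZero gr P B) (weylFormLe σ), ∀ x, W.field x = zeroField gr V x := by
  rw [isWeylInf_iff σ hzero]
  constructor
  · intro h
    exact ⟨⟨zeroField gr V, smoothField_zeroField hzero V, vecZero_rightZero hzero V,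
      lieDerivFormZero_pullLe (gr := gr) V σ.smooth (smoothField_zeroField hzero V) h⟩,
      fun x => rfl⟩
  · rintro ⟨W, hW⟩ x
    have h1 : W.field = zeroField gr V := funext hW
    have h2 := W.lie
    rw [h1] at h2
    refine eq_inf_of_lieForm hP hZ hzero V σ.smooth (smoothField_zeroField hzero V) (fun y => ?_) x
      (md_proj_toFun_surjective σ hzero x)
      (lieForm_pullScale (gr := gr) hZ σ.smooth h2 x)
    rw [funext σ.isSection, md_id, σ.isSection]
    rfl

end WeylAutomorphisms

/-! ### Restriction of vector fields to immersed submanifolds -/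

section Immersed

open Filter Topology Set

variable {E : Type*} [NormedAddCommGroup E] [NormedSpace ℝ E]
  {E' : Type*} [NormedAddCommGroup E'] [NormedSpace ℝ E']
  {X : Type*} [TopologicalSpace X] [ChartedSpace E X] [IsManifold 𝓘(ℝ, E) ∞ X]
  {Y : Type*} [TopologicalSpace Y] [ChartedSpace E' Y] [IsManifold 𝓘(ℝ, E') ∞ Y]

/-- The restriction of a smooth vector field to an immersed submanifold to which it is tangent is
smooth. -/
lemma smoothField_of_immersion {f : X → Y} (hf : Manifold.IsImmersion 𝓘(ℝ, E) 𝓘(ℝ, E') ∞ f)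
    {V : Y → E'} (hV : SmoothField (E := E') (X := Y) V) {W : X → E}
    (h : ∀ x, md E E' f x (W x) = V (f x)) : SmoothField (E := E) (X := X) W := by
  have hfs : ∀ x, SmoothAt E E' f x := fun x => (hf.isImmersionAt x).contMDiffAt
  intro x
  -- With a local left inverse `r` of `f`, the field is `W = Tr ∘ V ∘ f` near `x`, a visibly smooth
  -- expression.
  obtain ⟨r, hr, hrf⟩ := (hf.isImmersionAt x).exists_left_inverse
  have h1 : SmoothAlong E' E' (fun y => y) V (f x) := hV _
  have h2 : SmoothAlong E E (fun y => r (f y)) (fun y => md E' E r (f y) (V (f y))) x :=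
    (h1.md hr).comp (hfs x) rfl
  refine ContMDiffAt.congr_of_eventuallyEq h2 ?_
  filter_upwards [eventually_eventually_nhds.2 hrf,
    (hfs x).continuousAt.eventually hr.eventually_diffAt] with y hy hy'
  have h3 : (fun z => r (f z)) =ᶠ[𝓝 y] fun z => z := hy
  have h4 : md E' E r (f y) (V (f y)) = W y := by
    rw [← h, ← md_comp_apply hy' (hfs y).diffAt, md_congr h3, md_id]
    rfl
  have h5 : r (f y) = y := hy.self_of_nhds
  change (⟨y, W y⟩ : TangentBundle 𝓘(ℝ, E) X) = ⟨r (f y), md E' E r (f y) (V (f y))⟩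
  rw [h4, h5]

lemma lieForm_zero [FiniteDimensional ℝ E] (W : X → E) (x : X) (v : E) :
    lieForm W (fun _ => 0) x v = 0 := by
  have h : formChart (chartAt E x) (fun _ : X => (0 : E →ₗ[ℝ] ℝ)) = fun _ => 0 := by
    funext y
    exact ContinuousLinearMap.ext fun w => rfl
  rw [lieForm, h]
  simp

end Immersed

section ExactAutomorphisms

open Filter Topology Set

variable {EG : Type*} [NormedAddCommGroup EG] [NormedSpace ℝ EG] [FiniteDimensional ℝ EG]
  {G : Type*} [TopologicalSpace G] [T2Space G] [ChartedSpace EG G] [Group G]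
  [LieGroup 𝓘(ℝ, EG) ∞ G]
  [LieAlgebra.IsKilling ℝ (GroupLieAlgebra 𝓘(ℝ, EG) G)]
  {k : ℕ} {gr : Grading (GroupLieAlgebra 𝓘(ℝ, EG) G) k}
  {EP : Type*} [NormedAddCommGroup EP] [NormedSpace ℝ EP] [FiniteDimensional ℝ EP]
  {P : Subgroup G} [ChartedSpace EP P] [LieGroup 𝓘(ℝ, EP) ∞ P]
  {EB : Type*} [NormedAddCommGroup EB] [NormedSpace ℝ EB] [FiniteDimensional ℝ EB]
  {B : Type*} [TopologicalSpace B] [T2Space B] [ChartedSpace EB B] [IsManifold 𝓘(ℝ, EB) ∞ B]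
  [MulAction (↥P)ᵐᵒᵖ B]
  {EM : Type*} [NormedAddCommGroup EM] [NormedSpace ℝ EM] [FiniteDimensional ℝ EM]
  {M : Type*} [TopologicalSpace M] [T2Space M] [ChartedSpace EM M] [IsManifold 𝓘(ℝ, EM) ∞ M]
  {C : CartanGeometry EG EP EB EM P B M}
  {E0 : Type*} [NormedAddCommGroup E0] [NormedSpace ℝ E0] [FiniteDimensional ℝ E0]
  [T2Space (GZero gr P B)] [ChartedSpace E0 (GZero gr P B)]
  [IsManifold 𝓘(ℝ, E0) ∞ (GZero gr P B)]
  {Z : GroupLieAlgebra 𝓘(ℝ, EG) G} {lam : ScaleRep gr P Z}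
  {EL : Type*} [NormedAddCommGroup EL] [NormedSpace ℝ EL] [FiniteDimensional ℝ EL]
  [T2Space (ScaleBundle B lam)] [ChartedSpace EL (ScaleBundle B lam)]
  [IsManifold 𝓘(ℝ, EL) ∞ (ScaleBundle B lam)]
  {s : Scale C lam EL}

/-! ### Scales -/

lemma Scale.smoothAt (s : Scale C lam EL) (m : M) : SmoothAt EM EL s.toFun m := s.smooth m

lemma projLam_piLam (x : GZero gr P B) : C.projLam lam (piLam B lam x) = C.projZero gr x := rfl

lemma mem_reduction_iff {x : GZero gr P B} :
    x ∈ reduction s ↔ piLam B lam x = s.toFun (C.projZero gr x) := by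
  constructor
  · rintro ⟨m, hm⟩
    rw [← projLam_piLam (lam := lam), ← hm, s.isSection]
  · intro h
    exact ⟨_, h.symm⟩

lemma exists_mem_reduction (s : Scale C lam EL) (m : M) :
    ∃ x : reduction s, C.projZero gr (x : GZero gr P B) = m := by
  obtain ⟨y, hy⟩ := piLam_surjective (s.toFun m)
  exact ⟨⟨y, m, hy.symm⟩, by rw [← projLam_piLam (lam := lam), hy, s.isSection]⟩

lemma piLam_zeroMap (Φ : C.Aut) (x : GZero gr P B) :
    piLam B lam (zeroMap gr Φ x) = mapLam lam Φ.toDiffeo Φ.equivariant (piLam B lam x) := rfl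

lemma mapLam_symm_mapLam (Φ : C.Aut) (y : ScaleBundle B lam) :
    mapLam lam Φ.toDiffeo.symm Φ.symm_equivariant (mapLam lam Φ.toDiffeo Φ.equivariant y) = y := by
  obtain ⟨x, rfl⟩ := piLam_surjective y
  exact congrArg (piLam B lam) (mapZero_symm_mapZero Φ x)

lemma mapLam_mapLam_symm (Φ : C.Aut) (y : ScaleBundle B lam) :
    mapLam lam Φ.toDiffeo Φ.equivariant (mapLam lam Φ.toDiffeo.symm Φ.symm_equivariant y) = y := by
  obtain ⟨x, rfl⟩ := piLam_surjective y
  exact congrArg (piLam B lam) (mapZero_mapZero_symm Φ x)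

lemma baseMap_projZero (Φ : C.Aut) (x : GZero gr P B) :
    baseMap Φ (C.projZero gr x) = C.projZero gr (zeroMap gr Φ x) := by
  obtain ⟨u, rfl⟩ := piPlus_surjective x
  exact baseMap_proj Φ u

lemma isExactAut_iff (Φ : C.Aut) : IsExactAut s Φ ↔
    ∀ m, mapLam lam Φ.toDiffeo Φ.equivariant (s.toFun m) = s.toFun (baseMap Φ m) := by
  constructor
  · intro h m
    rw [← congrFun h m]
    exact mapLam_mapLam_symm Φ _
  · intro h
    funext m
    exact (congrArg _ (h m).symm).trans (mapLam_symm_mapLam Φ _)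

lemma zeroMap_mem_reduction {Φ : C.Aut} (h : IsExactAut s Φ) {x : GZero gr P B}
    (hx : x ∈ reduction s) : zeroMap gr Φ x ∈ reduction s := by
  rw [mem_reduction_iff] at hx ⊢
  rw [piLam_zeroMap, hx, (isExactAut_iff Φ).1 h, baseMap_projZero]

lemma mapZero_symm_mem_reduction {Φ : C.Aut} (h : IsExactAut s Φ) {y : GZero gr P B}
    (hy : y ∈ reduction s) : mapZero gr P Φ.toDiffeo.symm Φ.symm_equivariant y ∈ reduction s := by
  have h1 := mapZero_mapZero_symm Φ y
  rw [mem_reduction_iff] at hy ⊢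
  set x := mapZero gr P Φ.toDiffeo.symm Φ.symm_equivariant y
  rw [← h1, ← baseMap_projZero, ← (isExactAut_iff Φ).1 h, piLam_zeroMap] at hy
  have h2 := congrArg (mapLam lam Φ.toDiffeo.symm Φ.symm_equivariant) hy
  rwa [mapLam_symm_mapLam, mapLam_symm_mapLam] at h2

/-- The reduction has a point over every `m`, and its points over `m` project to `s(m)`; so the
invariance of the reduction determines the image of `s` pointwise. -/
lemma isExactAut_of_mapsTo {Φ : C.Aut}
    (h : Set.MapsTo (zeroMap gr Φ) (reduction s) (reduction s)) : IsExactAut s Φ := by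
  refine (isExactAut_iff Φ).2 fun m => ?_
  obtain ⟨⟨x, hx⟩, rfl⟩ := exists_mem_reduction s m
  rw [← mem_reduction_iff.1 hx, ← piLam_zeroMap, mem_reduction_iff.1 (h hx), baseMap_projZero]

/-! ### The reduction defined by a scale -/

lemma rightLam_one (y : ScaleBundle B lam) : rightLam B lam 1 y = y := by
  obtain ⟨x, rfl⟩ := piLam_surjective y
  exact congrArg (piLam B lam) (rightZero_one gr P B x)

/-- The instance `g = 1` of exactness: `s` itself is horizontal for `σ^λ`. -/
lemma scaleConn_scale {σ : WeylStructure gr C E0} (hs : IsExactWith σ lam s) (m : M) (w : EM) :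
    scaleConn lam EL σ (s.toFun m) (md EM EL s.toFun m w) = 0 := by
  have h1 : (fun y => rightLam B lam 1 (s.toFun y)) = s.toFun := funext fun y => rightLam_one _
  have h2 := hs 1 m w
  rw [h1] at h2
  exact h2

variable {ER : Type*} [NormedAddCommGroup ER] [NormedSpace ℝ ER] [FiniteDimensional ℝ ER]
  [ChartedSpace ER (reduction s)] [IsManifold 𝓘(ℝ, ER) ∞ (reduction s)]
  (σ : WeylStructure gr C E0)
  (hzero : Manifold.IsSubmersion 𝓘(ℝ, EB) 𝓘(ℝ, E0) ∞ (piPlus gr P B))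
  (hlam : Manifold.IsSubmersion 𝓘(ℝ, E0) 𝓘(ℝ, EL) ∞ (piLam (gr := gr) (P := P) B lam))

variable (s) in
/-- The inclusion of the reduction. -/
abbrev incl (x : reduction s) : GZero gr P B := x

variable (hi : Manifold.IsSmoothEmbedding 𝓘(ℝ, ER) 𝓘(ℝ, E0) ∞ (incl s))

include hi in
lemma smoothAt_incl (x : reduction s) : SmoothAt ER E0 (incl s) x := hi.contMDiff x

lemma piLam_incl (x : reduction s) : piLam B lam (incl s x) = s.toFun (C.projZero gr (incl s x)) :=
  mem_reduction_iff.1 x.2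

include hzero hlam hi in
lemma md_piLam_incl (x : reduction s) (v : ER) :
    md E0 EL (piLam B lam) (incl s x) (md ER E0 (incl s) x v)
      = md EM EL s.toFun (C.projZero gr (incl s x))
        (md E0 EM (C.projZero gr) (incl s x) (md ER E0 (incl s) x v)) := by
  rw [← md_comp_apply (smoothAt_projZero C hzero _).diffAt (smoothAt_incl hi x).diffAt,
    ← md_comp_apply (g := s.toFun) (f := fun x => C.projZero gr (incl s x)) (s.smoothAt _).diffAt
      (SmoothAt.comp' (smoothAt_projZero C hzero _) (smoothAt_incl hi x)).diffAt,
    ← md_comp_apply (smoothAt_piLam hlam _).diffAt (smoothAt_incl hi x).diffAt]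
  exact congrArg (fun f => md ER EL f x v) (funext piLam_incl)

include hi in
lemma smoothAt_toFun_incl (x : reduction s) : SmoothAt ER EB (fun x => σ.toFun (incl s x)) x :=
  (σ.smoothAt _).comp' (smoothAt_incl hi x)

include hzero hlam hi in
/-- The pullback of the Weyl connection form to the reduction vanishes. -/
lemma pullScale_incl (hP : IsParabolicSubgroup gr P EP) (hZ : gr.IsScaling Z)
    (hs : IsExactWith σ lam s) (x : reduction s) :
    pullScale (EN := ER) C Z (fun x => σ.toFun (incl s x)) x = 0 := by
  refine LinearMap.ext fun v => ?_
  change C.scaleForm Z (σ.toFun (incl s x)) (md ER EB (fun x => σ.toFun (incl s x)) x v) = 0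
  rw [md_comp_apply (σ.smoothAt _).diffAt (smoothAt_incl hi x).diffAt]
  refine (scaleConn_piLam σ hzero hlam hP hZ (incl s x) (md ER E0 (incl s) x v)).symm.trans ?_
  rw [md_piLam_incl hzero hlam hi, piLam_incl]
  exact scaleConn_scale hs _ _

include hlam hi in
/-- The tangent spaces of the reduction. -/
lemma exists_md_incl (x : reduction s) {v : E0} {w : EM}
    (h : md E0 EL (piLam B lam) (incl s x) v = md EM EL s.toFun (C.projZero gr (incl s x)) w) :
    ∃ u : ER, md ER E0 (incl s) x u = v := by
  -- Lift the curve `s ∘ γ` through `π_λ` with initial velocity `v`; near 0 the lift stays in the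
  -- reduction.
  obtain ⟨γ, hγ, hγ0, hγw⟩ := exists_curve (C.projZero gr (incl s x)) w
  have hsγ : SmoothAt ℝ EL (fun t => s.toFun (γ t)) 0 := (s.smoothAt _).comp' hγ
  obtain ⟨c, hc, hc0, hcv, hcm⟩ := (hlam.isSubmersionAt (incl s x)).exists_lift hsγ
    (by rw [hγ0, piLam_incl]) (v := v) (by
      rw [md_comp_apply_of_eq hγ0 (s.smoothAt _).diffAt hγ.diffAt, hγw, h])
  classical
  -- Away from 0 the lift may leave the reduction; the default `x` is used there, and smoothness
  -- matters only near 0.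
  let d : ℝ → reduction s := fun t => if h : c t ∈ reduction s then ⟨c t, h⟩ else x
  have hd : (fun t => incl s (d t)) =ᶠ[𝓝 0] c := by
    filter_upwards [hcm] with t ht
    have h1 : c t ∈ reduction s := ⟨γ t, ht.symm⟩
    simp only [d, dif_pos h1]
  have hd0 : d 0 = x := Subtype.ext (hd.self_of_nhds.trans hc0)
  have hds : SmoothAt ℝ ER d 0 := hi.smoothAt_of_comp (hc.congr_of_eventuallyEq hd)
  refine ⟨md ℝ ER d 0 1, ?_⟩
  rw [← md_comp_apply_of_eq hd0 (smoothAt_incl hi x).diffAt hds.diffAt, md_congr hd, hcv]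

include hzero hlam in
lemma md_projZero_eq (x : GZero gr P B) (v : E0) :
    md E0 EM (C.projZero gr) x v
      = md EL EM (C.projLam lam) (piLam B lam x) (md E0 EL (piLam B lam) x v) := by
  have h1 : SmoothAt EL EM (C.projLam lam) (piLam B lam x) :=
    hlam.smoothAt_of_comp (g := C.projLam lam) (f := piLam B lam) (smoothAt_projZero C hzero x)
  rw [← md_comp_apply h1.diffAt (smoothAt_piLam hlam x).diffAt]
  rfl

-- A tangent vector `w` of `M` is moved by `Ts`, lifted through `π_λ`, and is then tangent to the
-- reduction by `exists_md_incl`; since `s` is a section, it projects back to `w`. So the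
-- transversality hypothesis still holds on the reduction.
include hzero hlam hi in
lemma md_proj_toFun_incl_surjective (x : reduction s) :
    Function.Surjective (md ER EM (fun y => C.proj (σ.toFun (incl s y))) x) := by
  rw [funext fun y => proj_toFun σ (incl s y)]
  intro w
  obtain ⟨v, hv⟩ := (hlam.isSubmersionAt (incl s x)).md_surjective
    (md EM EL s.toFun (C.projZero gr (incl s x)) w)
  obtain ⟨u, hu⟩ := exists_md_incl hlam hi x hv
  refine ⟨u, ?_⟩
  have h1 : SmoothAt EL EM (C.projLam lam) (s.toFun (C.projZero gr (incl s x))) := by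
    rw [← piLam_incl]
    exact hlam.smoothAt_of_comp (g := C.projLam lam) (f := piLam B lam)
      (smoothAt_projZero C hzero _)
  rw [md_comp_apply (smoothAt_projZero C hzero _).diffAt (smoothAt_incl hi x).diffAt, hu,
    md_projZero_eq hzero hlam, hv, piLam_incl, ← md_comp_apply h1.diffAt (s.smoothAt _).diffAt,
    funext s.isSection, md_id]
  rfl

/-! ### Exact automorphisms -/

include hzero hi in
lemma contMDiff_restrict {H : GZero gr P B → GZero gr P B} (hH : ∀ x, SmoothAt E0 E0 H x)
    (hm : ∀ x ∈ reduction s, H x ∈ reduction s) :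
    ContMDiff 𝓘(ℝ, ER) 𝓘(ℝ, ER) ∞ (fun x : reduction s => (⟨H x, hm x x.2⟩ : reduction s)) :=
  fun x => hi.smoothAt_of_comp (SmoothAt.comp' (g := H) (f := incl s) (hH _) (smoothAt_incl hi x))

/-- The restriction of `Φ_0` to the reduction, for an exact automorphism `Φ`. -/
noncomputable def redDiffeo
    (hzero : Manifold.IsSubmersion 𝓘(ℝ, EB) 𝓘(ℝ, E0) ∞ (piPlus gr P B))
    (hi : Manifold.IsSmoothEmbedding 𝓘(ℝ, ER) 𝓘(ℝ, E0) ∞ (incl s))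
    {Φ : C.Aut} (h : IsExactAut s Φ) :
    reduction s ≃ₘ^∞⟮𝓘(ℝ, ER), 𝓘(ℝ, ER)⟯ reduction s where
  toFun x := ⟨zeroMap gr Φ x, zeroMap_mem_reduction h x.2⟩
  invFun y := ⟨mapZero gr P Φ.toDiffeo.symm Φ.symm_equivariant y, mapZero_symm_mem_reduction h y.2⟩
  left_inv x := Subtype.ext (mapZero_symm_mapZero (gr := gr) Φ (incl s x))
  right_inv y := Subtype.ext (mapZero_mapZero_symm (gr := gr) Φ (incl s y))
  contMDiff_toFun := contMDiff_restrict hzero hi (contMDiff_mapZero hzero Φ)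
    fun _ => zeroMap_mem_reduction h
  contMDiff_invFun := contMDiff_restrict hzero hi (contMDiff_mapZero_symm hzero Φ)
    fun _ => mapZero_symm_mem_reduction h

-- Preserving `s` and preserving `𝒢̄_0` are the same. As `B(Z, ω)` pulls back to zero on `𝒢̄_0`, the
-- uniqueness theorem makes `σ̄` commute with `Φ` there, which gives invariance of `σ̄^*ω_≤`.
include hzero hlam hi in
theorem exactAut_iff (hP : IsParabolicSubgroup gr P EP) (hZ : gr.IsScaling Z)
    (hs : IsExactWith σ lam s) (Φ : C.Aut) : IsExactAut s Φ ↔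
      Set.MapsTo (zeroMap gr Φ) (reduction s) (reduction s) ∧
      ∃ Ψ : GeomAut (rightRed s) (redFormLe (ER := ER) σ s),
        ∀ x, (Ψ.toDiffeo x : GZero gr P B) = zeroMap gr Φ x := by
  refine ⟨fun h => ⟨fun x => zeroMap_mem_reduction h, ⟨redDiffeo hzero hi h, ?_, ?_⟩, fun x => rfl⟩,
    fun h => isExactAut_of_mapsTo h.1⟩
  · exact fun g x => Subtype.ext (mapZero_rightZero gr P Φ.toDiffeo Φ.equivariant g x)
  · have hH : ∀ x, SmoothAt ER ER (redDiffeo hzero hi h) x := (redDiffeo hzero hi h).contMDiff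
    have h1 : ∀ x, σ.toFun (incl s (redDiffeo hzero hi h x)) = Φ.toDiffeo (σ.toFun (incl s x)) := by
      intro x
      have : Nonempty B := ⟨σ.toFun x⟩
      have h2 := eq_aut_of_pullScale (gr := gr) hP hZ σ.levi_inter_unip Φ
        (smoothAt_toFun_incl σ hi) hH (fun y => by rw [σ.isSection, σ.isSection]; rfl) x
        (md_proj_toFun_incl_surjective σ hzero hlam hi x) fun v => by
          rw [pullScale_incl σ hzero hlam hi hP hZ hs, pullScale_incl σ hzero hlam hi hP hZ hs]
          rfl
      rw [← h2]
      exact (Φ.toDiffeo.apply_symm_apply _).symm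
    funext x
    refine LinearMap.ext fun (v : ER) => ?_
    exact pullLe_aut (gr := gr) Φ (smoothAt_toFun_incl σ hi) hH h1 x v

include hzero in
lemma vecM_projZero (V : C.Inf) (x : GZero gr P B) :
    vecM V (C.projZero gr x) = md E0 EM (C.projZero gr) x (vecZero gr E0 V x) := by
  obtain ⟨u, rfl⟩ := piPlus_surjective x
  rw [vecZero_piPlus hzero, md_projZero_piPlus C hzero]
  exact vecM_proj V u

include hzero hlam in
lemma isExactInf_iff (V : C.Inf) : IsExactInf E0 s V ↔
    ∀ m, md EM EL s.toFun m (vecM V m) = vecLam E0 lam EL V (s.toFun m) :=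
  forall_congr' fun m => hasMFDerivAt_flow_iff (smoothField_baseField V)
    (smoothField_lamField hzero hlam V) (s.smoothAt m).diffAt

-- The inclusion has injective derivative, so invariance can be checked in `𝒢_0`, where it holds for
-- `𝐗_0`.
include hzero hi in
lemma md_rightRed (V : C.Inf) {W : reduction s → ER}
    (hW : ∀ x, md ER E0 (incl s) x (W x) = vecZero gr E0 V (incl s x)) (g : lam.hom.ker)
    (x : reduction s) : md ER ER (rightRed s g) x (W x) = W (rightRed s g x) := by
  have h1 : SmoothAt ER ER (rightRed s g) x := hi.smoothAt_of_comp
    (SmoothAt.comp' (g := rightZero gr P B g) (f := incl s) (smoothAt_rightZero hzero g _ C)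
      (smoothAt_incl hi x))
  refine (hi.isImmersion.isImmersionAt (rightRed s g x)).md_injective ?_
  refine Eq.trans ?_ (hW _).symm
  rw [← md_comp_apply (smoothAt_incl hi _).diffAt h1.diffAt]
  refine Eq.trans ?_ (vecZero_rightZero hzero V g (incl s x))
  rw [← hW, ← md_comp_apply (smoothAt_rightZero hzero g (incl s x) C).diffAt
    (smoothAt_incl hi x).diffAt]
  rfl

-- The flow condition says that `s` relates `X` to `𝐗_λ`, which amounts to tangency of `𝐗_0` to
-- `𝒢̄_0`. Since `σ̄^* B(Z, ω) = 0`, its Lie derivative vanishes for the restricted field, and the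
-- infinitesimal uniqueness theorem gives the invariance of `σ̄^*ω_≤`.
include hzero hlam hi in
theorem exactInf_iff (hP : IsParabolicSubgroup gr P EP) (hZ : gr.IsScaling Z)
    (hs : IsExactWith σ lam s) (V : C.Inf) : IsExactInf E0 s V ↔
      ∃ W : InfAut (rightRed s) (redFormLe (ER := ER) σ s),
        ∀ x, md ER E0 (incl s) x (W.field x) = vecZero gr E0 V (incl s x) := by
  rw [isExactInf_iff hzero hlam]
  constructor
  · intro h
    have h1 : ∀ x : reduction s, ∃ u : ER, md ER E0 (incl s) x u = vecZero gr E0 V (incl s x) :=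
      fun x => exists_md_incl hlam hi x (w := vecM V (C.projZero gr (incl s x)))
        (by rw [← vecLam_piLam hzero hlam, h, piLam_incl])
    choose W hW using h1
    have hWs : SmoothField (E := ER) (X := reduction s) W :=
      smoothField_of_immersion hi.isImmersion (smoothField_zeroField hzero V) hW
    have hf : ContMDiff 𝓘(ℝ, ER) 𝓘(ℝ, EB) ∞ (fun x => σ.toFun (incl s x)) :=
      smoothAt_toFun_incl σ hi
    refine ⟨⟨W, hWs, md_rightRed hzero hi V hW, ?_⟩, hW⟩
    refine lieDerivFormZero_pullLe (gr := gr) V hf hWs fun x => ?_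
    refine eq_inf_of_lieForm hP hZ hzero V hf hWs (fun y => ?_) x
      (md_proj_toFun_incl_surjective σ hzero hlam hi x) fun v => ?_
    · rw [funext fun y => σ.isSection (incl s y), σ.isSection]
      exact hW y
    · rw [funext (pullScale_incl σ hzero hlam hi hP hZ hs)]
      exact lieForm_zero W x v
  -- On the reduction `π_λ = s ∘ π_0`; differentiating this along the tangent field `𝐗_0` gives
  -- `Ts(X) = 𝐗_λ`.
  · rintro ⟨W, hW⟩ m
    obtain ⟨x, rfl⟩ := exists_mem_reduction s m
    have h1 := md_piLam_incl hzero hlam hi x (W.field x)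
    rw [hW, ← vecLam_piLam hzero hlam, ← vecM_projZero hzero, piLam_incl] at h1
    exact h1.symm

end ExactAutomorphisms

end ParabolicWeyl

/-! ### The lemma on automorphisms of Weyl structures -/

theorem lemma2p5
    -- a semisimple Lie group `G` with a `|k|`-graded Lie algebra and a parabolic subgroup `P`
    {EG : Type*} [NormedAddCommGroup EG] [NormedSpace ℝ EG] [FiniteDimensional ℝ EG]
    {G : Type*} [TopologicalSpace G] [T2Space G] [ChartedSpace EG G] [Group G]
    [LieGroup 𝓘(ℝ, EG) ∞ G]
    [LieAlgebra.IsSemisimple ℝ (GroupLieAlgebra 𝓘(ℝ, EG) G)]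
    {k : ℕ} (gr : Grading (GroupLieAlgebra 𝓘(ℝ, EG) G) k)
    {EP : Type*} [NormedAddCommGroup EP] [NormedSpace ℝ EP] [FiniteDimensional ℝ EP]
    (P : Subgroup G) [ChartedSpace EP P] [LieGroup 𝓘(ℝ, EP) ∞ P]
    (hP : IsParabolicSubgroup gr P EP)
    -- a parabolic geometry `(𝒢 → M, ω)` of type `(G, P)`
    {EB : Type*} [NormedAddCommGroup EB] [NormedSpace ℝ EB] [FiniteDimensional ℝ EB]
    {B : Type*} [TopologicalSpace B] [T2Space B] [ChartedSpace EB B] [IsManifold 𝓘(ℝ, EB) ∞ B]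
    [MulAction (↥P)ᵐᵒᵖ B]
    {EM : Type*} [NormedAddCommGroup EM] [NormedSpace ℝ EM] [FiniteDimensional ℝ EM]
    {M : Type*} [TopologicalSpace M] [T2Space M] [ChartedSpace EM M] [IsManifold 𝓘(ℝ, EM) ∞ M]
    (C : CartanGeometry EG EP EB EM P B M)
    -- the quotient manifold structure on `𝒢_0 = 𝒢 / P_+`
    {E0 : Type*} [NormedAddCommGroup E0] [NormedSpace ℝ E0] [FiniteDimensional ℝ E0]
    [T2Space (GZero gr P B)] [ChartedSpace E0 (GZero gr P B)]
    [IsManifold 𝓘(ℝ, E0) ∞ (GZero gr P B)]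
    (hzero : Manifold.IsSubmersion 𝓘(ℝ, EB) 𝓘(ℝ, E0) ∞ (piPlus gr P B))
    -- a scale representation `λ` and the quotient manifold structure on `𝓛^λ = 𝒢_0 / Ker λ`
    (Z : GroupLieAlgebra 𝓘(ℝ, EG) G) (hZ : gr.IsScaling Z) (lam : ScaleRep gr P Z)
    {EL : Type*} [NormedAddCommGroup EL] [NormedSpace ℝ EL] [FiniteDimensional ℝ EL]
    [T2Space (ScaleBundle B lam)] [ChartedSpace EL (ScaleBundle B lam)]
    [IsManifold 𝓘(ℝ, EL) ∞ (ScaleBundle B lam)]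
    (hlam : Manifold.IsSubmersion 𝓘(ℝ, E0) 𝓘(ℝ, EL) ∞ (piLam (gr := gr) (P := P) B lam))
    -- a Weyl structure
    (σ : WeylStructure gr C E0) :
    -- automorphisms
    (∀ Φ : C.Aut, List.TFAE
      [IsWeylAut σ Φ,
       ∃ Ψ : GeomAut (rightZero gr P B) (weylFormLe σ), ∀ x, Ψ.toDiffeo x = zeroMap gr Φ x,
       pullbackForm (mapLam lam Φ.toDiffeo Φ.equivariant) (scaleConnection (EL := EL) σ lam)
        = scaleConnection (EL := EL) σ lam]) ∧
    -- infinitesimal automorphisms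
    (∀ V : C.Inf, IsWeylInf σ V ↔
      ∃ W : InfAut (rightZero gr P B) (weylFormLe σ), ∀ x, W.field x = zeroField gr V x) ∧
    -- exact Weyl structures: `σ` corresponds to the scale `s`, and the reduction `𝒢̄_0` carries
    -- its structure of an embedded submanifold of `𝒢_0`
    (∀ (s : Scale C lam EL), IsExactWith σ lam s →
      ∀ (ER : Type*) [NormedAddCommGroup ER] [NormedSpace ℝ ER] [FiniteDimensional ℝ ER]
        [ChartedSpace ER (reduction s)] [IsManifold 𝓘(ℝ, ER) ∞ (reduction s)],
        Manifold.IsSmoothEmbedding 𝓘(ℝ, ER) 𝓘(ℝ, E0) ∞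
          (fun x : reduction s => (x : GZero gr P B)) →
        (∀ Φ : C.Aut, IsExactAut s Φ ↔
          Set.MapsTo (zeroMap gr Φ) (reduction s) (reduction s) ∧
          ∃ Ψ : GeomAut (rightRed s) (redFormLe (ER := ER) σ s),
            ∀ x, (Ψ.toDiffeo x : GZero gr P B) = zeroMap gr Φ x) ∧
        (∀ V : C.Inf, IsExactInf E0 s V ↔
          ∃ W : InfAut (rightRed s) (redFormLe (ER := ER) σ s), ∀ x,
            mfderiv 𝓘(ℝ, ER) 𝓘(ℝ, E0) (fun x : reduction s => (x : GZero gr P B)) x (W.field x)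
              = zeroField gr V (x : GZero gr P B))) := by
  -- The nondegenerate Killing form assumed by the preceding results comes from semisimplicity, by
  -- Cartan's criterion, through instance search.
  refine ⟨fun Φ => weylAut_tfae σ hP hZ hzero hlam Φ, fun V => weylInf_iff σ hzero hP hZ V,
    fun s hs ER _ _ _ _ _ hi => ⟨fun Φ => exactAut_iff σ hzero hlam hi hP hZ hs Φ,
      fun V => exactInf_iff σ hzero hlam hi hP hZ hs V⟩⟩
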